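/- Let $M$ be a closed (compact, without boundary) smooth manifold and let $h,k\ge 0$ be integers. A pair $(\alpha,\beta)$ of smooth $1$-forms on $M$ is called a contact pair of type $(h,k)$ if $\alpha\wedge(d\alpha)^h\wedge\beta\wedge(d\beta)^k$ is a volume form (in particular $\dim M=2h+2k+2$), $(d\alpha)^{h+1}=0$ and $(d\beta)^{k+1}=0$. The kernel of a form $\theta$ is the distribution of all tangent vectors $v$ with $i_v\theta=0$. Let $(\alpha_t,\beta_t)$, $t\in[0,1]$, be a family of contact pairs of type $(h,k)$ on $M$ that depends smoothly on $(t,x)\in[0,1]\times M$, and suppose that the kernel foliations $\mathcal F=\operatorname{Ker}(\alpha_t\wedge(d\alpha_t)^h)$ and $\mathcal G=\operatorname{Ker}(\beta_t\wedge(d\beta_t)^k)$ are independent of $t\in[0,1]$. Then there exist an isotopy $\varphi_t$, $t\in[0,1]$ (diffeomorphisms of $M$ depending smoothly on $(t,x)\in[0,1]\times M$, with $\varphi_0=\mathrm{id}_M$), and nowhere vanishing functions $f_t,g_t$ on $M$, depending smoothly on $(t,x)\in[0,1]\times M$, such that for all $t\in[0,1]$ $$\varphi_t^*\alpha_t=f_t\,\alpha_0\quad\text{and}\quad\varphi_t^*\beta_t=g_t\,\beta_0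 .$$ -/

import Mathlib

open Set Bundle
open scoped Manifold ContDiff

noncomputable section

namespace ContactPairs

section LinearAlgebra

variable {V : Type*} [AddCommGroup V] [Module ℝ V]

/-- The exterior product of two alternating forms: the signed sum over all `(m, n)`-shuffles. -/
def wedge {m n : ℕ} (θ : V [⋀^Fin m]→ₗ[ℝ] ℝ) (η : V [⋀^Fin n]→ₗ[ℝ] ℝ) :
    V [⋀^Fin (m + n)]→ₗ[ℝ] ℝ :=
  ((LinearMap.mul' ℝ ℝ).compAlternatingMap (θ.domCoprod η)).domDomCongr finSumFinEquiv

/-- The exterior power `θ ∧ ⋯ ∧ θ` with `r` factors; for `r = 0` it is the `0`-form `1`. -/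
def wedgePow {m : ℕ} (θ : V [⋀^Fin m]→ₗ[ℝ] ℝ) : (r : ℕ) → V [⋀^Fin (m * r)]→ₗ[ℝ] ℝ
  | 0 => (AlternatingMap.constOfIsEmpty ℝ V (Fin 0) 1 : V [⋀^Fin 0]→ₗ[ℝ] ℝ)
  | r + 1 => wedge (wedgePow θ r) θ

/-- The kernel of an alternating form `θ`: all `v` with `i_v θ = 0`, that is, such that `θ`
vanishes as soon as one of its arguments is `v`. -/
def formKer {n : ℕ} (θ : V [⋀^Fin n]→ₗ[ℝ] ℝ) : Submodule ℝ V where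
  carrier := {v | ∀ (w : Fin n → V) (i : Fin n), θ (Function.update w i v) = 0}
  add_mem' := by
    intro a b ha hb w i
    rw [θ.map_update_add, ha w i, hb w i, add_zero]
  zero_mem' := by
    intro w i
    exact θ.map_coord_zero i (by simp)
  smul_mem' := by
    intro c a ha w i
    rw [θ.map_update_smul, ha w i, smul_zero]

/-- A linear functional as an alternating `1`-form. -/
def asForm (a : V →ₗ[ℝ] ℝ) : V [⋀^Fin 1]→ₗ[ℝ] ℝ :=
  AlternatingMap.ofSubsingleton ℝ V ℝ (0 : Fin 1) a

end LinearAlgebra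

section Manifold

variable (E : Type*) [NormedAddCommGroup E] [NormedSpace ℝ E]
variable (M : Type*) [TopologicalSpace M] [ChartedSpace E M] [IsManifold 𝓘(ℝ, E) ∞ M]

/-- Smooth `1`-forms on `M`: smooth sections of the cotangent bundle. -/
abbrev OneForm :=
  ContMDiffSection 𝓘(ℝ, E) (E →L[ℝ] ℝ) ∞
    (fun x : M ↦ TangentSpace 𝓘(ℝ, E) x →L[ℝ] Bundle.Trivial M ℝ x)

variable {E M}

/-- The value `α_x` of a `1`-form, a continuous linear functional on `T_x M`. -/
def OneForm.at (α : OneForm E M) (x : M) : TangentSpace 𝓘(ℝ, E) x →L[ℝ] ℝ := α x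

/-- The coordinate expression of a `1`-form in the preferred chart at `p`: the pullback of `α`
by the inverse of the chart. It is meaningful on the (open) target of the chart. -/
def OneForm.inChart (α : OneForm E M) (p : M) (y : E) : E →L[ℝ] ℝ :=
  (α.at ((extChartAt 𝓘(ℝ, E) p).symm y)).comp
    (mfderiv 𝓘(ℝ, E) 𝓘(ℝ, E) (extChartAt 𝓘(ℝ, E) p).symm y)

/-- The exterior derivative of a `1`-form at `p`: the exterior derivative of its coordinate
expression in the preferred chart at `p`. By the definition of `TangentSpace`, this chart
identifies `T_p M` with `E`. -/
def OneForm.d (α : OneForm E M) (p : M) : TangentSpace 𝓘(ℝ, E) p [⋀^Fin 2]→ₗ[ℝ] ℝ :=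
  (extDeriv (fun y : E ↦ ContinuousAlternatingMap.ofSubsingleton ℝ E ℝ (0 : Fin 1)
    (α.inChart p y)) (extChartAt 𝓘(ℝ, E) p p)).toAlternatingMap

/-- The `(2h+1)`-form `α ∧ (dα)^h` at `x`. -/
def OneForm.wedgeD (α : OneForm E M) (h : ℕ) (x : M) :
    TangentSpace 𝓘(ℝ, E) x [⋀^Fin (1 + 2 * h)]→ₗ[ℝ] ℝ :=
  wedge (asForm (α.at x).toLinearMap) (wedgePow (α.d x) h)

/-- A form of degree `n` (given pointwise) is a volume form if `n` is the dimension of the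
manifold and the form vanishes nowhere. -/
def IsVolumeForm {n : ℕ} (θ : ∀ x : M, TangentSpace 𝓘(ℝ, E) x [⋀^Fin n]→ₗ[ℝ] ℝ) : Prop :=
  Module.finrank ℝ E = n ∧ ∀ x, θ x ≠ 0

/-- `(α, β)` is a contact pair of type `(h, k)`: `α ∧ (dα)^h ∧ β ∧ (dβ)^k` is a volume form,
`(dα)^(h+1) = 0` and `(dβ)^(k+1) = 0`. -/
structure IsContactPair (h k : ℕ) (α β : OneForm E M) : Prop where
  isVolumeForm : IsVolumeForm fun x ↦ wedge (α.wedgeD h x) (β.wedgeD k x)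
  d_left_pow : ∀ x, wedgePow (α.d x) (h + 1) = 0
  d_right_pow : ∀ x, wedgePow (β.d x) (k + 1) = 0

/-- The (tangent distribution of the) kernel foliation `Ker (α ∧ (dα)^h)`. -/
def OneForm.kerFoliation (α : OneForm E M) (h : ℕ) (x : M) :
    Submodule ℝ (TangentSpace 𝓘(ℝ, E) x) :=
  formKer (α.wedgeD h x)

/-- The family `α t`, `t ∈ [0, 1]`, of `1`-forms is smooth: it depends smoothly on
`(t, x) ∈ [0, 1] × M`. -/
def IsSmoothFamily (α : ℝ → OneForm E M) : Prop :=
  ContMDiffOn (𝓘(ℝ, ℝ).prod 𝓘(ℝ, E)) (𝓘(ℝ, E).prod 𝓘(ℝ, E →L[ℝ] ℝ)) ∞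
    (fun q : ℝ × M ↦ (TotalSpace.mk' (E →L[ℝ] ℝ) q.2 (α q.1 q.2) :
      TotalSpace (E →L[ℝ] ℝ)
        (fun x : M ↦ TangentSpace 𝓘(ℝ, E) x →L[ℝ] Bundle.Trivial M ℝ x)))
    (Icc (0 : ℝ) 1 ×ˢ univ)

/-- The family `f t`, `t ∈ [0, 1]`, of functions depends smoothly on `(t, x) ∈ [0, 1] × M`. -/
def IsSmoothFunctionFamily (f : ℝ → M → ℝ) : Prop :=
  ContMDiffOn (𝓘(ℝ, ℝ).prod 𝓘(ℝ, E)) 𝓘(ℝ, ℝ) ∞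
    (fun q : ℝ × M ↦ f q.1 q.2) (Icc (0 : ℝ) 1 ×ˢ univ)

/-- The family `φ t`, `t ∈ [0, 1]`, of diffeomorphisms is an isotopy: it depends smoothly on
`(t, x) ∈ [0, 1] × M` and starts at the identity. -/
structure IsIsotopy (φ : ℝ → Diffeomorph 𝓘(ℝ, E) 𝓘(ℝ, E) M M ∞) : Prop where
  smooth : ContMDiffOn (𝓘(ℝ, ℝ).prod 𝓘(ℝ, E)) 𝓘(ℝ, E) ∞
    (fun q : ℝ × M ↦ φ q.1 q.2) (Icc (0 : ℝ) 1 ×ˢ univ)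
  map_zero : ∀ x, φ 0 x = x

/-- The pullback `φ^* α` at `x`. -/
def OneForm.pullback (φ : Diffeomorph 𝓘(ℝ, E) 𝓘(ℝ, E) M M ∞) (α : OneForm E M) (x : M) :
    TangentSpace 𝓘(ℝ, E) x →L[ℝ] ℝ :=
  (α.at (φ x)).comp (mfderiv 𝓘(ℝ, E) 𝓘(ℝ, E) φ x)

end Manifold

end ContactPairs

end

/-! This is the Gray–Moser argument. An isotopy generated by a time-dependent field `X` satisfies
d/dt φ_t^*α_t = φ_t^*(α_t' + L_X α_t). If α_t(X) = 0 and i_X dα_t = -α_t' + μ_t α_t, then for each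
fixed vector v the number (φ_t^*α_t)(v) solves a scalar linear equation c' = (μ_t ∘ φ_t) c. It
therefore vanishes for all times as soon as it vanishes once. Hence φ_t^*α_t vanishes on Ker α_0 and
is a multiple of α_0; the factor f_t = (φ_t^*α_t)(R_0), with R_0 the Reeb field of α_0, equals 1 at
t = 0 and never vanishes. The same field has to work for β_t.

The field is found pointwise. The condition (dα)^(h+1) = 0 bounds the rank of dα by 2h, and
similarly for dβ; together with the volume condition a dimension count gives TM = F ⊕ G with F = Ker
α ∩ Ker dα and G = Ker β ∩ Ker dβ (`isLinearContactPair_of_wedge`). The bilinear form dα + dβ + α⊗α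
+ β⊗β is then nondegenerate, so one linear equation defines X. Since F and G do not move, α_t'
vanishes on F and β_t' on G, and the single equation separates into the conditions for α and for β,
with μ_t = α_t'(R_t) and β_t'(S_t), where R_t and S_t are the Reeb fields (`grayVector_spec`).
Solving by inversion of operators shows that X is smooth.

Smoothness is required up to t = 0 and t = 1, so flows are built for derivatives within [0, 1].
Locally the integral equation is solved by inverting a smooth map on the Banach space of curves
(`exists_contDiff_solution`), and joint smoothness follows by induction through the linearized
equation (`contDiffOn_uncurry_solution`). Uniqueness and compactness globalize the flow
(`exists_isIsotopy`). The evolution of the pullback is computed in charts in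
`hasDerivWithinAt_pullback_flow`, and `pullbackVal_eq_smul` concludes. -/

noncomputable section

namespace ContactPairs

/-! ### Exterior algebra: kernels of wedge products and positivity of powers of a 2-form. -/

section Wedge

variable {V : Type*} [AddCommGroup V] [Module ℝ V]

/-- The wedge product as a normalized sum over all permutations. -/
theorem factorial_mul_wedge_apply {m n : ℕ} (θ : V [⋀^Fin m]→ₗ[ℝ] ℝ) (η : V [⋀^Fin n]→ₗ[ℝ] ℝ)
    (u : Fin (m + n) → V) :
    ((m.factorial * n.factorial : ℕ) : ℝ) * wedge θ η u =
      ∑ σ : Equiv.Perm (Fin m ⊕ Fin n), ((Equiv.Perm.sign σ : ℤ) : ℝ) *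
        (θ (fun i ↦ u (finSumFinEquiv (σ (Sum.inl i)))) *
          η (fun i ↦ u (finSumFinEquiv (σ (Sum.inr i))))) := by
  have h := congrArg (fun ζ ↦ LinearMap.mul' ℝ ℝ (ζ (u ∘ finSumFinEquiv)))
    (MultilinearMap.domCoprod_alternization_eq θ η)
  simp only [Fintype.card_fin, AlternatingMap.smul_apply, MultilinearMap.alternatization_apply,
    map_sum, map_nsmul] at h
  rw [wedge, AlternatingMap.domDomCongr_apply, LinearMap.compAlternatingMap_apply,
    ← nsmul_eq_mul]
  refine h.symm.trans (Finset.sum_congr rfl fun σ _ ↦ ?_)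
  rw [Units.smul_def, map_zsmul, zsmul_eq_mul]
  rfl

theorem mem_formKer_iff {n : ℕ} {θ : V [⋀^Fin n]→ₗ[ℝ] ℝ} {v : V} :
    v ∈ formKer θ ↔ ∀ (w : Fin n → V) (i : Fin n), w i = v → θ w = 0 := by
  constructor
  · intro h w i hi
    have := h w i
    rwa [← hi, Function.update_eq_self] at this
  · intro h w i
    exact h _ i (by simp)

/-- In each term of the permutation sum, the slot occupied by v is an argument either of `θ` or of
`η`. -/
theorem inf_formKer_le_formKer_wedge {m n : ℕ} (θ : V [⋀^Fin m]→ₗ[ℝ] ℝ)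
    (η : V [⋀^Fin n]→ₗ[ℝ] ℝ) : formKer θ ⊓ formKer η ≤ formKer (wedge θ η) := by
  rintro v ⟨h1, h2⟩
  rw [SetLike.mem_coe, mem_formKer_iff] at h1 h2
  rw [mem_formKer_iff]
  intro w i hi
  have hc : ((m.factorial * n.factorial : ℕ) : ℝ) ≠ 0 := by positivity
  refine (mul_eq_zero.1 ?_).resolve_left hc
  rw [factorial_mul_wedge_apply]
  refine Finset.sum_eq_zero fun σ _ ↦ ?_
  obtain ⟨j, rfl⟩ : ∃ j, finSumFinEquiv (σ j) = i :=
    ⟨σ.symm (finSumFinEquiv.symm i), by simp⟩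
  rcases j with j | j
  · rw [h1 _ j hi]; simp
  · rw [h2 _ j hi]; simp

theorem formKer_le_formKer_wedgePow {m : ℕ} (θ : V [⋀^Fin m]→ₗ[ℝ] ℝ) (r : ℕ) :
    formKer θ ≤ formKer (wedgePow θ r) := by
  induction r with
  | zero => intro v _ w i; exact i.elim0
  | succ r ih => exact (le_inf ih le_rfl).trans (inf_formKer_le_formKer_wedge _ _)

/-- A nonzero v extends to a basis. A top-degree form is determined by its values on injective
families of basis vectors; by cardinality each such family contains v, so a form with v in its
kernel is zero. -/
theorem formKer_eq_bot {n : ℕ} [FiniteDimensional ℝ V] (hn : Module.finrank ℝ V = n)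
    {θ : V [⋀^Fin n]→ₗ[ℝ] ℝ} (hθ : θ ≠ 0) : formKer θ = ⊥ := by
  rw [eq_bot_iff]
  intro v hv
  rw [mem_formKer_iff] at hv
  rw [Submodule.mem_bot]
  by_contra hne
  apply hθ
  have hli : LinearIndepOn ℝ id ({v} : Set V) := LinearIndepOn.singleton hne
  let b := Module.Basis.extend hli
  have : Fintype (hli.extend (subset_univ _)) := FiniteDimensional.fintypeBasisIndex b
  refine Module.Basis.ext_alternating b fun w hw ↦ ?_
  have hcard : Fintype.card (Fin n) = Fintype.card (hli.extend (subset_univ _)) := by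
    rw [Fintype.card_fin, ← hn, Module.finrank_eq_card_basis b]
  have hbij := (Fintype.bijective_iff_injective_and_card w).2 ⟨hw, hcard⟩
  obtain ⟨i, hi⟩ := hbij.2 ⟨v, hli.subset_extend (subset_univ _) rfl⟩
  rw [hv _ i (by simp [hi, b])]
  rfl

/-- The bilinear form of an alternating `2`-form. -/
def bilin (ζ : V [⋀^Fin 2]→ₗ[ℝ] ℝ) : V →ₗ[ℝ] V →ₗ[ℝ] ℝ :=
  LinearMap.mk₂ ℝ (fun x y ↦ ζ ![x, y])
    (fun x x' y ↦ ζ.map_vecCons_add _ _ _)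
    (fun c x y ↦ ζ.map_vecCons_smul _ _ _)
    (fun x y y' ↦ by
      have h : ∀ z, Function.update ![x, y] 1 z = ![x, z] := fun z ↦ by
        ext j; fin_cases j <;> simp
      simpa only [h] using ζ.map_update_add ![x, y] 1 y y')
    (fun c x y ↦ by
      have h : ∀ z, Function.update ![x, y] 1 z = ![x, z] := fun z ↦ by
        ext j; fin_cases j <;> simp
      simpa only [h] using ζ.map_update_smul ![x, y] 1 c y)

theorem bilin_apply (ζ : V [⋀^Fin 2]→ₗ[ℝ] ℝ) (x y : V) : bilin ζ x y = ζ ![x, y] := rfl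

theorem bilin_self (ζ : V [⋀^Fin 2]→ₗ[ℝ] ℝ) (x : V) : bilin ζ x x = 0 :=
  ζ.map_eq_zero_of_eq _ (i := 0) (j := 1) rfl (by decide)

theorem bilin_swap (ζ : V [⋀^Fin 2]→ₗ[ℝ] ℝ) (x y : V) : bilin ζ x y = -bilin ζ y x := by
  have h := bilin_self ζ (x + y)
  simp only [map_add, LinearMap.add_apply, bilin_self] at h
  linarith

theorem ker_bilin_le_formKer (ζ : V [⋀^Fin 2]→ₗ[ℝ] ℝ) : LinearMap.ker (bilin ζ) ≤ formKer ζ := by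
  intro v hv
  rw [mem_formKer_iff]
  intro w i hi
  have hw : w = ![w 0, w 1] := by ext j; fin_cases j <;> rfl
  rw [LinearMap.mem_ker] at hv
  rw [hw, ← bilin_apply]
  fin_cases i
  · simp only [Fin.zero_eta] at hi; rw [hi, hv]; rfl
  · simp only [Fin.mk_one] at hi; rw [hi, bilin_swap, hv]; simp

theorem ker_le_formKer_asForm (a : V →ₗ[ℝ] ℝ) : LinearMap.ker a ≤ formKer (asForm a) := by
  intro v hv
  rw [mem_formKer_iff]
  intro w i hi
  rw [Subsingleton.elim i 0] at hi
  change a (w 0) = 0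
  rw [hi]; exact hv

/-- `u` is the family `e₁, f₁, …, e_r, f_r` of a symplectic basis of a subspace. -/
def IsSymplecticFamily (ζ : V [⋀^Fin 2]→ₗ[ℝ] ℝ) {r : ℕ} (u : Fin (2 * r) → V) : Prop :=
  ∀ i j, ζ ![u i, u j] =
    if (i : ℕ) / 2 = j / 2 then (if i < j then 1 else if j < i then -1 else 0) else 0

/-- Deletes one pair from a family: the pair at positions p, p + 1 is replaced by the pair at 2r, 2r
+ 1. Pairs go to pairs with their order kept, so the pattern of values survives. -/
theorem IsSymplecticFamily.comp_pairSwap {ζ : V [⋀^Fin 2]→ₗ[ℝ] ℝ} {r s : ℕ}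
    {u : Fin (2 * s) → V} (hu : IsSymplecticFamily ζ u) (p : ℕ) (hp : p % 2 = 0)
    (f : Fin (2 * r) → Fin (2 * s))
    (hf : ∀ i, (f i : ℕ) = if (i : ℕ) = p then 2 * r else if (i : ℕ) = p + 1 then 2 * r + 1
      else i) : IsSymplecticFamily ζ (fun i ↦ u (f i)) := by
  intro i j
  have hi2 := i.2
  have hj2 := j.2
  have h1 : (f i : ℕ) / 2 = f j / 2 ↔ (i : ℕ) / 2 = j / 2 := by
    rw [hf, hf]; split_ifs <;> omega
  refine (hu _ _).trans ?_
  simp only [Fin.lt_def, h1]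
  by_cases hij : (i : ℕ) / 2 = j / 2
  · have h2 : (f i : ℕ) < f j ↔ (i : ℕ) < j := by rw [hf, hf]; split_ifs <;> omega
    have h3 : (f j : ℕ) < f i ↔ (j : ℕ) < i := by rw [hf, hf]; split_ifs <;> omega
    simp only [h2, h3]
  · rw [if_neg hij, if_neg hij]

/-- In the permutation sum for ζ^r ∧ ζ only the terms survive in which the last factor receives a
pair e_j, f_j. For such a term, the sign of the permutation cancels against the reordering of the
remaining r pairs, which again form a symplectic family. So no term is negative, and the identity
contributes a positive one. -/
theorem wedgePow_pos_of_isSymplecticFamily (ζ : V [⋀^Fin 2]→ₗ[ℝ] ℝ) (r : ℕ) :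
    ∀ u : Fin (2 * r) → V, IsSymplecticFamily ζ u → 0 < wedgePow ζ r u := by
  induction r with
  | zero =>
    intro u _
    change (0 : ℝ) < 1
    exact one_pos
  | succ r ih =>
    intro u hu
    have hfac : (0 : ℝ) < (((2 * r).factorial * Nat.factorial 2 : ℕ) : ℝ) := by positivity
    refine pos_of_mul_pos_right (a := (((2 * r).factorial * Nat.factorial 2 : ℕ) : ℝ)) ?_ hfac.le
    change 0 < _ * wedge (wedgePow ζ r) ζ u
    rw [factorial_mul_wedge_apply]
    let e : Fin (2 * r) ⊕ Fin 2 ≃ Fin (2 * r + 2) := finSumFinEquiv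
    set T : Equiv.Perm (Fin (2 * r) ⊕ Fin 2) → ℝ := fun σ ↦ ((Equiv.Perm.sign σ : ℤ) : ℝ) *
        (wedgePow ζ r (fun i ↦ u (e (σ (Sum.inl i)))) *
          ζ (fun i ↦ u (e (σ (Sum.inr i))))) with hT
    change 0 < ∑ σ, T σ
    have hζ : ∀ w : Fin 2 → V, ζ w = ζ ![w 0, w 1] := fun w ↦ by
      congr 1; ext j; fin_cases j <;> rfl
    -- a term whose last two arguments are a pair in the right order is positive
    have key : ∀ σ, ((e (σ (Sum.inr 0)) : ℕ) / 2 = e (σ (Sum.inr 1)) / 2) →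
        e (σ (Sum.inr 0)) < e (σ (Sum.inr 1)) → 0 < T σ := by
      intro σ h2 hlt
      set p := e (σ (Sum.inr 0)) with hp
      set q := e (σ (Sum.inr 1)) with hq
      have hpq : (q : ℕ) = p + 1 ∧ (p : ℕ) % 2 = 0 := by
        have : (p : ℕ) < q := hlt
        omega
      let l₀ : Fin (2 * r + 2) := e (Sum.inr 0)
      let l₁ : Fin (2 * r + 2) := e (Sum.inr 1)
      have hl₀ : (l₀ : ℕ) = 2 * r := rfl
      have hl₁ : (l₁ : ℕ) = 2 * r + 1 := rfl
      -- This exchanges the chosen pair with the last one. It is a product of two transpositions, or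
      -- trivial, hence even.
      let ρ : Equiv.Perm (Fin (2 * r + 2)) := Equiv.swap p l₀ * Equiv.swap q l₁
      have hρval : ∀ i, ((ρ i : Fin (2 * r + 2)) : ℕ) =
          if (i : ℕ) = p then 2 * r else if (i : ℕ) = q then 2 * r + 1 else
            if (i : ℕ) = 2 * r then (p : ℕ) else if (i : ℕ) = 2 * r + 1 then (q : ℕ) else i := by
        intro i
        have hpl := p.2
        simp only [ρ, Equiv.Perm.mul_apply, Equiv.swap_apply_def]
        simp only [Fin.ext_iff, hl₀, hl₁]
        split_ifs <;> simp only [hl₀, hl₁] at * <;> omega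
      have hρρ : ∀ i, ρ (ρ i) = i := by
        intro i
        apply Fin.ext
        have hpl := p.2
        rw [hρval, hρval]
        split_ifs <;> omega
      have hsign : Equiv.Perm.sign ρ = 1 := by
        by_cases hpr : p = l₀
        · have hqr : q = l₁ := by apply Fin.ext; rw [hl₁, hpq.1, hpr, hl₀]
          simp [ρ, hpr, hqr]
        · have hqr : q ≠ l₁ := by
            intro h; apply hpr; apply Fin.ext
            have := congrArg Fin.val h; omega
          simp [ρ, Equiv.Perm.sign_swap hpr, Equiv.Perm.sign_swap hqr]
      let σ' : Equiv.Perm (Fin (2 * r) ⊕ Fin 2) := (e.permCongr.symm ρ) * σ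
      have hσ' : ∀ x, σ' x = e.symm (ρ (e (σ x))) := fun x ↦ rfl
      have hsσ' : Equiv.Perm.sign σ' = Equiv.Perm.sign σ := by
        simp only [σ', Equiv.Perm.sign_mul]
        rw [show Equiv.Perm.sign (e.permCongr.symm ρ) = 1 from
          (Equiv.Perm.sign_permCongr e.symm ρ).trans hsign, one_mul]
      have hfix : ∀ j, σ' (Sum.inr j) = Sum.inr j := by
        intro j
        rw [hσ', Equiv.symm_apply_eq]
        apply Fin.ext
        have hpl := p.2
        fin_cases j
        · change ((ρ p : Fin (2 * r + 2)) : ℕ) = l₀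
          rw [hρval, hl₀]; simp
        · change ((ρ q : Fin (2 * r + 2)) : ℕ) = l₁
          rw [hρval, hl₁]; split_ifs <;> omega
      have hmaps : MapsTo σ' (range Sum.inl) (range Sum.inl) := by
        rintro _ ⟨i, rfl⟩
        rcases hs : σ' (Sum.inl i) with k | k
        · exact ⟨k, rfl⟩
        · rw [← hfix k] at hs
          exact absurd (σ'.injective hs) (by simp)
      obtain ⟨⟨τ, τ₂⟩, hτ⟩ := Equiv.Perm.mem_sumCongrHom_range_of_perm_mapsTo_inl hmaps
      have hτ₂ : τ₂ = 1 := by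
        ext j
        have := hfix j
        rw [← hτ] at this
        simpa using congrArg (fun z ↦ Sum.elim (fun _ ↦ 0) Fin.val z) this
      have hinl : ∀ i, σ' (Sum.inl i) = Sum.inl (τ i) := by
        intro i; rw [← hτ]; simp
      have hsτ : Equiv.Perm.sign τ = Equiv.Perm.sign σ := by
        rw [← hsσ', ← hτ, hτ₂]; simp
      have hback : ∀ i, e (σ (Sum.inl i)) = ρ (e (Sum.inl (τ i))) := by
        intro i
        rw [← hinl, hσ', Equiv.apply_symm_apply, hρρ]
      have hsym : IsSymplecticFamily ζ (fun i : Fin (2 * r) ↦ u (ρ (e (Sum.inl i)))) :=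
        hu.comp_pairSwap p hpq.2 (fun i ↦ ρ (e (Sum.inl i))) fun i ↦ by
          have hi : ((e (Sum.inl i) : Fin (2 * r + 2)) : ℕ) = i := rfl
          have hi2 := i.2
          rw [hρval, hi, hpq.1, if_neg (by omega : ¬ (i : ℕ) = 2 * r),
            if_neg (by omega : ¬ (i : ℕ) = 2 * r + 1)]
      have hpos := ih _ hsym
      have hv1 : ζ (fun i ↦ u (e (σ (Sum.inr i)))) = 1 := by
        rw [hζ]
        refine (hu p q).trans ?_
        rw [if_pos h2, if_pos hlt]
      have hv2 : wedgePow ζ r (fun i ↦ u (e (σ (Sum.inl i)))) =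
          ((Equiv.Perm.sign σ : ℤ) : ℝ) *
            wedgePow ζ r (fun i ↦ u (ρ (e (Sum.inl i)))) := by
        have := (wedgePow ζ r).map_perm (fun i ↦ u (ρ (e (Sum.inl i)))) τ
        rw [Units.smul_def, zsmul_eq_mul, hsτ] at this
        rw [← this]
        congr 1
        ext i
        simp only [Function.comp]
        rw [hback]
      simp only [hT]
      rw [hv1, hv2, mul_one, ← mul_assoc]
      have : ((Equiv.Perm.sign σ : ℤ) : ℝ) * ((Equiv.Perm.sign σ : ℤ) : ℝ) = 1 := by
        rw [← Int.cast_mul, ← Units.val_mul, Int.units_mul_self]; simp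
      rw [this, one_mul]
      exact hpos
    -- Exchanging the two arguments of the last factor changes both the sign of `σ` and the sign of
    -- `ζ`; this reduces the wrong order to `key`.
    have hswap : ∀ σ, T (σ * Equiv.swap (Sum.inr 0) (Sum.inr 1)) = T σ := by
      intro σ
      simp only [hT, Equiv.Perm.sign_mul, Equiv.Perm.mul_apply]
      rw [Equiv.Perm.sign_swap (by simp), hζ (fun i ↦ u (e (σ (Sum.inr i)))),
        hζ, Equiv.swap_apply_left, Equiv.swap_apply_right]
      have h1 : ∀ i : Fin (2 * r), Equiv.swap (Sum.inr 0) (Sum.inr 1 : Fin (2 * r) ⊕ Fin 2)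
          (Sum.inl i) = Sum.inl i :=
        fun i ↦ Equiv.swap_apply_of_ne_of_ne (by simp) (by simp)
      simp only [h1]
      have h2 := bilin_swap ζ (u (e (σ (Sum.inr 1)))) (u (e (σ (Sum.inr 0))))
      rw [bilin_apply, bilin_apply] at h2
      rw [h2]
      push_cast
      ring
    have hnonneg : ∀ σ, 0 ≤ T σ := by
      intro σ
      by_cases h2 : (e (σ (Sum.inr 0)) : ℕ) / 2 = e (σ (Sum.inr 1)) / 2
      · rcases lt_trichotomy (e (σ (Sum.inr 0))) (e (σ (Sum.inr 1))) with h | h | h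
        · exact (key σ h2 h).le
        · exact absurd (σ.injective (e.injective h)) (by simp)
        · rw [← hswap]
          refine (key _ ?_ ?_).le
          · simp only [Equiv.Perm.mul_apply, Equiv.swap_apply_left, Equiv.swap_apply_right]
            exact h2.symm
          · simpa only [Equiv.Perm.mul_apply, Equiv.swap_apply_left, Equiv.swap_apply_right]
              using h
      · have : ζ (fun i ↦ u (e (σ (Sum.inr i)))) = 0 := by
          rw [hζ]
          refine (hu _ _).trans ?_
          rw [if_neg h2]
        simp only [hT, this, mul_zero, le_refl]
    refine Finset.sum_pos' (fun σ _ ↦ hnonneg σ) ⟨1, Finset.mem_univ _, key 1 ?_ ?_⟩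
    · simp [e]; omega
    · simp [e, Fin.lt_def]

end Wedge

/-- The pointwise linear algebra of a contact pair: `a` and `b` are the values of the two
`1`-forms, `ζ` and `η` those of their exterior derivatives. -/
structure IsLinearContactPair {V : Type*} [AddCommGroup V] (a b : V → ℝ) (ζ η : V → V → ℝ) :
    Prop where
  left_self : ∀ v, ζ v v = 0
  right_self : ∀ v, η v v = 0
  disjoint : ∀ v, a v = 0 → ζ v = 0 → b v = 0 → η v = 0 → v = 0
  exists_add : ∀ v, ∃ f g, v = f + g ∧ (a f = 0 ∧ ζ f = 0) ∧ (b g = 0 ∧ η g = 0)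
  exists_left : ∃ R, (b R = 0 ∧ η R = 0) ∧ a R = 1 ∧ ζ R = 0
  exists_right : ∃ S, (a S = 0 ∧ ζ S = 0) ∧ b S = 1 ∧ η S = 0

theorem ker_inf_ker_le_formKer {V : Type*} [AddCommGroup V] [Module ℝ V] (a : V →ₗ[ℝ] ℝ)
    (ζ : V [⋀^Fin 2]→ₗ[ℝ] ℝ) (h : ℕ) :
    LinearMap.ker a ⊓ LinearMap.ker (bilin ζ) ≤ formKer (wedge (asForm a) (wedgePow ζ h)) :=
  (inf_le_inf (ker_le_formKer_asForm a)
    ((ker_bilin_le_formKer ζ).trans (formKer_le_formKer_wedgePow ζ h))).trans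
    (inf_formKer_le_formKer_wedge _ _)

/-! ### Rank of a 2-form and the splitting of the tangent space by a contact pair. -/

section Rank

variable {V : Type*} [AddCommGroup V] [Module ℝ V] [FiniteDimensional ℝ V]

/-- Greedy construction of a symplectic basis. Given r pairs, let ker T be their B-orthogonal
complement. If B is nonzero on it, rescaling gives another pair; otherwise ker T lies in the radical
of B, and its codimension is at most 2r. -/
theorem exists_symplectic_or_finrank_le (B : V →ₗ[ℝ] V →ₗ[ℝ] ℝ) (hB : ∀ x, B x x = 0) (r : ℕ) :
    (∃ a b : Fin r → V, (∀ i j, B (a i) (a j) = 0) ∧ (∀ i j, B (b i) (b j) = 0) ∧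
      ∀ i j, B (a i) (b j) = if i = j then 1 else 0) ∨
    ∃ m, m + 1 ≤ r ∧ Module.finrank ℝ V ≤ Module.finrank ℝ (LinearMap.ker B) + 2 * m := by
  have hsw : ∀ x y, B x y = -B y x := by
    intro x y
    have h := hB (x + y)
    simp only [map_add, LinearMap.add_apply, hB] at h
    linarith
  induction r with
  | zero => exact Or.inl ⟨Fin.elim0, Fin.elim0, fun i ↦ i.elim0, fun i ↦ i.elim0, fun i ↦ i.elim0⟩
  | succ r ih =>
    rcases ih with ⟨a, b, haa, hbb, hab⟩ | ⟨m, hm, hle⟩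
    swap
    · exact Or.inr ⟨m, by omega, hle⟩
    let T : V →ₗ[ℝ] (Fin r → ℝ) × (Fin r → ℝ) :=
      (LinearMap.pi fun i ↦ B (a i)).prod (LinearMap.pi fun i ↦ B (b i))
    have hT : ∀ v, v ∈ LinearMap.ker T ↔ (∀ i, B (a i) v = 0) ∧ ∀ i, B (b i) v = 0 := by
      intro v
      simp [T, funext_iff]
    by_cases hW : ∃ e ∈ LinearMap.ker T, ∃ f ∈ LinearMap.ker T, B e f ≠ 0
    · obtain ⟨e, he, f, hf, hef⟩ := hW
      rw [hT] at he hf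
      left
      refine ⟨Fin.snoc a e, Fin.snoc b ((B e f)⁻¹ • f), ?_, ?_, ?_⟩
      · intro i j
        refine Fin.lastCases ?_ (fun i ↦ ?_) i <;> refine Fin.lastCases ?_ (fun j ↦ ?_) j
        · simp [hB]
        · simp only [Fin.snoc_last, Fin.snoc_castSucc]; rw [hsw, he.1, neg_zero]
        · simp only [Fin.snoc_last, Fin.snoc_castSucc]; exact he.1 i
        · simp only [Fin.snoc_castSucc]; exact haa i j
      · intro i j
        refine Fin.lastCases ?_ (fun i ↦ ?_) i <;> refine Fin.lastCases ?_ (fun j ↦ ?_) j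
        · simp [hB]
        · simp only [Fin.snoc_last, Fin.snoc_castSucc]; rw [hsw, map_smul, hf.2]; simp
        · simp only [Fin.snoc_last, Fin.snoc_castSucc]; rw [map_smul, hf.2]; simp
        · simp only [Fin.snoc_castSucc]; exact hbb i j
      · intro i j
        refine Fin.lastCases ?_ (fun i ↦ ?_) i <;> refine Fin.lastCases ?_ (fun j ↦ ?_) j
        · simp [hef]
        · simp only [Fin.snoc_last, Fin.snoc_castSucc]; rw [hsw, he.2, neg_zero,
            if_neg (Fin.castSucc_lt_last j).ne']
        · simp only [Fin.snoc_last, Fin.snoc_castSucc]; rw [map_smul, hf.1, smul_zero,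
            if_neg (Fin.castSucc_lt_last i).ne]
        · simp only [Fin.snoc_castSucc, Fin.castSucc_inj]; exact hab i j
    · push Not at hW
      right
      refine ⟨r, le_rfl, ?_⟩
      have hle : LinearMap.ker T ≤ LinearMap.ker B := by
        intro w hw
        rw [LinearMap.mem_ker]
        ext v
        rw [LinearMap.zero_apply]
        -- The projection of v to the span of the pairs, so that v - v₁ is orthogonal to all of
        -- them.
        let v₁ : V := ∑ i, (B v (b i) • a i - B v (a i) • b i)
        have hv : v - v₁ ∈ LinearMap.ker T := by
          rw [hT]
          have hba : ∀ i j, B (b i) (a j) = if i = j then -1 else 0 := by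
            intro i j; rw [hsw, hab]; by_cases h : i = j <;> simp [h, eq_comm]
          constructor
          · intro i
            simp only [v₁, map_sub, map_sum, map_smul, haa, hab, smul_eq_mul, mul_zero, zero_sub,
              mul_ite, mul_one, Finset.sum_neg_distrib, Finset.sum_ite_eq, Finset.mem_univ,
              if_true, hsw v]
            ring
          · intro i
            simp only [v₁, map_sub, map_sum, map_smul, hbb, hba, smul_eq_mul, mul_zero, sub_zero,
              mul_ite, mul_one, mul_neg, Finset.sum_ite_eq, Finset.mem_univ,
              if_true, hsw v]
            ring
        have h1 := hW w hw _ hv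
        rw [hT] at hw
        have h2 : B w v₁ = 0 := by
          simp only [v₁, map_sub, map_sum, map_smul]
          refine Finset.sum_eq_zero fun i _ ↦ ?_
          rw [hsw w, hsw w, hw.1, hw.2]; simp
        rw [map_sub, h2, sub_zero] at h1
        exact h1
      have h1 := LinearMap.finrank_range_add_finrank_ker T
      have h2 : Module.finrank ℝ (LinearMap.range T) ≤ r + r := by
        refine (Submodule.finrank_le _).trans ?_
        simp
      have h3 := Submodule.finrank_mono hle
      omega

/-- A `2`-form with `ζ^(h+1) = 0` has rank at most `2h`. -/
theorem finrank_le_finrank_ker_bilin_add (ζ : V [⋀^Fin 2]→ₗ[ℝ] ℝ) (h : ℕ)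
    (hζ : wedgePow ζ (h + 1) = 0) :
    Module.finrank ℝ V ≤ Module.finrank ℝ (LinearMap.ker (bilin ζ)) + 2 * h := by
  rcases exists_symplectic_or_finrank_le (bilin ζ) (bilin_self ζ) (h + 1) with
    ⟨a, b, haa, hbb, hab⟩ | ⟨m, hm, hle⟩
  · exfalso
    let u : Fin (2 * (h + 1)) → V := fun i ↦
      if (i : ℕ) % 2 = 0 then a ⟨i / 2, by omega⟩ else b ⟨i / 2, by omega⟩
    have hu : IsSymplecticFamily ζ u := by
      intro i j
      have hlt : i < j ↔ (i : ℕ) < j := Iff.rfl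
      have hlt' : j < i ↔ (j : ℕ) < i := Iff.rfl
      rw [← bilin_apply]
      by_cases hi : (i : ℕ) % 2 = 0 <;> by_cases hj : (j : ℕ) % 2 = 0 <;>
        simp only [u, hi, hj, if_true, if_false, hlt, hlt']
      · rw [haa]; split_ifs <;> first | rfl | omega
      · rw [hab]; simp only [Fin.mk.injEq]; split_ifs <;> first | rfl | omega
      · rw [bilin_swap, hab]; simp only [Fin.mk.injEq]
        split_ifs <;> first | rfl | omega | simp
      · rw [hbb]; split_ifs <;> first | rfl | omega
    have := wedgePow_pos_of_isSymplecticFamily ζ (h + 1) u hu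
    rw [hζ] at this
    exact lt_irrefl _ this
  · omega

theorem finrank_le_finrank_inf_ker_add_one (a : V →ₗ[ℝ] ℝ) (K : Submodule ℝ V) :
    Module.finrank ℝ K ≤ Module.finrank ℝ (LinearMap.ker a ⊓ K : Submodule ℝ V) + 1 := by
  have h1 := Submodule.finrank_sup_add_finrank_inf_eq (LinearMap.ker a) K
  have h2 := LinearMap.finrank_range_add_finrank_ker a
  have h3 : Module.finrank ℝ (LinearMap.range a) ≤ 1 := by
    simpa using Submodule.finrank_le (LinearMap.range a)
  have h4 := Submodule.finrank_le (LinearMap.ker a ⊔ K)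
  omega

/-- Dimension count. The rank bounds give dim F ≥ 2k + 1 and dim G ≥ 2h + 1, which add up to dim V.
The kernels KF ⊇ F and KG ⊇ G of the decomposable factors meet in 0 because their intersection lies
in the kernel of a volume form. So all inequalities are equalities, F = KF, G = KG and V = F ⊕ G. -/
theorem isLinearContactPair_of_wedge {h k : ℕ}
    (hn : Module.finrank ℝ V = (1 + 2 * h) + (1 + 2 * k)) (a b : V →ₗ[ℝ] ℝ)
    (ζ η : V [⋀^Fin 2]→ₗ[ℝ] ℝ)
    (hvol : wedge (wedge (asForm a) (wedgePow ζ h)) (wedge (asForm b) (wedgePow η k)) ≠ 0)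
    (hζ : wedgePow ζ (h + 1) = 0) (hη : wedgePow η (k + 1) = 0) :
    IsLinearContactPair a b (fun v ↦ bilin ζ v) (fun v ↦ bilin η v) ∧
    formKer (wedge (asForm a) (wedgePow ζ h)) = LinearMap.ker a ⊓ LinearMap.ker (bilin ζ) ∧
    formKer (wedge (asForm b) (wedgePow η k)) = LinearMap.ker b ⊓ LinearMap.ker (bilin η) := by
  set KF := formKer (wedge (asForm a) (wedgePow ζ h))
  set KG := formKer (wedge (asForm b) (wedgePow η k))
  set F := LinearMap.ker a ⊓ LinearMap.ker (bilin ζ) with hFdef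
  set G := LinearMap.ker b ⊓ LinearMap.ker (bilin η) with hGdef
  have hF : F ≤ KF := ker_inf_ker_le_formKer a ζ h
  have hG : G ≤ KG := ker_inf_ker_le_formKer b η k
  have hK : KF ⊓ KG = ⊥ := by
    rw [eq_bot_iff]
    refine (inf_formKer_le_formKer_wedge _ _).trans ?_
    rw [formKer_eq_bot hn hvol]
  have hFG : F ⊓ G = ⊥ := eq_bot_iff.2 ((inf_le_inf hF hG).trans hK.le)
  have e1 := finrank_le_finrank_ker_bilin_add ζ h hζ
  have e2 := finrank_le_finrank_ker_bilin_add η k hη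
  have e3 := finrank_le_finrank_inf_ker_add_one a (LinearMap.ker (bilin ζ))
  have e4 := finrank_le_finrank_inf_ker_add_one b (LinearMap.ker (bilin η))
  have e5 := Submodule.finrank_sup_add_finrank_inf_eq F G
  have e6 := Submodule.finrank_sup_add_finrank_inf_eq KF KG
  rw [hFG, finrank_bot] at e5
  rw [hK, finrank_bot] at e6
  have e7 := Submodule.finrank_le (F ⊔ G)
  have e8 := Submodule.finrank_le (KF ⊔ KG)
  have e9 := Submodule.finrank_mono hF
  have e10 := Submodule.finrank_mono hG
  rw [← hFdef] at e3
  rw [← hGdef] at e4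
  have hsup : F ⊔ G = ⊤ := Submodule.eq_top_of_finrank_eq (by omega)
  have hadd : ∀ v, ∃ f g, v = f + g ∧ (a f = 0 ∧ bilin ζ f = 0) ∧ (b g = 0 ∧ bilin η g = 0) := by
    intro v
    have hv : v ∈ F ⊔ G := by rw [hsup]; trivial
    obtain ⟨f, hf, g, hg, rfl⟩ := Submodule.mem_sup.1 hv
    exact ⟨f, g, rfl, hf, hg⟩
  -- Otherwise the kernel of `bilin ζ`, of dimension at least 2k + 2, would lie in F, of dimension
  -- 2k + 1.
  have hR : ∃ R, a R = 1 ∧ bilin ζ R = 0 := by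
    by_contra hne
    push Not at hne
    have : LinearMap.ker (bilin ζ) ≤ F := by
      refine le_inf (fun v hv ↦ ?_) le_rfl
      by_contra hav
      rw [LinearMap.mem_ker] at hav hv
      exact hne ((a v)⁻¹ • v) (by simp [hav]) (by rw [map_smul, hv, smul_zero])
    have := Submodule.finrank_mono this
    omega
  have hS : ∃ S, b S = 1 ∧ bilin η S = 0 := by
    by_contra hne
    push Not at hne
    have : LinearMap.ker (bilin η) ≤ G := by
      refine le_inf (fun v hv ↦ ?_) le_rfl
      by_contra hav
      rw [LinearMap.mem_ker] at hav hv
      exact hne ((b v)⁻¹ • v) (by simp [hav]) (by rw [map_smul, hv, smul_zero])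
    have := Submodule.finrank_mono this
    omega
  have hz : ∀ (χ : V [⋀^Fin 2]→ₗ[ℝ] ℝ) (v : V), (⇑(bilin χ v) = 0) ↔ bilin χ v = 0 :=
    fun χ v ↦ ⟨fun h ↦ LinearMap.ext (congrFun h), fun h ↦ by rw [h]; rfl⟩
  refine ⟨⟨bilin_self ζ, bilin_self η, ?_, by simpa only [hz] using hadd, ?_, ?_⟩,
    (Submodule.eq_of_le_of_finrank_eq hF (by omega)).symm,
    (Submodule.eq_of_le_of_finrank_eq hG (by omega)).symm⟩
  · intro v h1 h2 h3 h4
    rw [hz] at h2 h4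
    have : v ∈ F ⊓ G := ⟨⟨h1, h2⟩, ⟨h3, h4⟩⟩
    rwa [hFG, Submodule.mem_bot] at this
  -- The F-component of R is invisible to both `a` and `ζ`, so the G-component is the Reeb vector.
  · simp only [hz]
    obtain ⟨R, hR1, hR2⟩ := hR
    obtain ⟨f, g, rfl, hf, hg⟩ := hadd R
    refine ⟨g, hg, ?_, ?_⟩
    · rwa [map_add, hf.1, zero_add] at hR1
    · rwa [map_add, hf.2, zero_add] at hR2
  · simp only [hz]
    obtain ⟨S, hS1, hS2⟩ := hS
    obtain ⟨f, g, rfl, hf, hg⟩ := hadd S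
    refine ⟨f, hf, ?_, ?_⟩
    · rwa [map_add, hg.1, add_zero] at hS1
    · rwa [map_add, hg.2, add_zero] at hS2

end Rank

/-! ### Linear algebra of the Reeb vectors and of the generating vector. -/

section GrayField

variable {E : Type*} [NormedAddCommGroup E] [NormedSpace ℝ E]

/-- The bilinear form `ζ + η + a ⊗ a + b ⊗ b`. -/
def grayForm (a b : E →L[ℝ] ℝ) (ζ η : E →L[ℝ] E →L[ℝ] ℝ) : E →L[ℝ] E →L[ℝ] ℝ :=
  ζ + η + a.smulRight a + b.smulRight b

theorem grayForm_apply (a b : E →L[ℝ] ℝ) (ζ η : E →L[ℝ] E →L[ℝ] ℝ) (v w : E) :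
    grayForm a b ζ η v w = ζ v w + η v w + a v * a w + b v * b w := by
  simp [grayForm]

/-- The Reeb vector of `c`, where `c` is one of `a` and `b`. -/
def reebVector (a b : E →L[ℝ] ℝ) (ζ η : E →L[ℝ] E →L[ℝ] ℝ) (c : E →L[ℝ] ℝ) : E :=
  (grayForm a b ζ η).inverse c

/-- The vector generating the stabilizing isotopy; `a'` and `b'` are the time derivatives. -/
def grayVector (a b : E →L[ℝ] ℝ) (ζ η : E →L[ℝ] E →L[ℝ] ℝ) (a' b' : E →L[ℝ] ℝ) : E :=
  (grayForm a b ζ η).inverse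
    (-a' - b' + a' (reebVector a b ζ η a) • a + b' (reebVector a b ζ η b) • b)

namespace IsLinearContactPair

variable {a b : E →L[ℝ] ℝ} {ζ η : E →L[ℝ] E →L[ℝ] ℝ}

theorem pullback (h : IsLinearContactPair a b (fun v w ↦ ζ v w) (fun v w ↦ η v w))
    (D : E ≃L[ℝ] E) {a₁ b₁ : E →L[ℝ] ℝ} {ζ₁ η₁ : E →L[ℝ] E →L[ℝ] ℝ}
    (ha : ∀ v, a₁ v = a (D v)) (hb : ∀ v, b₁ v = b (D v))
    (hζ : ∀ v w, ζ₁ v w = ζ (D v) (D w)) (hη : ∀ v w, η₁ v w = η (D v) (D w)) :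
    IsLinearContactPair a₁ b₁ (fun v w ↦ ζ₁ v w) (fun v w ↦ η₁ v w) := by
  have key : ∀ (χ χ₁ : E →L[ℝ] E →L[ℝ] ℝ), (∀ v w, χ₁ v w = χ (D v) (D w)) → ∀ v,
      ((fun w ↦ χ₁ v w) = 0 ↔ (fun w ↦ χ (D v) w) = 0) := by
    intro χ χ₁ hχ v
    simp only [funext_iff, hχ, Pi.zero_apply]
    exact ⟨fun h w ↦ by simpa using h (D.symm w), fun h w ↦ h _⟩
  have hζ' := key ζ ζ₁ hζ
  have hη' := key η η₁ hη
  constructor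
  · intro v; rw [hζ]; exact h.left_self _
  · intro v; rw [hη]; exact h.right_self _
  · intro v h1 h2 h3 h4
    rw [ha] at h1
    rw [hb] at h3
    exact D.map_eq_zero_iff.1 (h.disjoint _ h1 ((hζ' v).1 h2) h3 ((hη' v).1 h4))
  · intro v
    obtain ⟨f, g, hv, hf, hg⟩ := h.exists_add (D v)
    refine ⟨D.symm f, D.symm g, ?_, ?_, ?_⟩
    · rw [← map_add, ← hv, D.symm_apply_apply]
    · rw [hζ', ha, D.apply_symm_apply]; exact hf
    · rw [hη', hb, D.apply_symm_apply]; exact hg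
  · obtain ⟨R, hR⟩ := h.exists_left
    refine ⟨D.symm R, ?_⟩
    rw [hη', hζ', hb, ha, D.apply_symm_apply]; exact hR
  · obtain ⟨R, hR⟩ := h.exists_right
    refine ⟨D.symm R, ?_⟩
    rw [hη', hζ', hb, ha, D.apply_symm_apply]; exact hR

theorem left_swap (h : IsLinearContactPair a b (fun v w ↦ ζ v w) (fun v w ↦ η v w)) (v w : E) :
    ζ v w = -ζ w v := by
  have := h.left_self (v + w)
  have h1 := h.left_self v
  have h2 := h.left_self w
  simp only [map_add, _root_.add_apply] at this h1 h2
  linarith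

theorem right_swap (h : IsLinearContactPair a b (fun v w ↦ ζ v w) (fun v w ↦ η v w)) (v w : E) :
    η v w = -η w v := by
  have := h.right_self (v + w)
  have h1 := h.right_self v
  have h2 := h.right_self w
  simp only [map_add, _root_.add_apply] at this h1 h2
  linarith

/-- Pairing v with itself kills the alternating parts and leaves a(v)² + b(v)² = 0. Then ζ(v, ·) =
-η(v, ·); the left side vanishes on F and the right side on G, so both vanish on F + G. -/
theorem injective_grayForm (h : IsLinearContactPair a b (fun v w ↦ ζ v w) (fun v w ↦ η v w)) :
    Function.Injective (grayForm a b ζ η) := by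
  rw [injective_iff_map_eq_zero]
  intro v hv
  have hv' : ∀ w, ζ v w + η v w + a v * a w + b v * b w = 0 := fun w ↦ by
    rw [← grayForm_apply, hv]; rfl
  have h0 := hv' v
  have hl := h.left_self v
  have hr := h.right_self v
  have ha : a v = 0 := by nlinarith [mul_self_nonneg (a v), mul_self_nonneg (b v)]
  have hb : b v = 0 := by nlinarith [mul_self_nonneg (a v), mul_self_nonneg (b v)]
  simp only [ha, hb, zero_mul, add_zero] at hv'
  have hζ : ∀ w, ζ v w = 0 := by
    intro w
    obtain ⟨f, g, rfl, hf, hg⟩ := h.exists_add w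
    have h1 : ζ v f = 0 := by rw [h.left_swap]; simpa using congrFun hf.2 v
    have h2 : η v g = 0 := by rw [h.right_swap]; simpa using congrFun hg.2 v
    have h3 := hv' g
    rw [map_add, h1]
    linarith
  have hη : ∀ w, η v w = 0 := fun w ↦ by have := hv' w; rw [hζ w] at this; linarith
  exact h.disjoint v ha (funext hζ) hb (funext hη)

theorem exists_equiv_grayForm [FiniteDimensional ℝ E]
    (h : IsLinearContactPair a b (fun v w ↦ ζ v w) (fun v w ↦ η v w)) :
    ∃ e : E ≃L[ℝ] (E →L[ℝ] ℝ), (e : E →L[ℝ] E →L[ℝ] ℝ) = grayForm a b ζ η := by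
  have hfr : Module.finrank ℝ E = Module.finrank ℝ (E →L[ℝ] ℝ) := by
    rw [← (LinearMap.toContinuousLinearMap (𝕜 := ℝ) (E := E) (F' := ℝ)).finrank_eq]
    exact (Subspace.dual_finrank_eq (K := ℝ) (V := E)).symm
  let l : E ≃ₗ[ℝ] (E →L[ℝ] ℝ) := LinearMap.linearEquivOfInjective
    (grayForm a b ζ η : E →ₗ[ℝ] E →L[ℝ] ℝ) h.injective_grayForm hfr
  exact ⟨l.toContinuousLinearEquiv, by ext v w; rfl⟩

theorem inverse_grayForm_eq [FiniteDimensional ℝ E]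
    (h : IsLinearContactPair a b (fun v w ↦ ζ v w) (fun v w ↦ η v w)) {v : E} {l : E →L[ℝ] ℝ}
    (hv : grayForm a b ζ η v = l) : (grayForm a b ζ η).inverse l = v := by
  obtain ⟨e, he⟩ := h.exists_equiv_grayForm
  rw [← hv, ← he, ContinuousLinearMap.inverse_equiv]
  exact e.symm_apply_apply v

theorem grayForm_inverse [FiniteDimensional ℝ E]
    (h : IsLinearContactPair a b (fun v w ↦ ζ v w) (fun v w ↦ η v w)) (l : E →L[ℝ] ℝ) :
    grayForm a b ζ η ((grayForm a b ζ η).inverse l) = l := by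
  obtain ⟨e, he⟩ := h.exists_equiv_grayForm
  rw [← he, ContinuousLinearMap.inverse_equiv]
  exact e.apply_symm_apply l

variable [FiniteDimensional ℝ E]

/-- The Reeb vector of `a` is annihilated by `ζ`, `η` and `b`, so `grayForm` sends it to `a`;
injectivity makes it the inverse image. -/
theorem reebVector_left (h : IsLinearContactPair a b (fun v w ↦ ζ v w) (fun v w ↦ η v w)) :
    a (reebVector a b ζ η a) = 1 ∧ b (reebVector a b ζ η a) = 0 ∧
      (∀ w, ζ (reebVector a b ζ η a) w = 0) ∧ ∀ w, η (reebVector a b ζ η a) w = 0 := by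
  obtain ⟨R, hR, haR, hζ⟩ := h.exists_left
  have hζ' := congrFun hζ
  have hη' := congrFun hR.2
  simp only [Pi.zero_apply] at hζ' hη'
  have : reebVector a b ζ η a = R := h.inverse_grayForm_eq (by
    ext w; rw [grayForm_apply, haR, hR.1, hζ', hη']; ring)
  rw [this]
  exact ⟨haR, hR.1, hζ', hη'⟩

theorem reebVector_right (h : IsLinearContactPair a b (fun v w ↦ ζ v w) (fun v w ↦ η v w)) :
    b (reebVector a b ζ η b) = 1 ∧ a (reebVector a b ζ η b) = 0 ∧
      (∀ w, ζ (reebVector a b ζ η b) w = 0) ∧ ∀ w, η (reebVector a b ζ η b) w = 0 := by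
  obtain ⟨R, hR, haR, hη⟩ := h.exists_right
  have hη' := congrFun hη
  have hζ' := congrFun hR.2
  simp only [Pi.zero_apply] at hζ' hη'
  have : reebVector a b ζ η b = R := h.inverse_grayForm_eq (by
    ext w; rw [grayForm_apply, haR, hR.1, hζ', hη']; ring)
  rw [this]
  exact ⟨haR, hR.1, hζ', hη'⟩

/-- Evaluation on the Reeb vectors gives a(X) = b(X) = 0. For w = f + g with f in F and g in G, both
sides of the `ζ`-equation vanish at f, while at g the `η`, b' and b terms of the defining equation
drop out and leave the `ζ`-equation. -/
theorem grayVector_spec (h : IsLinearContactPair a b (fun v w ↦ ζ v w) (fun v w ↦ η v w))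
    {a' b' : E →L[ℝ] ℝ} (ha' : ∀ v, a v = 0 → (∀ w, ζ v w = 0) → a' v = 0)
    (hb' : ∀ v, b v = 0 → (∀ w, η v w = 0) → b' v = 0) :
    a (grayVector a b ζ η a' b') = 0 ∧ b (grayVector a b ζ η a' b') = 0 ∧
      (∀ w, ζ (grayVector a b ζ η a' b') w = -a' w + a' (reebVector a b ζ η a) * a w) ∧
      ∀ w, η (grayVector a b ζ η a' b') w = -b' w + b' (reebVector a b ζ η b) * b w := by
  set R := reebVector a b ζ η a
  set S := reebVector a b ζ η b
  obtain ⟨hR1, hR2, hR3, hR4⟩ := h.reebVector_left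
  obtain ⟨hS1, hS2, hS3, hS4⟩ := h.reebVector_right
  set X := grayVector a b ζ η a' b' with hX
  have hXeq : ∀ w, ζ X w + η X w + a X * a w + b X * b w =
      -a' w - b' w + a' R * a w + b' S * b w := by
    intro w
    rw [← grayForm_apply, hX, grayVector, h.grayForm_inverse]
    simp [R, S]
  have haX : a X = 0 := by
    -- R lies in G, so b'(R) = 0, and the right side becomes -a'(R) + a'(R) = 0.
    have := hXeq R
    rw [h.left_swap, h.right_swap, hR1, hR2, hR3, hR4, hb' R hR2 hR4] at this
    linarith
  have hbX : b X = 0 := by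
    have := hXeq S
    rw [h.left_swap, h.right_swap, hS1, hS2, hS3, hS4, ha' S hS2 hS3] at this
    linarith
  simp only [haX, hbX, zero_mul, add_zero] at hXeq
  have hζ : ∀ w, ζ X w = -a' w + a' R * a w := by
    intro w
    obtain ⟨f, g, rfl, hf, hg⟩ := h.exists_add w
    have hf2 := congrFun hf.2
    have hg2 := congrFun hg.2
    simp only [Pi.zero_apply] at hf2 hg2
    have h1 : ζ X f = 0 := by rw [h.left_swap, hf2, neg_zero]
    have h2 : η X g = 0 := by rw [h.right_swap, hg2, neg_zero]
    have h3 := hXeq g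
    rw [h2, hb' g hg.1 hg2, hg.1] at h3
    rw [map_add, map_add, map_add, h1, ha' f hf.1 hf2, hf.1]
    linarith
  refine ⟨haX, hbX, hζ, fun w ↦ ?_⟩
  have := hXeq w
  rw [hζ] at this
  linarith

/-- Naturality under linear isomorphisms, for an arbitrary covector `c`. Since `grayVector` is
`reebVector` at another covector, this also covers the generating field and lets both be computed in
coordinates. -/
theorem reebVector_pullback
    (h : IsLinearContactPair a b (fun v w ↦ ζ v w) (fun v w ↦ η v w))
    (D : E ≃L[ℝ] E) {a₁ b₁ : E →L[ℝ] ℝ} {ζ₁ η₁ : E →L[ℝ] E →L[ℝ] ℝ}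
    (ha : ∀ v, a₁ v = a (D v)) (hb : ∀ v, b₁ v = b (D v))
    (hζ : ∀ v w, ζ₁ v w = ζ (D v) (D w)) (hη : ∀ v w, η₁ v w = η (D v) (D w))
    {c c₁ : E →L[ℝ] ℝ} (hc : ∀ v, c₁ v = c (D v)) :
    D (reebVector a₁ b₁ ζ₁ η₁ c₁) = reebVector a b ζ η c := by
  have h₁ := h.pullback D ha hb hζ hη
  rw [← D.eq_symm_apply]
  refine h₁.inverse_grayForm_eq ?_
  ext w
  rw [grayForm_apply, ha, ha, hb, hb, hζ, hη, hc, D.apply_symm_apply, ← grayForm_apply,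
    reebVector, h.grayForm_inverse]

theorem grayVector_pullback
    (h : IsLinearContactPair a b (fun v w ↦ ζ v w) (fun v w ↦ η v w))
    (D : E ≃L[ℝ] E) {a₁ b₁ : E →L[ℝ] ℝ} {ζ₁ η₁ : E →L[ℝ] E →L[ℝ] ℝ}
    (ha : ∀ v, a₁ v = a (D v)) (hb : ∀ v, b₁ v = b (D v))
    (hζ : ∀ v w, ζ₁ v w = ζ (D v) (D w)) (hη : ∀ v w, η₁ v w = η (D v) (D w))
    {a' b' a₁' b₁' : E →L[ℝ] ℝ} (ha' : ∀ v, a₁' v = a' (D v)) (hb' : ∀ v, b₁' v = b' (D v)) :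
    D (grayVector a₁ b₁ ζ₁ η₁ a₁' b₁') = grayVector a b ζ η a' b' := by
  refine h.reebVector_pullback D ha hb hζ hη fun v ↦ ?_
  have hR := h.reebVector_pullback D ha hb hζ hη ha
  have hS := h.reebVector_pullback D ha hb hζ hη hb
  simp only [_root_.add_apply, _root_.sub_apply,
    _root_.neg_apply, _root_.smul_apply, smul_eq_mul, ha, hb, ha', hb',
    hR, hS]

end IsLinearContactPair

end GrayField

/-! ### Ordinary differential equations as smooth equations in the Banach space of curves. -/

section Nemytskii

set_option synthInstance.maxHeartbeats 400000
set_option maxHeartbeats 800000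

universe u

open Topology

variable {a b : ℝ} {F G : Type u} [NormedAddCommGroup F] [NormedAddCommGroup G]

/-- The superposition operator `γ ↦ (s ↦ f (s, γ s))` on continuous curves. -/
def nemytskii (f : ℝ × F → G) (hf : ContinuousOn f (Icc a b ×ˢ univ)) (γ : C(Icc a b, F)) :
    C(Icc a b, G) :=
  ⟨fun s ↦ f (s, γ s), hf.comp_continuous (by fun_prop) fun s ↦ ⟨s.2, trivial⟩⟩

theorem nemytskii_apply (f : ℝ × F → G) (hf : ContinuousOn f (Icc a b ×ˢ univ))
    (γ : C(Icc a b, F)) (s : Icc a b) : nemytskii f hf γ s = f (s, γ s) := rfl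

theorem continuous_nemytskii (f : ℝ × F → G) (hf : ContinuousOn f (Icc a b ×ˢ univ)) :
    Continuous (nemytskii f hf) := by
  refine ContinuousMap.continuous_of_continuous_uncurry _ ?_
  refine hf.comp_continuous (f := fun q : C(Icc a b, F) × Icc a b ↦ ((q.2 : ℝ), q.1 q.2)) ?_
    fun s ↦ ⟨s.2.2, trivial⟩
  fun_prop

variable [NormedSpace ℝ F] [NormedSpace ℝ G]

/-- The partial derivative in the second variable of a function on `Icc a b ×ˢ univ`. -/
def partialDeriv (a b : ℝ) (f : ℝ × F → G) (q : ℝ × F) : F →L[ℝ] G :=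
  (fderivWithin ℝ f (Icc a b ×ˢ univ) q).comp (ContinuousLinearMap.inr ℝ ℝ F)

theorem uniqueDiffOn_Icc_prod_univ (hab : a < b) :
    UniqueDiffOn ℝ (Icc a b ×ˢ (univ : Set F)) :=
  (uniqueDiffOn_Icc hab).prod uniqueDiffOn_univ

theorem contDiffOn_partialDeriv (hab : a < b) {f : ℝ × F → G}
    (hf : ContDiffOn ℝ ∞ f (Icc a b ×ˢ univ)) :
    ContDiffOn ℝ ∞ (partialDeriv a b f) (Icc a b ×ˢ univ) :=
  (hf.fderivWithin (uniqueDiffOn_Icc_prod_univ hab) (by norm_cast)).clm_comp contDiffOn_const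

theorem hasFDerivAt_partialDeriv {f : ℝ × F → G}
    (hf : ContDiffOn ℝ ∞ f (Icc a b ×ˢ univ)) {s : ℝ} (hs : s ∈ Icc a b) (y : F) :
    HasFDerivAt (fun y ↦ f (s, y)) (partialDeriv a b f (s, y)) y := by
  have h1 := ((hf.differentiableOn (by simp)) (s, y) ⟨hs, trivial⟩).hasFDerivWithinAt
  have h2 : HasFDerivAt (fun y : F ↦ (s, y)) (ContinuousLinearMap.inr ℝ ℝ F) y :=
    hasFDerivAt_prodMk_right s y
  rw [← hasFDerivWithinAt_univ] at h2 ⊢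
  exact h1.comp y h2 fun z _ ↦ ⟨hs, trivial⟩

/-- Pointwise application of a curve of continuous linear maps to a curve. -/
def curveApply (a b : ℝ) (F G : Type u) [NormedAddCommGroup F] [NormedSpace ℝ F]
    [NormedAddCommGroup G] [NormedSpace ℝ G] :
    C(Icc a b, F →L[ℝ] G) →L[ℝ] C(Icc a b, F) →L[ℝ] C(Icc a b, G) :=
  LinearMap.mkContinuous₂
    (LinearMap.mk₂ ℝ (fun (A : C(Icc a b, F →L[ℝ] G)) (γ : C(Icc a b, F)) ↦
        (⟨fun s ↦ A s (γ s), by fun_prop⟩ : C(Icc a b, G)))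
      (fun _ _ _ ↦ rfl) (fun _ _ _ ↦ rfl) (fun A _ _ ↦ by ext s; exact map_add (A s) _ _)
      (fun c A _ ↦ by ext s; exact map_smul (A s) _ _)) 1 fun A γ ↦ by
    rw [one_mul, ContinuousMap.norm_le _ (by positivity)]
    intro s
    exact ((A s).le_opNorm _).trans
      (mul_le_mul (A.norm_coe_le_norm s) (γ.norm_coe_le_norm s) (norm_nonneg _) (norm_nonneg A))

theorem curveApply_apply (A : C(Icc a b, F →L[ℝ] G)) (γ : C(Icc a b, F)) (s : Icc a b) :
    curveApply a b F G A γ s = A s (γ s) := rfl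

/-- The mean value inequality is applied at each time s. The radius δ can be taken the same for all
s because the superposition operator of the partial derivative is continuous in the sup norm. -/
theorem hasFDerivAt_nemytskii (hab : a < b) {f : ℝ × F → G}
    (hf : ContDiffOn ℝ ∞ f (Icc a b ×ˢ univ)) (γ : C(Icc a b, F)) :
    HasFDerivAt (nemytskii f hf.continuousOn)
      (curveApply a b F G
        (nemytskii (partialDeriv a b f) (contDiffOn_partialDeriv hab hf).continuousOn γ)) γ := by
  set hf' := (contDiffOn_partialDeriv hab hf).continuousOn
  rw [hasFDerivAt_iff_isLittleO_nhds_zero, Asymptotics.isLittleO_iff]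
  intro c hc
  have hcont := (continuous_nemytskii (partialDeriv a b f) hf').continuousAt (x := γ)
  rw [Metric.continuousAt_iff] at hcont
  obtain ⟨δ, hδ, hball⟩ := hcont c hc
  filter_upwards [Metric.ball_mem_nhds (0 : C(Icc a b, F)) hδ] with h hh
  rw [mem_ball_zero_iff] at hh
  rw [ContinuousMap.norm_le _ (by positivity)]
  intro s
  rw [ContinuousMap.sub_apply, ContinuousMap.sub_apply, curveApply_apply, nemytskii_apply,
    nemytskii_apply, nemytskii_apply, ContinuousMap.add_apply]
  have key := (convex_ball (γ s) δ).norm_image_sub_le_of_norm_hasFDerivWithin_le'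
    (f := fun y ↦ f (s, y)) (f' := fun y ↦ partialDeriv a b f (s, y))
    (φ := partialDeriv a b f (s, γ s)) (C := c)
    (fun y _ ↦ (hasFDerivAt_partialDeriv hf s.2 y).hasFDerivWithinAt)
    (fun y hy ↦ ?_) (Metric.mem_ball_self hδ) (y := γ s + h s) ?_
  · rw [add_sub_cancel_left] at key
    exact key.trans (mul_le_mul_of_nonneg_left (h.norm_coe_le_norm s) hc.le)
  -- A point y near γ(s) is reached by the translate of the whole curve by the constant y - γ(s),
  -- which is equally close to γ in the sup norm.
  · have hd : dist (γ + ContinuousMap.const _ (y - γ s)) γ < δ := by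
      rw [dist_eq_norm, add_sub_cancel_left]
      refine lt_of_le_of_lt ?_ (mem_ball_iff_norm.1 hy)
      rw [ContinuousMap.norm_le _ (by positivity)]
      intro s; exact le_rfl
    have := ((ContinuousMap.dist_lt_iff hc).1 (hball hd) s).le
    rw [dist_eq_norm, nemytskii_apply, nemytskii_apply, ContinuousMap.add_apply,
      ContinuousMap.const_apply, add_sub_cancel] at this
    exact this
  · rw [mem_ball_iff_norm, add_sub_cancel_left]
    exact (h.norm_coe_le_norm s).trans_lt hh

/-- The derivative is a continuous linear function of the superposition operator of the partial
derivative, which allows induction on the order. The target changes to `F →L[ℝ] G`, which stays in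
the same universe as `F` and `G` share one. -/
theorem contDiff_nemytskii (hab : a < b) {f : ℝ × F → G}
    (hf : ContDiffOn ℝ ∞ f (Icc a b ×ˢ univ)) :
    ContDiff ℝ ∞ (nemytskii f hf.continuousOn) := by
  rw [contDiff_infty]
  intro n
  induction n generalizing G with
  | zero => exact contDiff_zero.2 (continuous_nemytskii _ _)
  | succ n ih =>
    refine contDiff_succ_iff_hasFDerivAt.2 ⟨_, ?_, hasFDerivAt_nemytskii hab hf⟩
    have h : ContDiff ℝ n (fun A : C(Icc a b, F →L[ℝ] G) ↦ curveApply a b F G A) := by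
      fun_prop
    exact h.comp (ih (contDiffOn_partialDeriv hab hf))

/-- The Volterra operator `γ ↦ ∫ s in t₀..t, γ s`. -/
def volterra (hab : a ≤ b) (t₀ : Icc a b) (F : Type u) [NormedAddCommGroup F] [NormedSpace ℝ F] :
    C(Icc a b, F) →L[ℝ] C(Icc a b, F) :=
  LinearMap.mkContinuous
    { toFun := fun γ ↦ ⟨fun t ↦ ∫ s in (t₀ : ℝ)..t, γ (projIcc a b hab s),
        (intervalIntegral.continuous_primitive (fun c d ↦ Continuous.intervalIntegrable
          (by fun_prop) c d) _).comp continuous_subtype_val⟩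
      map_add' := fun γ η ↦ by
        ext t
        exact intervalIntegral.integral_add (Continuous.intervalIntegrable (by fun_prop) _ _)
          (Continuous.intervalIntegrable (by fun_prop) _ _)
      map_smul' := fun c γ ↦ by
        ext t
        exact intervalIntegral.integral_smul c _ } (b - a) fun γ ↦ by
    rw [ContinuousMap.norm_le _ (mul_nonneg (sub_nonneg.2 hab) (norm_nonneg _))]
    intro t
    refine (intervalIntegral.norm_integral_le_of_norm_le_const (C := ‖γ‖)
      fun s _ ↦ γ.norm_coe_le_norm _).trans ?_
    rw [mul_comm]
    refine mul_le_mul_of_nonneg_right ?_ (norm_nonneg _)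
    rw [abs_le]
    constructor <;> linarith [t.2.1, t.2.2, t₀.2.1, t₀.2.2]

theorem volterra_apply (hab : a ≤ b) (t₀ : Icc a b) (γ : C(Icc a b, F)) (t : Icc a b) :
    volterra hab t₀ F γ t = ∫ s in (t₀ : ℝ)..t, γ (projIcc a b hab s) := rfl

theorem norm_volterra_le (hab : a ≤ b) (t₀ : Icc a b) : ‖volterra hab t₀ F‖ ≤ b - a :=
  LinearMap.mkContinuous_norm_le _ (sub_nonneg.2 hab) _

theorem volterra_comp (hab : a ≤ b) (t₀ : Icc a b) [CompleteSpace F] [CompleteSpace G]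
    (L : F →L[ℝ] G) (γ : C(Icc a b, F)) (t : Icc a b) :
    L (volterra hab t₀ F γ t) = ∫ s in (t₀ : ℝ)..t, L (γ (projIcc a b hab s)) := by
  rw [volterra_apply]
  exact (L.intervalIntegral_comp_comm (Continuous.intervalIntegrable (by fun_prop) _ _)).symm

theorem hasDerivWithinAt_volterra (hab : a ≤ b) (t₀ : Icc a b) [CompleteSpace F]
    (γ : C(Icc a b, F)) {t : ℝ} (ht : t ∈ Icc a b) :
    HasDerivWithinAt (fun s ↦ volterra hab t₀ F γ (projIcc a b hab s)) (γ ⟨t, ht⟩)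
      (Icc a b) t := by
  have h : HasDerivAt (fun t : ℝ ↦ ∫ s in (t₀ : ℝ)..t, γ (projIcc a b hab s))
      (γ (projIcc a b hab t)) t := by
    have hc : Continuous fun s ↦ γ (projIcc a b hab s) := by fun_prop
    exact intervalIntegral.integral_hasDerivAt_right (hc.intervalIntegrable _ _)
      (hc.stronglyMeasurableAtFilter _ _) hc.continuousAt
  rw [projIcc_of_mem hab ht] at h
  refine h.hasDerivWithinAt.congr (fun s hs ↦ ?_) ?_
  · rw [volterra_apply, projIcc_of_mem hab hs]
  · rw [volterra_apply, projIcc_of_mem hab ht]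

/-- The constant curves. -/
def constCurve (a b : ℝ) (F : Type u) [NormedAddCommGroup F] [NormedSpace ℝ F] :
    F →L[ℝ] C(Icc a b, F) :=
  LinearMap.mkContinuous
    { toFun := fun x ↦ ContinuousMap.const (Icc a b) x
      map_add' := fun _ _ ↦ rfl
      map_smul' := fun _ _ ↦ rfl } 1 fun x ↦ by
    rw [one_mul, ContinuousMap.norm_le _ (norm_nonneg _)]
    exact fun _ ↦ le_rfl

/-- Solutions of `γ' = f(t, γ)` on a short interval, as a smooth function of the initial value
with values in the space of curves. -/
theorem exists_contDiff_solution [CompleteSpace F] (hab : a < b) (t₀ : Icc a b) {f : ℝ × F → F}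
    (hf : ContDiffOn ℝ ∞ f (Icc a b ×ˢ univ)) {K : ℝ} (hK : 0 ≤ K)
    (hfK : ∀ s ∈ Icc a b, ∀ y, ‖partialDeriv a b f (s, y)‖ ≤ K) (hKab : (b - a) * K ≤ 1 / 2) :
    ∃ Γ : F → C(Icc a b, F), ContDiff ℝ ∞ Γ ∧ ∀ x, Γ x = constCurve a b F x +
      volterra hab.le t₀ F (nemytskii f hf.continuousOn (Γ x)) := by
  set N := nemytskii f hf.continuousOn
  set N' := nemytskii (partialDeriv a b f) (contDiffOn_partialDeriv hab hf).continuousOn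
  set V := volterra hab.le t₀ F
  let A : C(Icc a b, F) → C(Icc a b, F) →L[ℝ] C(Icc a b, F) :=
    fun γ ↦ V.comp (curveApply a b F F (N' γ))
  have hA : ∀ γ, ‖A γ‖ ≤ 1 / 2 := by
    intro γ
    have h1 : ‖curveApply a b F F (N' γ)‖ ≤ K := by
      refine ContinuousLinearMap.opNorm_le_bound _ hK fun h ↦ ?_
      rw [ContinuousMap.norm_le _ (by positivity)]
      intro s
      rw [curveApply_apply]
      exact ((N' γ s).le_opNorm _).trans (mul_le_mul (hfK s s.2 _) (h.norm_coe_le_norm s)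
        (norm_nonneg _) hK)
    exact (ContinuousLinearMap.opNorm_comp_le _ _).trans
      ((mul_le_mul (norm_volterra_le _ _) h1 (ContinuousLinearMap.opNorm_nonneg _)
        (by linarith)).trans hKab)
  have hVN : ∀ γ, HasFDerivAt (fun γ ↦ V (N γ)) (A γ) γ := fun γ ↦
    V.hasFDerivAt.comp γ (hasFDerivAt_nemytskii hab hf γ)
  have hH : ∀ γ, HasFDerivAt (fun γ ↦ γ - V (N γ)) (ContinuousLinearMap.id ℝ _ - A γ) γ :=
    fun γ ↦ (hasFDerivAt_id γ).sub (hVN γ)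
  -- The map γ ↦ γ - V(N γ) differs from the identity by a 1/2-contraction on the whole space, so it
  -- is a global homeomorphism and every initial value is admissible.
  have happ : ApproximatesLinearOn (fun γ ↦ γ - V (N γ))
      ((ContinuousLinearEquiv.refl ℝ C(Icc a b, F) : C(Icc a b, F) ≃L[ℝ] C(Icc a b, F)) :
        C(Icc a b, F) →L[ℝ] C(Icc a b, F)) univ (1 / 2) := by
    intro γ _ η _
    have := convex_univ.norm_image_sub_le_of_norm_hasFDerivWithin_le (C := 1 / 2)
      (fun γ _ ↦ (hVN γ).hasFDerivWithinAt) (fun γ _ ↦ hA γ) (mem_univ η) (mem_univ γ)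
    rw [← norm_neg]
    convert this using 1
    · congr 1
      simp only [ContinuousLinearEquiv.coe_refl, ContinuousLinearMap.coe_id', id_eq]
      abel
    · norm_num
  have hc : Subsingleton C(Icc a b, F) ∨ (1 / 2 : NNReal) <
      ‖((ContinuousLinearEquiv.refl ℝ C(Icc a b, F)).symm :
        C(Icc a b, F) →L[ℝ] C(Icc a b, F))‖₊⁻¹ := by
    rcases subsingleton_or_nontrivial C(Icc a b, F) with h | h
    · exact Or.inl h
    · right
      have : ‖((ContinuousLinearEquiv.refl ℝ C(Icc a b, F)).symm :
        C(Icc a b, F) →L[ℝ] C(Icc a b, F))‖₊ = 1 := by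
        ext
        exact ContinuousLinearMap.norm_id
      rw [this, inv_one]
      exact NNReal.half_lt_self one_ne_zero
  let H : C(Icc a b, F) ≃ₜ C(Icc a b, F) := happ.toHomeomorph _ hc
  -- The derivative is invertible by the Neumann series, which makes the inverse homeomorphism
  -- smooth.
  have hunit : ∀ γ, ∃ e : C(Icc a b, F) ≃L[ℝ] C(Icc a b, F),
      (e : C(Icc a b, F) →L[ℝ] C(Icc a b, F)) = ContinuousLinearMap.id ℝ _ - A γ := fun γ ↦
    ⟨ContinuousLinearEquiv.unitsEquiv ℝ _
      (Units.oneSub (A γ) ((hA γ).trans_lt (by norm_num))), by ext; rfl⟩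
  choose e he using hunit
  have hsymm : ContDiff ℝ ∞ H.symm := by
    refine H.contDiff_symm (f₀' := e) (fun γ ↦ ?_) ?_
    · rw [he]; exact hH γ
    · exact contDiff_id.sub (V.contDiff.comp (contDiff_nemytskii hab hf))
  refine ⟨fun x ↦ H.symm (constCurve a b F x), hsymm.comp (constCurve a b F).contDiff,
    fun x ↦ ?_⟩
  exact eq_add_of_sub_eq (H.apply_symm_apply (constCurve a b F x))

end Nemytskii

/-! ### Joint smoothness of solutions in time and initial value. -/

section JointSmoothness

universe u v

open Topology

set_option synthInstance.maxHeartbeats 400000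
set_option maxHeartbeats 800000

variable {a b : ℝ} {E : Type v} [NormedAddCommGroup E] [NormedSpace ℝ E] [FiniteDimensional ℝ E]

/-- Γ(y)(s) is split as Γ(x)(s) + (Γ(y) - Γ(x))(s). The first term depends on time only. The second
is controlled by the derivative of `Γ` in the sup norm and by the continuity of s ↦ ev_s ∘ Γ', which
holds in operator norm because `E` is finite-dimensional. -/
theorem hasFDerivWithinAt_uncurry_curve {F : Type u} [NormedAddCommGroup F] [NormedSpace ℝ F]
    (hab : a ≤ b) {Γ : E → C(Icc a b, F)} {x : E} {Γ' : E →L[ℝ] C(Icc a b, F)}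
    (hΓ : HasFDerivAt Γ Γ' x) {t : ℝ} (ht : t ∈ Icc a b) {c : F}
    (hc : HasDerivWithinAt (fun s ↦ Γ x (projIcc a b hab s)) c (Icc a b) t) :
    HasFDerivWithinAt (fun q : ℝ × E ↦ Γ q.2 (projIcc a b hab q.1))
      ((ContinuousLinearMap.toSpanSingleton ℝ c).comp (ContinuousLinearMap.fst ℝ ℝ E) +
        ((ContinuousMap.evalCLM ℝ (⟨t, ht⟩ : Icc a b)).comp Γ').comp
          (ContinuousLinearMap.snd ℝ ℝ E)) (Icc a b ×ˢ univ) (t, x) := by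
  have h1 : HasFDerivWithinAt (fun q : ℝ × E ↦ Γ x (projIcc a b hab q.1))
      ((ContinuousLinearMap.toSpanSingleton ℝ c).comp (ContinuousLinearMap.fst ℝ ℝ E))
      (Icc a b ×ˢ univ) (t, x) :=
    HasFDerivWithinAt.comp (t, x) (g := fun s ↦ Γ x (projIcc a b hab s)) hc.hasFDerivWithinAt
      (ContinuousLinearMap.fst ℝ ℝ E).hasFDerivWithinAt fun q hq ↦ hq.1
  have h2 : HasFDerivWithinAt (fun q : ℝ × E ↦ (Γ q.2 - Γ x) (projIcc a b hab q.1))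
      (((ContinuousMap.evalCLM ℝ (⟨t, ht⟩ : Icc a b)).comp Γ').comp
          (ContinuousLinearMap.snd ℝ ℝ E)) (Icc a b ×ˢ univ) (t, x) := by
    rw [hasFDerivWithinAt_iff_isLittleO, Asymptotics.isLittleO_iff]
    intro ε hε
    have hev : Continuous fun s : ℝ ↦
        (ContinuousMap.evalCLM ℝ (projIcc a b hab s) : C(Icc a b, F) →L[ℝ] F).comp Γ' := by
      rw [continuous_clm_apply]
      intro v
      change Continuous fun s : ℝ ↦ Γ' v (projIcc a b hab s)
      fun_prop
    have h3 := Metric.continuousAt_iff.1 (hev.continuousAt (x := t)) (ε / 2) (by positivity)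
    obtain ⟨δ, hδ, h3⟩ := h3
    have h4 := Asymptotics.isLittleO_iff.1 hΓ.isLittleO (show (0 : ℝ) < ε / 2 by positivity)
    have h4' : ∀ᶠ q : ℝ × E in 𝓝 (t, x),
        ‖Γ q.2 - Γ x - Γ' (q.2 - x)‖ ≤ ε / 2 * ‖q.2 - x‖ :=
      (continuous_snd.tendsto (t, x)).eventually h4
    have h5 : ∀ᶠ q : ℝ × E in 𝓝 (t, x), dist q.1 t < δ :=
      (continuous_fst.tendsto (t, x)).eventually (Metric.ball_mem_nhds t hδ)
    filter_upwards [nhdsWithin_le_nhds h4', nhdsWithin_le_nhds h5] with q hq1 hq2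
    have h6 := (h3 hq2).le
    rw [projIcc_of_mem hab ht, dist_eq_norm] at h6
    have h7 := ContinuousLinearMap.le_of_opNorm_le _ h6 (q.2 - x)
    have h8 := ((Γ q.2 - Γ x - Γ' (q.2 - x)).norm_coe_le_norm (projIcc a b hab q.1)).trans hq1
    have h9 : ‖q.2 - x‖ ≤ ‖q - (t, x)‖ := norm_snd_le (q - (t, x))
    have e : (Γ q.2 - Γ x) (projIcc a b hab q.1) - (Γ x - Γ x) (projIcc a b hab t) -
        (((ContinuousMap.evalCLM ℝ (⟨t, ht⟩ : Icc a b)).comp Γ').comp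
          (ContinuousLinearMap.snd ℝ ℝ E)) (q - (t, x)) =
        (Γ q.2 - Γ x - Γ' (q.2 - x)) (projIcc a b hab q.1) +
        (((ContinuousMap.evalCLM ℝ (projIcc a b hab q.1) : C(Icc a b, F) →L[ℝ] F).comp Γ') -
          (ContinuousMap.evalCLM ℝ (⟨t, ht⟩ : Icc a b)).comp Γ') (q.2 - x) := by
      simp
    rw [e]
    refine (norm_add_le _ _).trans ?_
    nlinarith
  refine (h1.add h2).congr (fun q _ ↦ ?_) ?_ <;> simp

/-- Induction on the order, over all equations at once. The time derivative is f along the solution.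
A directional derivative in x solves the linearized equation, so together with the solution it
solves a system of the same shape with initial value (ℓ, Dℓ·v); for this reason the initial value is
a general smooth `ℓ`. -/
theorem contDiffOn_uncurry_solution (hab : a < b) (t₀ : Icc a b) (n : ℕ) :
    ∀ {F : Type u} [NormedAddCommGroup F] [NormedSpace ℝ F] [CompleteSpace F] {f : ℝ × F → F}
    (hf : ContDiffOn ℝ ∞ f (Icc a b ×ˢ univ)) {ℓ : E → F} (_ : ContDiff ℝ ∞ ℓ)
    {Γ : E → C(Icc a b, F)} (_ : ContDiff ℝ ∞ Γ)
    (_ : ∀ x, Γ x = constCurve a b F (ℓ x) +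
      volterra hab.le t₀ F (nemytskii f hf.continuousOn (Γ x))),
    ContDiffOn ℝ n (fun q : ℝ × E ↦ Γ q.2 (projIcc a b hab.le q.1)) (Icc a b ×ˢ univ) := by
  induction n with
  | zero =>
    intro F _ _ _ f hf ℓ hℓ Γ hΓ heq
    refine contDiffOn_zero.2 (Continuous.continuousOn ?_)
    have := hΓ.continuous
    fun_prop
  | succ n ih =>
    intro F _ _ _ f hf ℓ hℓ Γ hΓ heq
    have hf' := contDiffOn_partialDeriv hab hf
    have hdiff : ∀ x, HasFDerivAt Γ (fderiv ℝ Γ x) x := fun x ↦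
      (hΓ.differentiable (by simp) x).hasFDerivAt
    have hder : ∀ x, ∀ t (ht : t ∈ Icc a b),
        HasDerivWithinAt (fun s ↦ Γ x (projIcc a b hab.le s)) (f (t, Γ x ⟨t, ht⟩))
          (Icc a b) t := by
      intro x t ht
      have h := (hasDerivWithinAt_volterra hab.le t₀ (nemytskii f hf.continuousOn (Γ x)) ht
        ).const_add (ℓ x)
      refine h.congr (fun s _ ↦ ?_) ?_
      · conv_lhs => rw [heq x]
        rfl
      · conv_lhs => rw [heq x]
        rfl
    have hfd := fun t ht x ↦ hasFDerivWithinAt_uncurry_curve hab.le (hdiff x) ht (hder x t ht)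
    have hdf : DifferentiableOn ℝ (fun q : ℝ × E ↦ Γ q.2 (projIcc a b hab.le q.1))
        (Icc a b ×ˢ univ) := fun q hq ↦ (hfd q.1 hq.1 q.2).differentiableWithinAt
    refine contDiffOn_succ_of_fderiv_apply hdf
      (fun h ↦ absurd h (WithTop.natCast_ne_top n)) fun y ↦ ?_
    -- the system satisfied by the solution and its derivative in a fixed direction
    let f₂ : ℝ × (F × F) → F × F := fun q ↦
      (f (q.1, q.2.1), partialDeriv a b f (q.1, q.2.1) q.2.2)
    have hf₂ : ContDiffOn ℝ ∞ f₂ (Icc a b ×ˢ univ) := by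
      have hp : ContDiffOn ℝ ∞ (fun q : ℝ × (F × F) ↦ (q.1, q.2.1)) (Icc a b ×ˢ univ) := by
        fun_prop
      have hm : MapsTo (fun q : ℝ × (F × F) ↦ (q.1, q.2.1)) (Icc a b ×ˢ univ)
        (Icc a b ×ˢ univ) := fun q hq ↦ ⟨hq.1, trivial⟩
      exact (hf.comp hp hm).prodMk ((hf'.comp hp hm).clm_apply (by fun_prop))
    let Γ₂ : E → C(Icc a b, F × F) := fun x ↦
      (ContinuousLinearMap.inl ℝ F F).compLeftContinuous ℝ (Icc a b) (Γ x) +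
      (ContinuousLinearMap.inr ℝ F F).compLeftContinuous ℝ (Icc a b) (fderiv ℝ Γ x y.2)
    have hΓ₂v : ∀ x t, Γ₂ x t = (Γ x t, fderiv ℝ Γ x y.2 t) := by
      intro x t
      simp [Γ₂]
    have hdΓ : ContDiff ℝ ∞ fun x ↦ fderiv ℝ Γ x y.2 :=
      (hΓ.fderiv_right (by norm_cast)).clm_apply contDiff_const
    have hΓ₂ : ContDiff ℝ ∞ Γ₂ :=
      (((ContinuousLinearMap.inl ℝ F F).compLeftContinuous ℝ (Icc a b)).contDiff.comp hΓ).add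
        (((ContinuousLinearMap.inr ℝ F F).compLeftContinuous ℝ (Icc a b)).contDiff.comp hdΓ)
    have hℓ₂ : ContDiff ℝ ∞ fun x ↦ (ℓ x, fderiv ℝ ℓ x y.2) :=
      hℓ.prodMk ((hℓ.fderiv_right (by norm_cast)).clm_apply contDiff_const)
    have heq' : ∀ x, fderiv ℝ Γ x y.2 = constCurve a b F (fderiv ℝ ℓ x y.2) +
        volterra hab.le t₀ F (curveApply a b F F (nemytskii (partialDeriv a b f)
          hf'.continuousOn (Γ x)) (fderiv ℝ Γ x y.2)) := by
      intro x
      have h1 : HasFDerivAt Γ ((constCurve a b F).comp (fderiv ℝ ℓ x) +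
          (volterra hab.le t₀ F).comp ((curveApply a b F F (nemytskii (partialDeriv a b f)
          hf'.continuousOn (Γ x))).comp (fderiv ℝ Γ x))) x := by
        have h2 := ((constCurve a b F).hasFDerivAt.comp x
          (hℓ.differentiable (by simp) x).hasFDerivAt).add
          ((volterra hab.le t₀ F).hasFDerivAt.comp x
            ((hasFDerivAt_nemytskii hab hf (Γ x)).comp x (hdiff x)))
        refine h2.congr_of_eventuallyEq (Filter.Eventually.of_forall fun z ↦ heq z)
      have h3 := congrArg (fun L : E →L[ℝ] C(Icc a b, F) ↦ L y.2) h1.fderiv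
      exact h3
    have heq₂ : ∀ x, Γ₂ x = constCurve a b (F × F) (ℓ x, fderiv ℝ ℓ x y.2) +
        volterra hab.le t₀ (F × F) (nemytskii f₂ hf₂.continuousOn (Γ₂ x)) := by
      intro x
      ext t
      · have h1 := volterra_comp hab.le t₀ (ContinuousLinearMap.fst ℝ F F)
          (nemytskii f₂ hf₂.continuousOn (Γ₂ x)) t
        simp only [ContinuousLinearMap.coe_fst'] at h1
        rw [hΓ₂v]
        refine Eq.trans ?_ (congrArg (ℓ x + ·) h1.symm)
        conv_lhs => rw [heq x]
        rw [ContinuousMap.add_apply, volterra_apply]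
        simp only [nemytskii_apply, hΓ₂v, f₂]
        rfl
      · have h1 := volterra_comp hab.le t₀ (ContinuousLinearMap.snd ℝ F F)
          (nemytskii f₂ hf₂.continuousOn (Γ₂ x)) t
        simp only [ContinuousLinearMap.coe_snd'] at h1
        rw [hΓ₂v]
        refine Eq.trans ?_ (congrArg (fderiv ℝ ℓ x y.2 + ·) h1.symm)
        conv_lhs => rw [heq' x]
        rw [ContinuousMap.add_apply, volterra_apply]
        simp only [nemytskii_apply, hΓ₂v, f₂, curveApply_apply]
        rfl
    have hΦ := ih hf hℓ hΓ heq
    have hΦ₂ := ih hf₂ hℓ₂ hΓ₂ heq₂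
    have hfΦ : ContDiffOn ℝ n (fun q : ℝ × E ↦ f (q.1, Γ q.2 (projIcc a b hab.le q.1)))
        (Icc a b ×ˢ univ) :=
      (hf.of_le (by exact_mod_cast le_top)).comp (contDiffOn_fst.prodMk hΦ)
        fun q hq ↦ ⟨hq.1, trivial⟩
    refine ((contDiffOn_const (c := y.1)).smul hfΦ |>.add hΦ₂.snd).congr fun q hq ↦ ?_
    rw [(hfd q.1 hq.1 q.2).fderivWithin ((uniqueDiffOn_Icc_prod_univ hab) q hq)]
    simp [hΓ₂v, projIcc_of_mem hab.le hq.1]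

end JointSmoothness

/-! ### Local flows on [0, 1], smooth up to the end times. -/

section LocalFlow

open Topology Metric

variable {E : Type*} [NormedAddCommGroup E] [NormedSpace ℝ E] [FiniteDimensional ℝ E]

/-- Cutting off a vector field near a point. -/
theorem exists_cutoff {f : ℝ × E → E} {Ω : Set E} (hΩ : IsOpen Ω)
    (hf : ContDiffOn ℝ ∞ f (Icc (0 : ℝ) 1 ×ˢ Ω)) {y₀ : E} (hy₀ : y₀ ∈ Ω) :
    ∃ g : ℝ × E → E, ContDiffOn ℝ ∞ g (Icc (0 : ℝ) 1 ×ˢ univ) ∧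
      ∃ R > 0, ball y₀ R ⊆ Ω ∧ (∀ t, ∀ y ∈ ball y₀ R, g (t, y) = f (t, y)) ∧
      ∃ K, 0 ≤ K ∧ ∀ t ∈ Icc (0 : ℝ) 1, ∀ y, ‖g (t, y)‖ ≤ K ∧
        ‖partialDeriv 0 1 g (t, y)‖ ≤ K := by
  obtain ⟨R, hR, hRΩ⟩ := Metric.isOpen_iff.1 hΩ y₀ hy₀
  -- The bump is 1 up to radius R/4 and vanishes beyond R/2, so its support is compact inside Ω and
  -- the cut-off field has global bounds.
  let χ : ContDiffBump y₀ := ⟨R / 4, R / 2, by positivity, by linarith⟩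
  let g : ℝ × E → E := fun q ↦ χ q.2 • f q
  have hzero : ∀ t, ∀ y ∉ closedBall y₀ (R / 2), g (t, y) = 0 := by
    intro t y hy
    have : χ y = 0 := χ.zero_of_le_dist (by
      rw [mem_closedBall, not_le] at hy; exact hy.le)
    simp [g, this]
  have hsub : closedBall y₀ (R / 2) ⊆ Ω :=
    (closedBall_subset_ball (by linarith)).trans hRΩ
  have hg : ContDiffOn ℝ ∞ g (Icc (0 : ℝ) 1 ×ˢ univ) := by
    rintro ⟨t, y⟩ ⟨ht, -⟩
    by_cases hy : y ∈ closedBall y₀ (R / 2)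
    · have h1 : ContDiffWithinAt ℝ ∞ g (Icc (0 : ℝ) 1 ×ˢ Ω) (t, y) :=
        (χ.contDiff.comp contDiff_snd).contDiffWithinAt.smul (hf (t, y) ⟨ht, hsub hy⟩)
      refine h1.mono_of_mem_nhdsWithin ?_
      have h2 : (univ ×ˢ Ω : Set (ℝ × E)) ∈ 𝓝 (t, y) :=
        prod_mem_nhds Filter.univ_mem (hΩ.mem_nhds (hsub hy))
      filter_upwards [self_mem_nhdsWithin, nhdsWithin_le_nhds h2] with q hq hq'
      exact ⟨hq.1, hq'.2⟩
    · have h2 : (univ ×ˢ (closedBall y₀ (R / 2))ᶜ : Set (ℝ × E)) ∈ 𝓝 (t, y) :=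
        prod_mem_nhds Filter.univ_mem (isClosed_closedBall.isOpen_compl.mem_nhds hy)
      refine (contDiffWithinAt_const (c := (0 : E))).congr_of_eventuallyEq ?_ (hzero t y hy)
      filter_upwards [nhdsWithin_le_nhds h2] with q hq
      exact hzero q.1 q.2 hq.2
  have hcpt : IsCompact (Icc (0 : ℝ) 1 ×ˢ closedBall y₀ (R / 2)) :=
    isCompact_Icc.prod (isCompact_closedBall _ _)
  obtain ⟨K₁, hK₁⟩ := hcpt.exists_bound_of_continuousOn
    (hg.continuousOn.mono (prod_mono le_rfl (subset_univ _)))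
  obtain ⟨K₂, hK₂⟩ := hcpt.exists_bound_of_continuousOn
    ((contDiffOn_partialDeriv zero_lt_one hg).continuousOn.mono
      (prod_mono le_rfl (subset_univ _)))
  refine ⟨g, hg, R / 4, by positivity, (ball_subset_ball (by linarith)).trans hRΩ, ?_,
    max 0 (max K₁ K₂), le_max_left _ _, ?_⟩
  · intro t y hy
    have : χ y = 1 := χ.one_of_mem_closedBall (ball_subset_closedBall hy)
    simp [g, this]
  · intro t ht y
    by_cases hy : y ∈ closedBall y₀ (R / 2)
    · exact ⟨(hK₁ (t, y) ⟨ht, hy⟩).trans (by simp), (hK₂ (t, y) ⟨ht, hy⟩).trans (by simp)⟩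
    · have h0 : partialDeriv 0 1 g (t, y) = 0 := by
        refine (hasFDerivAt_partialDeriv hg ht y).unique ?_
        refine (hasFDerivAt_const (0 : E) y).congr_of_eventuallyEq ?_
        filter_upwards [isClosed_closedBall.isOpen_compl.mem_nhds hy] with z hz
        exact hzero t z hz
      rw [hzero t y hy, h0]
      simp

/-- Local flows of a time-dependent vector field on `[0, 1]` are smooth up to the boundary, and
their time of existence is locally uniform. -/
theorem exists_local_flow {f : ℝ × E → E} {Ω : Set E} (hΩ : IsOpen Ω)
    (hf : ContDiffOn ℝ ∞ f (Icc (0 : ℝ) 1 ×ˢ Ω)) {y₀ : E} (hy₀ : y₀ ∈ Ω) :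
    ∃ δ > 0, ∃ r > 0, ∀ t₀ ∈ Icc (0 : ℝ) 1, ∃ Φ : ℝ × E → E,
      ContDiffOn ℝ ∞ Φ ((Icc (0 : ℝ) 1 ∩ Ioo (t₀ - δ) (t₀ + δ)) ×ˢ univ) ∧
      ∀ x ∈ ball y₀ r, Φ (t₀, x) = x ∧ ∀ t ∈ Icc (0 : ℝ) 1 ∩ Ioo (t₀ - δ) (t₀ + δ),
        Φ (t, x) ∈ Ω ∧
        HasDerivWithinAt (fun s ↦ Φ (s, x)) (f (t, Φ (t, x))) (Icc (0 : ℝ) 1) t := by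
  obtain ⟨g, hg, R, hR, hRΩ, hgf, K, hK, hgK⟩ := exists_cutoff hΩ hf hy₀
  have hm : 0 < min 1 R := lt_min one_pos hR
  -- With δK ≤ 1/4 an interval of length at most 2δ meets the contraction condition, and with δK ≤
  -- R/4 a curve starting within R/2 of y₀ stays within R, where g = f. The summand 1 covers K = 0.
  -- Nothing here depends on t₀.
  set δ := min 1 R / (4 * (K + 1)) with hδdef
  have hδ : 0 < δ := by positivity
  have hδK : δ * K ≤ min 1 R / 4 := by
    rw [hδdef, div_mul_eq_mul_div, div_le_div_iff₀ (by positivity) (by norm_num)]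
    nlinarith
  have hδ1 : δ * K ≤ 1 / 4 := hδK.trans (by linarith [min_le_left 1 R])
  have hδ2 : δ * K ≤ R / 4 := hδK.trans (by linarith [min_le_right 1 R])
  refine ⟨δ, hδ, R / 2, by positivity, fun t₀ ht₀ ↦ ?_⟩
  set a := max 0 (t₀ - δ) with ha
  set b := min 1 (t₀ + δ) with hb
  have hab : a < b := by
    rw [ha, hb, max_lt_iff, lt_min_iff, lt_min_iff]
    refine ⟨⟨?_, ?_⟩, ?_, ?_⟩ <;> linarith [ht₀.1, ht₀.2]
  have hat : t₀ ∈ Icc a b := by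
    rw [ha, hb, mem_Icc, max_le_iff, le_min_iff]
    refine ⟨⟨?_, ?_⟩, ?_, ?_⟩ <;> linarith [ht₀.1, ht₀.2]
  have hJI : Icc a b ⊆ Icc 0 1 := Icc_subset_Icc (le_max_left _ _) (min_le_left _ _)
  have hIJ : Icc (0 : ℝ) 1 ∩ Ioo (t₀ - δ) (t₀ + δ) ⊆ Icc a b := fun t ht ↦
    ⟨max_le ht.1.1 ht.2.1.le, le_min ht.1.2 ht.2.2.le⟩
  have hlen : b - a ≤ 2 * δ := by
    linarith [le_max_right 0 (t₀ - δ), min_le_right 1 (t₀ + δ)]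
  have hgJ : ContDiffOn ℝ ∞ g (Icc a b ×ˢ univ) := hg.mono (prod_mono hJI le_rfl)
  obtain ⟨Γ, hΓ, hΓeq⟩ := exists_contDiff_solution hab ⟨t₀, hat⟩ hgJ hK (fun s hs y ↦ by
    rw [(hasFDerivAt_partialDeriv hgJ hs y).unique (hasFDerivAt_partialDeriv hg (hJI hs) y)]
    exact (hgK s (hJI hs) y).2) (by nlinarith)
  have hΓv : ∀ x t, Γ x t = x + ∫ s in t₀..t, g (projIcc a b hab.le s,
      Γ x (projIcc a b hab.le s)) := by
    intro x t
    conv_lhs => rw [hΓeq x]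
    rfl
  refine ⟨fun q ↦ Γ q.2 (projIcc a b hab.le q.1), ?_, ?_⟩
  · refine ContDiffOn.mono ?_ (prod_mono hIJ le_rfl)
    exact contDiffOn_infty.2 fun n ↦
      contDiffOn_uncurry_solution hab ⟨t₀, hat⟩ n hgJ contDiff_id hΓ hΓeq
  · intro x hx
    refine ⟨?_, fun t ht ↦ ?_⟩
    · simp only
      rw [projIcc_of_mem hab.le hat, hΓv]
      simp
    · have htJ := hIJ ht
      have hball : Γ x ⟨t, htJ⟩ ∈ ball y₀ R := by
        have h1 : ‖Γ x ⟨t, htJ⟩ - x‖ ≤ K * |t - t₀| := by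
          rw [hΓv, add_sub_cancel_left]
          refine intervalIntegral.norm_integral_le_of_norm_le_const fun s _ ↦ ?_
          exact (hgK _ (hJI (projIcc a b hab.le s).2) _).1
        have h2 : |t - t₀| ≤ δ := by
          rw [abs_le]; constructor <;> linarith [ht.2.1, ht.2.2]
        have h3 : K * |t - t₀| ≤ R / 4 := (mul_le_mul_of_nonneg_left h2 hK).trans (by linarith)
        rw [mem_ball_iff_norm] at hx ⊢
        calc ‖Γ x ⟨t, htJ⟩ - y₀‖ = ‖(Γ x ⟨t, htJ⟩ - x) + (x - y₀)‖ := by congr 1; abel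
          _ ≤ ‖Γ x ⟨t, htJ⟩ - x‖ + ‖x - y₀‖ := norm_add_le _ _
          _ < R := by linarith
      have hnhds : Icc a b ∈ 𝓝[Icc (0 : ℝ) 1] t := by
        refine Filter.mem_of_superset ?_ hIJ
        exact Filter.inter_mem self_mem_nhdsWithin (nhdsWithin_le_nhds (Ioo_mem_nhds ht.2.1 ht.2.2))
      simp only
      rw [projIcc_of_mem hab.le htJ]
      refine ⟨hRΩ hball, ?_⟩
      rw [← hgf t _ hball]
      have h := (hasDerivWithinAt_volterra hab.le ⟨t₀, hat⟩
        (nemytskii g hgJ.continuousOn (Γ x)) htJ).const_add x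
      refine HasDerivWithinAt.mono_of_mem_nhdsWithin (t := Icc a b) ?_ hnhds
      refine h.congr (fun s _ ↦ ?_) ?_
      · conv_lhs => rw [hΓeq x]
        rfl
      · conv_lhs => rw [hΓeq x]
        rfl

end LocalFlow

/-! ### Vector fields and integral curves in charts. -/

section Charts

open Topology Filter

variable {E : Type*} [NormedAddCommGroup E] [NormedSpace ℝ E]
variable {M : Type*} [TopologicalSpace M] [ChartedSpace E M]

/-- The derivative of the preferred chart at `p`, with `T_x M` identified with `E`. -/
def chartDeriv (p x : M) : E →L[ℝ] E :=
  (mfderiv 𝓘(ℝ, E) 𝓘(ℝ, E) (extChartAt 𝓘(ℝ, E) p) x :)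

/-- The derivative of the inverse of the preferred chart at `p`. -/
def chartSymmDeriv (p : M) (y : E) : E →L[ℝ] E :=
  (mfderiv 𝓘(ℝ, E) 𝓘(ℝ, E) (extChartAt 𝓘(ℝ, E) p).symm y :)

/-- The coordinate expression of a time-dependent vector field in the preferred chart at `p`. -/
def chartField (X : ℝ → M → E) (p : M) (q : ℝ × E) : E :=
  chartDeriv p ((extChartAt 𝓘(ℝ, E) p).symm q.2) (X q.1 ((extChartAt 𝓘(ℝ, E) p).symm q.2))

/-- A time-dependent vector field, smooth on `[0, 1] × M`. -/
def IsSmoothField (X : ℝ → M → E) : Prop :=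
  ∀ p : M, ContDiffOn ℝ ∞ (chartField X p) (Icc (0 : ℝ) 1 ×ˢ (extChartAt 𝓘(ℝ, E) p).target)

/-- `γ` solves `γ' = X(t, γ)` at time `t`, for derivatives within `[0, 1]`. -/
def IsSolAt (X : ℝ → M → E) (γ : ℝ → M) (t : ℝ) : Prop :=
  HasMFDerivWithinAt 𝓘(ℝ, ℝ) 𝓘(ℝ, E) γ (Icc (0 : ℝ) 1) t
    (ContinuousLinearMap.toSpanSingleton ℝ (X t (γ t)) : ℝ →L[ℝ] E)

variable {X : ℝ → M → E} {γ η : ℝ → M} {t : ℝ}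

theorem IsSolAt.continuousWithinAt (h : IsSolAt X γ t) :
    ContinuousWithinAt γ (Icc (0 : ℝ) 1) t :=
  HasMFDerivWithinAt.continuousWithinAt h

theorem IsSolAt.congr (h : IsSolAt X γ t) (ht : t ∈ Icc (0 : ℝ) 1)
    (hη : η =ᶠ[𝓝[Icc (0 : ℝ) 1] t] γ) : IsSolAt X η t := by
  have h1 := HasMFDerivWithinAt.congr_of_eventuallyEq h hη (hη.self_of_nhdsWithin ht)
  unfold IsSolAt
  rw [hη.self_of_nhdsWithin ht]
  exact h1

variable [IsManifold 𝓘(ℝ, E) ∞ M]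

theorem hasMFDerivAt_chart {p x : M} (hx : x ∈ (extChartAt 𝓘(ℝ, E) p).source) :
    HasMFDerivAt 𝓘(ℝ, E) 𝓘(ℝ, E) (extChartAt 𝓘(ℝ, E) p) x (chartDeriv (E := E) p x) :=
  (mdifferentiableAt_extChartAt (by simpa using hx)).hasMFDerivAt

theorem hasMFDerivAt_chart_symm {p : M} {y : E} (hy : y ∈ (extChartAt 𝓘(ℝ, E) p).target) :
    HasMFDerivAt 𝓘(ℝ, E) 𝓘(ℝ, E) (extChartAt 𝓘(ℝ, E) p).symm y (chartSymmDeriv (E := E) p y) := by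
  have h := mdifferentiableWithinAt_extChartAt_symm hy
  rw [modelWithCornersSelf_coe, range_id, mdifferentiableWithinAt_univ] at h
  exact h.hasMFDerivAt

theorem chartDeriv_chartSymmDeriv {p : M} {y : E} (hy : y ∈ (extChartAt 𝓘(ℝ, E) p).target)
    (v : E) : chartDeriv p ((extChartAt 𝓘(ℝ, E) p).symm y) (chartSymmDeriv p y v) = v := by
  have h := mfderiv_extChartAt_comp_mfderivWithin_extChartAt_symm hy
  rw [modelWithCornersSelf_coe, range_id, mfderivWithin_univ] at h
  exact DFunLike.congr_fun h v

theorem chartSymmDeriv_chartDeriv {p : M} {y : E} (hy : y ∈ (extChartAt 𝓘(ℝ, E) p).target)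
    (v : E) : chartSymmDeriv p y (chartDeriv p ((extChartAt 𝓘(ℝ, E) p).symm y) v) = v := by
  have h := mfderivWithin_extChartAt_symm_comp_mfderiv_extChartAt hy
  rw [modelWithCornersSelf_coe, range_id, mfderivWithin_univ] at h
  exact DFunLike.congr_fun h v

/-- The tangent space at x is identified with `E` through the preferred chart at x itself. -/
theorem chartDeriv_self (x : M) (v : E) : chartDeriv x x v = v :=
  DFunLike.congr_fun (mfderiv_extChartAt_self (I := 𝓘(ℝ, E)) (x := x)) v

theorem chartSymmDeriv_self (x : M) (v : E) :
    chartSymmDeriv x (extChartAt 𝓘(ℝ, E) x x) v = v := by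
  have h := mfderivWithin_range_extChartAt_symm (I := 𝓘(ℝ, E)) (x := x)
  rw [modelWithCornersSelf_coe, range_id, mfderivWithin_univ] at h
  exact DFunLike.congr_fun h v

/-- The derivative of the inverse of the chart at `p`, as an equivalence. -/
def chartSymmEquiv {p : M} {y : E} (hy : y ∈ (extChartAt 𝓘(ℝ, E) p).target) : E ≃L[ℝ] E :=
  ContinuousLinearEquiv.equivOfInverse (chartSymmDeriv p y)
    (chartDeriv p ((extChartAt 𝓘(ℝ, E) p).symm y)) (chartDeriv_chartSymmDeriv hy)
    (chartSymmDeriv_chartDeriv hy)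

theorem chartSymmEquiv_apply {p : M} {y : E} (hy : y ∈ (extChartAt 𝓘(ℝ, E) p).target) (v : E) :
    chartSymmEquiv hy v = chartSymmDeriv p y v := rfl

theorem IsSolAt.hasDerivWithinAt_chart (h : IsSolAt X γ t) {p : M}
    (hp : γ t ∈ (extChartAt 𝓘(ℝ, E) p).source) :
    HasDerivWithinAt (fun s ↦ extChartAt 𝓘(ℝ, E) p (γ s))
      (chartField X p (t, extChartAt 𝓘(ℝ, E) p (γ t))) (Icc (0 : ℝ) 1) t := by
  have h1 : HasFDerivWithinAt (fun s ↦ extChartAt 𝓘(ℝ, E) p (γ s))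
      ((chartDeriv (E := E) p (γ t)).comp
        (ContinuousLinearMap.toSpanSingleton ℝ (X t (γ t)) : ℝ →L[ℝ] E)) (Icc (0 : ℝ) 1) t :=
    ((hasMFDerivAt_chart hp).comp_hasMFDerivWithinAt t h).hasFDerivWithinAt
  have h2 := h1.hasDerivWithinAt
  rw [ContinuousLinearMap.comp_apply, ContinuousLinearMap.toSpanSingleton_apply, one_smul] at h2
  simpa only [chartField, (extChartAt 𝓘(ℝ, E) p).left_inv hp] using h2

theorem isSolAt_of_hasDerivWithinAt {p : M} {u : ℝ → E}
    (hp : u t ∈ (extChartAt 𝓘(ℝ, E) p).target)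
    (hu : HasDerivWithinAt u (chartField X p (t, u t)) (Icc (0 : ℝ) 1) t) :
    IsSolAt X (fun s ↦ (extChartAt 𝓘(ℝ, E) p).symm (u s)) t := by
  have h1 := (hasMFDerivAt_chart_symm hp).comp_hasMFDerivWithinAt t
    hu.hasFDerivWithinAt.hasMFDerivWithinAt
  have e : (ContinuousLinearMap.toSpanSingleton ℝ (X t ((extChartAt 𝓘(ℝ, E) p).symm (u t))) :
      ℝ →L[ℝ] E) = (chartSymmDeriv (E := E) p (u t)).comp
        (ContinuousLinearMap.toSpanSingleton ℝ (chartField X p (t, u t)) : ℝ →L[ℝ] E) := by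
    ext
    rw [ContinuousLinearMap.comp_apply, ContinuousLinearMap.toSpanSingleton_apply,
      ContinuousLinearMap.toSpanSingleton_apply, one_smul, one_smul, chartField,
      chartSymmDeriv_chartDeriv hp]
  unfold IsSolAt
  rw [e]
  exact h1

end Charts

/-! ### Uniqueness of integral curves on the manifold. -/

section Uniqueness

open Topology Filter

/-- Uniqueness for a Lipschitz ordinary differential equation on a closed interval, with
derivatives within the interval. -/
theorem eqOn_of_hasDerivWithinAt {F : Type*} [NormedAddCommGroup F] [NormedSpace ℝ F]
    {v : ℝ → F → F} {S : Set F} {K : NNReal} {a b t : ℝ} {u w : ℝ → F}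
    (hv : ∀ s ∈ Icc a b, LipschitzOnWith K (v s) S)
    (hu : ∀ s ∈ Icc a b, HasDerivWithinAt u (v s (u s)) (Icc a b) s)
    (huS : ∀ s ∈ Icc a b, u s ∈ S)
    (hw : ∀ s ∈ Icc a b, HasDerivWithinAt w (v s (w s)) (Icc a b) s)
    (hwS : ∀ s ∈ Icc a b, w s ∈ S) (ht : t ∈ Icc a b) (heq : u t = w t) :
    EqOn u w (Icc a b) := by
  have hl : Icc a t ⊆ Icc a b := Icc_subset_Icc_right ht.2
  have hr : Icc t b ⊆ Icc a b := Icc_subset_Icc_left ht.1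
  have hcu : ContinuousOn u (Icc a b) := fun s hs ↦ (hu s hs).continuousWithinAt
  have hcw : ContinuousOn w (Icc a b) := fun s hs ↦ (hw s hs).continuousWithinAt
  have hl' : ∀ s ∈ Ioc a t, s ∈ Icc a b := fun s hs ↦ hl (Ioc_subset_Icc_self hs)
  have hr' : ∀ s ∈ Ico t b, s ∈ Icc a b := fun s hs ↦ hr (Ico_subset_Icc_self hs)
  have hnl : ∀ s ∈ Ioc a t, Icc a b ∈ 𝓝[≤] s := fun s hs ↦
    Icc_mem_nhdsLE_of_mem ⟨hs.1, hs.2.trans ht.2⟩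
  have hnr : ∀ s ∈ Ico t b, Icc a b ∈ 𝓝[≥] s := fun s hs ↦
    Icc_mem_nhdsGE_of_mem ⟨ht.1.trans hs.1, hs.2⟩
  rw [← Icc_union_Icc_eq_Icc ht.1 ht.2]
  refine EqOn.union ?_ ?_
  · exact ODE_solution_unique_of_mem_Icc_left (s := fun _ ↦ S) (fun s hs ↦ hv s (hl' s hs))
      (hcu.mono hl) (fun s hs ↦ (hu s (hl' s hs)).mono_of_mem_nhdsWithin (hnl s hs))
      (fun s hs ↦ huS s (hl' s hs))
      (hcw.mono hl) (fun s hs ↦ (hw s (hl' s hs)).mono_of_mem_nhdsWithin (hnl s hs))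
      (fun s hs ↦ hwS s (hl' s hs)) heq
  · exact ODE_solution_unique_of_mem_Icc_right (s := fun _ ↦ S) (fun s hs ↦ hv s (hr' s hs))
      (hcu.mono hr) (fun s hs ↦ (hu s (hr' s hs)).mono_of_mem_nhdsWithin (hnr s hs))
      (fun s hs ↦ huS s (hr' s hs))
      (hcw.mono hr) (fun s hs ↦ (hw s (hr' s hs)).mono_of_mem_nhdsWithin (hnr s hs))
      (fun s hs ↦ hwS s (hr' s hs)) heq

variable {E : Type*} [NormedAddCommGroup E] [NormedSpace ℝ E] [FiniteDimensional ℝ E]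
variable {M : Type*} [TopologicalSpace M] [ChartedSpace E M] [IsManifold 𝓘(ℝ, E) ∞ M]
variable {X : ℝ → M → E} {γ η : ℝ → M} {t : ℝ}

/-- In the chart at the common value both curves solve, for nearby times, the cut-off equation,
which is globally Lipschitz. -/
theorem eventuallyEq_of_isSolAt (hX : IsSmoothField X) (ht : t ∈ Icc (0 : ℝ) 1)
    (hγ : ∀ᶠ s in 𝓝[Icc (0 : ℝ) 1] t, IsSolAt X γ s)
    (hη : ∀ᶠ s in 𝓝[Icc (0 : ℝ) 1] t, IsSolAt X η s) (heq : γ t = η t) :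
    γ =ᶠ[𝓝[Icc (0 : ℝ) 1] t] η := by
  set p := γ t with hp
  set χ := extChartAt 𝓘(ℝ, E) p
  have hpm : χ p ∈ χ.target := mem_extChartAt_target p
  obtain ⟨g, hg, R, hR, hRΩ, hgf, K, hK, hgK⟩ :=
    exists_cutoff (isOpen_extChartAt_target p) (hX p) hpm
  have hLip : ∀ s ∈ Icc (0 : ℝ) 1, LipschitzOnWith ⟨K, hK⟩ (fun y ↦ g (s, y)) univ := by
    intro s hs
    exact convex_univ.lipschitzOnWith_of_nnnorm_hasFDerivWithin_le
      (fun y _ ↦ (hasFDerivAt_partialDeriv hg hs y).hasFDerivWithinAt)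
      fun y _ ↦ (hgK s hs y).2
  have hloc : ∀ {ξ : ℝ → M}, (∀ᶠ s in 𝓝[Icc (0 : ℝ) 1] t, IsSolAt X ξ s) → ξ t = p →
      ∀ᶠ s in 𝓝[Icc (0 : ℝ) 1] t, ξ s ∈ χ.source ∧
        HasDerivWithinAt (fun s ↦ χ (ξ s)) (g (s, χ (ξ s))) (Icc (0 : ℝ) 1) s := by
    intro ξ hξ hξt
    have hc := (hξ.self_of_nhdsWithin ht).continuousWithinAt
    have h1 : χ.source ∩ χ ⁻¹' (Metric.ball (χ p) R) ∈ 𝓝 (ξ t) := by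
      rw [hξt]
      exact inter_mem (extChartAt_source_mem_nhds p)
        ((continuousAt_extChartAt p).preimage_mem_nhds (Metric.ball_mem_nhds _ hR))
    filter_upwards [hξ, hc h1] with s hs hs1
    refine ⟨hs1.1, ?_⟩
    rw [hgf s _ hs1.2]
    exact hs.hasDerivWithinAt_chart hs1.1
  have hboth := (hloc hγ hp.symm).and (hloc hη heq.symm)
  rw [eventually_nhdsWithin_iff, Metric.eventually_nhds_iff] at hboth
  obtain ⟨ε, hε, hboth⟩ := hboth
  set a := max 0 (t - ε / 2)
  set b := min 1 (t + ε / 2)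
  have hJI : Icc a b ⊆ Icc 0 1 := Icc_subset_Icc (le_max_left _ _) (min_le_left _ _)
  have hJ : ∀ s ∈ Icc a b, dist s t < ε := by
    intro s hs
    rw [Real.dist_eq, abs_lt]
    constructor <;> linarith [hs.1, hs.2, le_max_right 0 (t - ε / 2), min_le_right 1 (t + ε / 2)]
  have htJ : t ∈ Icc a b :=
    ⟨max_le ht.1 (by linarith), le_min ht.2 (by linarith)⟩
  have heqOn := eqOn_of_hasDerivWithinAt (v := fun s y ↦ g (s, y)) (S := univ) (t := t)
    (u := fun s ↦ χ (γ s)) (w := fun s ↦ χ (η s))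
    (fun s hs ↦ hLip s (hJI hs)) (fun s hs ↦ (hboth (hJ s hs) (hJI hs)).1.2.mono hJI)
    (fun _ _ ↦ trivial) (fun s hs ↦ (hboth (hJ s hs) (hJI hs)).2.2.mono hJI)
    (fun _ _ ↦ trivial) htJ (by simp only [← hp, heq])
  have hnhds : Icc a b ∈ 𝓝[Icc (0 : ℝ) 1] t := by
    filter_upwards [self_mem_nhdsWithin,
      nhdsWithin_le_nhds (Ioo_mem_nhds (show t - ε / 2 < t by linarith)
        (show t < t + ε / 2 by linarith))] with s hs hs'
    exact ⟨max_le hs.1 hs'.1.le, le_min hs.2 hs'.2.le⟩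
  filter_upwards [hnhds] with s hs
  exact χ.injOn (hboth (hJ s hs) (hJI hs)).1.1 (hboth (hJ s hs) (hJI hs)).2.1 (heqOn hs)

/-- The set of times of agreement is closed in `S` since M is Hausdorff, open by local uniqueness,
and nonempty. -/
theorem eqOn_of_isSolAt [T2Space M] (hX : IsSmoothField X) {S : Set ℝ} (hS : IsPreconnected S)
    (hSI : S ⊆ Icc (0 : ℝ) 1) (hSo : ∀ t ∈ S, S ∈ 𝓝[Icc (0 : ℝ) 1] t)
    (hγ : ∀ s ∈ S, IsSolAt X γ s) (hη : ∀ s ∈ S, IsSolAt X η s) (ht : t ∈ S)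
    (heq : γ t = η t) : EqOn γ η S := by
  have : PreconnectedSpace S := Subtype.preconnectedSpace hS
  have hc : ∀ {ξ : ℝ → M}, (∀ s ∈ S, IsSolAt X ξ s) → Continuous fun s : S ↦ ξ s := by
    intro ξ hξ
    exact continuousOn_iff_continuous_domRestrict.1
      fun s hs ↦ (hξ s hs).continuousWithinAt.mono hSI
  let A : Set S := {s | γ s = η s}
  have hclosed : IsClosed A := isClosed_eq (hc hγ) (hc hη)
  have hopen : IsOpen A := by
    rw [isOpen_iff_mem_nhds]
    rintro ⟨s, hs⟩ hsA
    rw [mem_nhds_subtype_iff_nhdsWithin]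
    have h1 := eventuallyEq_of_isSolAt hX (hSI hs)
      (mem_of_superset (hSo s hs) fun r hr ↦ hγ r hr)
      (mem_of_superset (hSo s hs) fun r hr ↦ hη r hr) hsA
    filter_upwards [nhdsWithin_mono s hSI h1, self_mem_nhdsWithin] with r hr hrS
    exact ⟨⟨r, hrS⟩, hr, rfl⟩
  have huniv : A = univ := IsClopen.eq_univ ⟨hclosed, hopen⟩ ⟨⟨t, ht⟩, heq⟩
  intro s hs
  exact (huniv ▸ mem_univ (⟨s, hs⟩ : S) : (⟨s, hs⟩ : S) ∈ A)

theorem inter_Ioo_mem_nhdsWithin {I : Set ℝ} {a b : ℝ} (ht : t ∈ Ioo a b) :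
    I ∩ Ioo a b ∈ 𝓝[I] t :=
  inter_mem self_mem_nhdsWithin (nhdsWithin_le_nhds (Ioo_mem_nhds ht.1 ht.2))

end Uniqueness

/-! ### Global flows on a closed manifold. -/

section Flow

open Topology Filter

variable {E : Type*} [NormedAddCommGroup E] [NormedSpace ℝ E]
variable {M : Type*} [TopologicalSpace M] [ChartedSpace E M]
variable {X : ℝ → M → E} {J J₁ J₂ : Set ℝ} {W : Set M} {Ψ Ψ₁ : ℝ → M → M} {t₀ t₁ : ℝ}

/-- `Ψ` is a smooth flow of `X` starting at time `t₀`, for times in `J` and points of `W`. -/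
structure IsFlowOn (X : ℝ → M → E) (t₀ : ℝ) (J : Set ℝ) (W : Set M) (Ψ : ℝ → M → M) : Prop where
  smooth : ContMDiffOn (𝓘(ℝ, ℝ).prod 𝓘(ℝ, E)) 𝓘(ℝ, E) ∞ (fun q : ℝ × M ↦ Ψ q.1 q.2) (J ×ˢ W)
  map_self : ∀ x ∈ W, Ψ t₀ x = x
  isSolAt : ∀ x ∈ W, ∀ t ∈ J, IsSolAt X (fun s ↦ Ψ s x) t

/-- `J` is a relatively open subinterval of `[0, 1]`. -/
structure IsOpenSubinterval (J : Set ℝ) : Prop where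
  subset : J ⊆ Icc 0 1
  ordConnected : J.OrdConnected
  mem_nhdsWithin : ∀ t ∈ J, J ∈ 𝓝[Icc (0 : ℝ) 1] t

theorem isOpenSubinterval_inter_Ioo (c d : ℝ) : IsOpenSubinterval (Icc 0 1 ∩ Ioo c d) :=
  ⟨inter_subset_left, ordConnected_Icc.inter ordConnected_Ioo,
    fun _ ht ↦ inter_Ioo_mem_nhdsWithin ht.2⟩

theorem isOpenSubinterval_Icc : IsOpenSubinterval (Icc 0 1) :=
  ⟨Subset.rfl, ordConnected_Icc, fun _ _ ↦ self_mem_nhdsWithin⟩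

theorem IsOpenSubinterval.inter (h₁ : IsOpenSubinterval J₁) (h₂ : IsOpenSubinterval J₂) :
    IsOpenSubinterval (J₁ ∩ J₂) :=
  ⟨inter_subset_left.trans h₁.subset, h₁.ordConnected.inter h₂.ordConnected,
    fun t ht ↦ inter_mem (h₁.mem_nhdsWithin t ht.1) (h₂.mem_nhdsWithin t ht.2)⟩

theorem IsFlowOn.mono (h : IsFlowOn X t₀ J₁ W Ψ) (hJ : J ⊆ J₁) : IsFlowOn X t₀ J W Ψ :=
  ⟨h.smooth.mono (prod_mono hJ Subset.rfl), h.map_self, fun x hx t ht ↦ h.isSolAt x hx t (hJ ht)⟩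

theorem IsFlowOn.contMDiff_slice (h : IsFlowOn X t₀ J univ Ψ) {t : ℝ} (ht : t ∈ J) :
    ContMDiff 𝓘(ℝ, E) 𝓘(ℝ, E) ∞ (Ψ t) := by
  have h1 : ContMDiff 𝓘(ℝ, E) (𝓘(ℝ, ℝ).prod 𝓘(ℝ, E)) ∞ (fun x : M ↦ (t, x)) :=
    contMDiff_const.prodMk contMDiff_id
  rw [← contMDiffOn_univ]
  exact h.smooth.comp h1.contMDiffOn fun x _ ↦ ⟨ht, trivial⟩

variable [IsManifold 𝓘(ℝ, E) ∞ M] [FiniteDimensional ℝ E]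

theorem IsFlowOn.eqOn [T2Space M] (hX : IsSmoothField X) (hJ : IsOpenSubinterval J)
    (h : IsFlowOn X t₀ J W Ψ) {γ : ℝ → M} (hγ : ∀ s ∈ J, IsSolAt X γ s) {x : M} (hx : x ∈ W)
    {t : ℝ} (ht : t ∈ J) (heq : Ψ t x = γ t) : EqOn (fun s ↦ Ψ s x) γ J :=
  eqOn_of_isSolAt hX hJ.ordConnected.isPreconnected hJ.subset hJ.mem_nhdsWithin
    (h.isSolAt x hx) hγ ht heq

/-- Both δ and W are chosen before t₀, so that compactness is later needed only for M. -/
theorem exists_isFlowOn_nhds (hX : IsSmoothField X) (x₀ : M) :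
    ∃ δ > 0, ∃ W ∈ 𝓝 x₀, ∀ t₀ ∈ Icc (0 : ℝ) 1, ∃ Ψ,
      IsFlowOn X t₀ (Icc 0 1 ∩ Ioo (t₀ - δ) (t₀ + δ)) W Ψ := by
  set χ := extChartAt 𝓘(ℝ, E) x₀ with hχ
  obtain ⟨δ, hδ, r, hr, H⟩ := exists_local_flow (isOpen_extChartAt_target x₀) (hX x₀)
    (mem_extChartAt_target (I := 𝓘(ℝ, E)) x₀)
  refine ⟨δ, hδ, χ.source ∩ χ ⁻¹' Metric.ball (χ x₀) r, inter_mem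
    (extChartAt_source_mem_nhds x₀)
    ((continuousAt_extChartAt x₀).preimage_mem_nhds (Metric.ball_mem_nhds _ hr)),
    fun t₀ ht₀ ↦ ?_⟩
  obtain ⟨Φ, hΦ, HΦ⟩ := H t₀ ht₀
  refine ⟨fun t x ↦ χ.symm (Φ (t, χ x)), ?_, ?_, ?_⟩
  · have hχs : ContMDiffOn 𝓘(ℝ, E) 𝓘(ℝ, E) ∞ χ χ.source := by
      simpa [hχ] using contMDiffOn_extChartAt (I := 𝓘(ℝ, E)) (n := ∞) (x := x₀)
    have h1 : ContMDiffOn (𝓘(ℝ, ℝ).prod 𝓘(ℝ, E)) 𝓘(ℝ, ℝ × E) ∞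
        (fun q : ℝ × M ↦ (q.1, χ q.2))
        ((Icc 0 1 ∩ Ioo (t₀ - δ) (t₀ + δ)) ×ˢ (χ.source ∩ χ ⁻¹' Metric.ball (χ x₀) r)) := by
      rw [modelWithCornersSelf_prod, ← chartedSpaceSelf_prod]
      exact contMDiffOn_fst.prodMk (hχs.comp contMDiffOn_snd fun q hq ↦ hq.2.1)
    exact (contMDiffOn_extChartAt_symm x₀).comp
      (hΦ.contMDiffOn.comp h1 fun q hq ↦ ⟨hq.1, trivial⟩)
      fun q hq ↦ ((HΦ _ hq.2.2).2 q.1 hq.1).1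
  · intro x hx
    simp only [(HΦ _ hx.2).1, χ.left_inv hx.1]
  · intro x hx t ht
    obtain ⟨h1, h2⟩ := (HΦ _ hx.2).2 t ht
    exact isSolAt_of_hasDerivWithinAt (p := x₀) (u := fun s ↦ Φ (s, χ x)) h1 h2

variable [T2Space M]

/-- Compactness yields one δ for all points, the smaller of two radii serving a union. The local
flows around different points agree where they overlap, by uniqueness, and glue to a flow on M. -/
theorem exists_isFlowOn_uniform [CompactSpace M] (hX : IsSmoothField X) :
    ∃ δ > 0, ∀ t₀ ∈ Icc (0 : ℝ) 1, ∃ Ψ,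
      IsFlowOn X t₀ (Icc 0 1 ∩ Ioo (t₀ - δ) (t₀ + δ)) univ Ψ := by
  have key : ∃ δ > 0, ∀ x ∈ (univ : Set M), ∃ W ∈ 𝓝 x, ∀ t₀ ∈ Icc (0 : ℝ) 1, ∃ Ψ,
      IsFlowOn X t₀ (Icc 0 1 ∩ Ioo (t₀ - δ) (t₀ + δ)) W Ψ := by
    refine isCompact_univ.induction_on (p := fun s : Set M ↦ ∃ δ > 0, ∀ x ∈ s, ∃ W ∈ 𝓝 x,
      ∀ t₀ ∈ Icc (0 : ℝ) 1, ∃ Ψ, IsFlowOn X t₀ (Icc 0 1 ∩ Ioo (t₀ - δ) (t₀ + δ)) W Ψ) ?_ ?_ ?_ ?_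
    · exact ⟨1, one_pos, fun x hx ↦ hx.elim⟩
    · rintro s s' hs ⟨δ, hδ, H⟩
      exact ⟨δ, hδ, fun x hx ↦ H x (hs hx)⟩
    · rintro s s' ⟨δ, hδ, H⟩ ⟨δ', hδ', H'⟩
      refine ⟨min δ δ', lt_min hδ hδ', ?_⟩
      rintro x (hx | hx)
      · obtain ⟨W, hW, HW⟩ := H x hx
        refine ⟨W, hW, fun t₀ ht₀ ↦ (HW t₀ ht₀).imp fun Ψ h ↦ h.mono ?_⟩
        exact inter_subset_inter_right _ (Ioo_subset_Ioo (by linarith [min_le_left δ δ'])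
          (by linarith [min_le_left δ δ']))
      · obtain ⟨W, hW, HW⟩ := H' x hx
        refine ⟨W, hW, fun t₀ ht₀ ↦ (HW t₀ ht₀).imp fun Ψ h ↦ h.mono ?_⟩
        exact inter_subset_inter_right _ (Ioo_subset_Ioo (by linarith [min_le_right δ δ'])
          (by linarith [min_le_right δ δ']))
    · intro x _
      obtain ⟨δ, hδ, W, hW, H⟩ := exists_isFlowOn_nhds hX x
      refine ⟨interior W, mem_nhdsWithin_of_mem_nhds (isOpen_interior.mem_nhds
        (mem_interior_iff_mem_nhds.2 hW)), δ, hδ, fun y hy ↦ ⟨W, mem_interior_iff_mem_nhds.1 hy, H⟩⟩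
  obtain ⟨δ, hδ, H⟩ := key
  refine ⟨δ, hδ, fun t₀ ht₀ ↦ ?_⟩
  choose W hW Φ hΦ using fun x ↦ H x trivial
  have hJ := isOpenSubinterval_inter_Ioo (t₀ - δ) (t₀ + δ)
  have ht₀' : t₀ ∈ Icc 0 1 ∩ Ioo (t₀ - δ) (t₀ + δ) := ⟨ht₀, by linarith, by linarith⟩
  have hagree : ∀ y x, x ∈ W y → ∀ t ∈ Icc 0 1 ∩ Ioo (t₀ - δ) (t₀ + δ),
      Φ x t₀ ht₀ t x = Φ y t₀ ht₀ t x := by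
    intro y x hx t ht
    refine (hΦ x t₀ ht₀).eqOn hX hJ ((hΦ y t₀ ht₀).isSolAt x hx) (mem_of_mem_nhds (hW x)) ht₀' ?_ ht
    rw [(hΦ x t₀ ht₀).map_self x (mem_of_mem_nhds (hW x)), (hΦ y t₀ ht₀).map_self x hx]
  refine ⟨fun t x ↦ Φ x t₀ ht₀ t x, ?_, ?_, ?_⟩
  · rintro ⟨t, y⟩ ⟨ht, -⟩
    have h1 := (hΦ y t₀ ht₀).smooth (t, y) ⟨ht, mem_of_mem_nhds (hW y)⟩
    have h2 : (Icc 0 1 ∩ Ioo (t₀ - δ) (t₀ + δ)) ×ˢ W y ∈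
        𝓝[(Icc 0 1 ∩ Ioo (t₀ - δ) (t₀ + δ)) ×ˢ (univ : Set M)] (t, y) := by
      rw [nhdsWithin_prod_eq, nhdsWithin_univ]
      exact prod_mem_prod self_mem_nhdsWithin (hW y)
    refine (h1.mono_of_mem_nhdsWithin h2).congr_of_eventuallyEq ?_
      (hagree y y (mem_of_mem_nhds (hW y)) t ht)
    filter_upwards [h2] with q hq
    exact hagree y q.2 hq.2 q.1 hq.1
  · intro x _
    exact (hΦ x t₀ ht₀).map_self x (mem_of_mem_nhds (hW x))
  · intro x _
    exact (hΦ x t₀ ht₀).isSolAt x (mem_of_mem_nhds (hW x))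

/-- Two flows compose to a flow on the union of their time intervals. -/
theorem IsFlowOn.exists_union (hX : IsSmoothField X) (hJ₁ : IsOpenSubinterval J₁)
    (hJ₂ : IsOpenSubinterval J₂) (h₁ : IsFlowOn X t₀ J₁ univ Ψ) (h₂ : IsFlowOn X t₁ J₂ univ Ψ₁)
    (ht₀ : t₀ ∈ J₁) (ht₁ : t₁ ∈ J₁ ∩ J₂) : ∃ Φ, IsFlowOn X t₀ (J₁ ∪ J₂) univ Φ := by
  classical
  set Φ : ℝ → M → M := fun t x ↦ if t ∈ J₁ then Ψ t x else Ψ₁ t (Ψ t₁ x) with hΦ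
  have e₁ : ∀ x, ∀ t ∈ J₁, Φ t x = Ψ t x := fun x t ht ↦ if_pos ht
  -- By uniqueness the second formula is valid on all of J₂, including the overlap. Thus Φ has a
  -- smooth expression near every time of the union.
  have e₂ : ∀ x, ∀ t ∈ J₂, Φ t x = Ψ₁ t (Ψ t₁ x) := by
    intro x t ht
    by_cases htJ : t ∈ J₁
    · rw [e₁ x t htJ]
      exact (h₁.mono inter_subset_left).eqOn hX (hJ₁.inter hJ₂)
        (fun s hs ↦ h₂.isSolAt (Ψ t₁ x) trivial s hs.2) trivial ht₁
        (h₂.map_self _ trivial).symm ⟨htJ, ht⟩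
    · exact if_neg htJ
  have hslice := h₁.contMDiff_slice ht₁.1
  have hs₂ : ContMDiffOn (𝓘(ℝ, ℝ).prod 𝓘(ℝ, E)) 𝓘(ℝ, E) ∞
      (fun q : ℝ × M ↦ Ψ₁ q.1 (Ψ t₁ q.2)) (J₂ ×ˢ univ) :=
    h₂.smooth.comp (contMDiffOn_fst.prodMk (hslice.comp_contMDiffOn contMDiffOn_snd))
      fun q hq ↦ ⟨hq.1, trivial⟩
  have hnhds : ∀ {J : Set ℝ}, IsOpenSubinterval J → ∀ q : ℝ × M, q.1 ∈ J →
      J ×ˢ univ ∈ 𝓝[(J₁ ∪ J₂) ×ˢ (univ : Set M)] q := by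
    intro J hJ q hq
    rw [← Prod.mk.eta (p := q), nhdsWithin_prod_eq]
    exact prod_mem_prod (nhdsWithin_mono _ (union_subset hJ₁.subset hJ₂.subset)
      (hJ.mem_nhdsWithin _ hq)) univ_mem
  refine ⟨Φ, ?_, ?_, ?_⟩
  · rintro q ⟨hq | hq, -⟩
    · refine ((h₁.smooth q ⟨hq, trivial⟩).mono_of_mem_nhdsWithin
        (hnhds hJ₁ q hq)).congr_of_eventuallyEq ?_ (e₁ _ _ hq)
      filter_upwards [hnhds hJ₁ q hq] with r hr using e₁ _ _ hr.1
    · refine ((hs₂ q ⟨hq, trivial⟩).mono_of_mem_nhdsWithin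
        (hnhds hJ₂ q hq)).congr_of_eventuallyEq ?_ (e₂ _ _ hq)
      filter_upwards [hnhds hJ₂ q hq] with r hr using e₂ _ _ hr.1
  · intro x _
    rw [e₁ _ _ ht₀, h₁.map_self x trivial]
  · rintro x - t (ht | ht)
    · refine (h₁.isSolAt x trivial t ht).congr (hJ₁.subset ht) ?_
      filter_upwards [hJ₁.mem_nhdsWithin t ht] with s hs using e₁ x s hs
    · refine (h₂.isSolAt (Ψ t₁ x) trivial t ht).congr (hJ₂.subset ht) ?_
      filter_upwards [hJ₂.mem_nhdsWithin t ht] with s hs using e₂ x s hs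

/-- Each step enlarges the time radius around t₀ by δ/2 on both sides, by restarting the flow near
the two ends; finitely many steps cover [0, 1]. -/
theorem exists_isFlowOn_Icc [CompactSpace M] (hX : IsSmoothField X) (ht₀ : t₀ ∈ Icc (0 : ℝ) 1) :
    ∃ Ψ, IsFlowOn X t₀ (Icc 0 1) univ Ψ := by
  obtain ⟨δ, hδ, H⟩ := exists_isFlowOn_uniform hX
  have key : ∀ n : ℕ, ∃ Ψ, IsFlowOn X t₀
      (Icc 0 1 ∩ Ioo (t₀ - (δ + n * (δ / 2))) (t₀ + (δ + n * (δ / 2)))) univ Ψ := by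
    intro n
    induction n with
    | zero => simpa using H t₀ ht₀
    | succ n ih =>
      obtain ⟨Ψ, hΨ⟩ := ih
      have hr : 0 ≤ n * (δ / 2) := by positivity
      set r := δ + n * (δ / 2) with hrdef
      have hrδ : δ ≤ r := by linarith
      have e : δ + (n + 1 : ℕ) * (δ / 2) = r + δ / 2 := by push_cast; ring
      rw [e]
      -- Restart times lie δ/2 inside the ends of the present interval, clipped to [0, 1], so a flow
      -- lasting δ from there reaches δ/2 beyond.
      set t₁ := min 1 (t₀ + r - δ / 2) with ht₁
      set t₂ := max 0 (t₀ - r + δ / 2) with ht₂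
      have h1 : t₀ ≤ t₁ := le_min ht₀.2 (by linarith)
      have h2 : t₂ ≤ t₀ := max_le ht₀.1 (by linarith)
      have h1' : t₁ ≤ 1 := min_le_left _ _
      have h2' : 0 ≤ t₂ := le_max_left _ _
      have h1'' : t₁ ≤ t₀ + r - δ / 2 := min_le_right _ _
      have h2'' : t₀ - r + δ / 2 ≤ t₂ := le_max_right _ _
      have ht₁I : t₁ ∈ Icc (0 : ℝ) 1 := ⟨ht₀.1.trans h1, h1'⟩
      have ht₂I : t₂ ∈ Icc (0 : ℝ) 1 := ⟨h2', h2.trans ht₀.2⟩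
      obtain ⟨Ψ₁, hΨ₁⟩ := H t₁ ht₁I
      obtain ⟨Ψ₂, hΨ₂⟩ := H t₂ ht₂I
      have hJ := isOpenSubinterval_inter_Ioo
      obtain ⟨Φ, hΦ⟩ := hΨ.exists_union hX (hJ _ _) (hJ _ _) hΨ₁
        ⟨ht₀, by linarith, by linarith⟩
        ⟨⟨ht₁I, by linarith, by linarith⟩, ⟨ht₁I, by linarith, by linarith⟩⟩
      have hΦ' : IsFlowOn X t₀ (Icc 0 1 ∩ Ioo (t₀ - r) (t₀ + r + δ / 2)) univ Φ := by
        refine hΦ.mono ?_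
        rintro s ⟨hsI, hs⟩
        rcases lt_or_ge s (t₀ + r) with h | h
        · exact Or.inl ⟨hsI, hs.1, h⟩
        · refine Or.inr ⟨hsI, by linarith, ?_⟩
          rcases min_choice 1 (t₀ + r - δ / 2) with h' | h' <;> rw [← ht₁] at h' <;>
            linarith [hsI.2, hs.2]
      obtain ⟨Θ, hΘ⟩ := hΦ'.exists_union hX (hJ _ _) (hJ _ _) hΨ₂
        ⟨ht₀, by linarith, by linarith⟩
        ⟨⟨ht₂I, by linarith, by linarith⟩, ⟨ht₂I, by linarith, by linarith⟩⟩
      refine ⟨Θ, hΘ.mono ?_⟩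
      rintro s ⟨hsI, hs⟩
      rcases lt_or_ge (t₀ - r) s with h | h
      · exact Or.inl ⟨hsI, h, by linarith [hs.2]⟩
      · refine Or.inr ⟨hsI, ?_, by linarith⟩
        rcases max_choice 0 (t₀ - r + δ / 2) with h' | h' <;> rw [← ht₂] at h' <;>
          linarith [hsI.1, hs.1]
  obtain ⟨n, hn⟩ := exists_nat_gt (1 / (δ / 2))
  rw [div_lt_iff₀ (by positivity)] at hn
  obtain ⟨Ψ, hΨ⟩ := key n
  exact ⟨Ψ, hΨ.mono fun s hs ↦ ⟨hs, by linarith [hs.1, hs.2, ht₀.1, ht₀.2],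
    by linarith [hs.1, hs.2, ht₀.1, ht₀.2]⟩⟩

/-- A smooth time-dependent vector field on a closed manifold integrates to an isotopy. -/
theorem exists_isIsotopy [CompactSpace M] (hX : IsSmoothField X) :
    ∃ φ : ℝ → Diffeomorph 𝓘(ℝ, E) 𝓘(ℝ, E) M M ∞, IsIsotopy φ ∧
      ∀ x, ∀ t ∈ Icc (0 : ℝ) 1, IsSolAt X (fun s ↦ φ s x) t := by
  have : Nonempty (ℝ → M → M) := ⟨fun _ x ↦ x⟩
  choose! F hF using fun t₀ (ht₀ : t₀ ∈ Icc (0 : ℝ) 1) ↦ exists_isFlowOn_Icc hX ht₀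
  have h0 : (0 : ℝ) ∈ Icc (0 : ℝ) 1 := ⟨le_rfl, zero_le_one⟩
  -- The flow from t to s and the flow from s to t are mutually inverse, by uniqueness.
  have inv : ∀ s ∈ Icc (0 : ℝ) 1, ∀ t ∈ Icc (0 : ℝ) 1, ∀ x, F t s (F s t x) = x := by
    intro s hs t ht x
    have := (hF t ht).eqOn hX isOpenSubinterval_Icc ((hF s hs).isSolAt x trivial)
      (mem_univ (F s t x)) ht ((hF t ht).map_self _ trivial) hs
    exact this.trans ((hF s hs).map_self x trivial)
  -- A diffeomorphism is required for every real t, so times outside [0, 1] are clamped.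
  let P : ℝ → ℝ := fun t ↦ projIcc 0 1 zero_le_one t
  have hP : ∀ t, P t ∈ Icc (0 : ℝ) 1 := fun t ↦ (projIcc 0 1 zero_le_one t).2
  have hPt : ∀ t ∈ Icc (0 : ℝ) 1, P t = t := fun t ht ↦ by simp only [P, projIcc_of_mem _ ht]
  let φ : ℝ → Diffeomorph 𝓘(ℝ, E) 𝓘(ℝ, E) M M ∞ := fun t ↦
    { toFun := F 0 (P t)
      invFun := F (P t) 0
      left_inv := inv 0 h0 _ (hP t)
      right_inv := inv _ (hP t) 0 h0
      contMDiff_toFun := (hF 0 h0).contMDiff_slice (hP t)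
      contMDiff_invFun := (hF _ (hP t)).contMDiff_slice h0 }
  have hφ : ∀ t ∈ Icc (0 : ℝ) 1, ∀ x, φ t x = F 0 t x := fun t ht x ↦ by
    change F 0 (P t) x = _
    rw [hPt t ht]
  refine ⟨φ, ⟨(hF 0 h0).smooth.congr fun q hq ↦ hφ _ hq.1 _, fun x ↦ ?_⟩, fun x t ht ↦ ?_⟩
  · rw [hφ 0 h0, (hF 0 h0).map_self x trivial]
  · refine ((hF 0 h0).isSolAt x trivial t ht).congr ht ?_
    filter_upwards [self_mem_nhdsWithin] with s hs using hφ s hs x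

end Flow

/-! ### Calculus on products of an interval and an open set. -/

section SliceDerivatives

variable {F G : Type*} [NormedAddCommGroup F] [NormedSpace ℝ F]
  [NormedAddCommGroup G] [NormedSpace ℝ G] {f : ℝ × F → G} {J : Set ℝ} {Ω : Set F} {t : ℝ} {y : F}

theorem contDiffOn_fderivWithin_prod (hJ : UniqueDiffOn ℝ J) (hΩ : IsOpen Ω)
    (hf : ContDiffOn ℝ ∞ f (J ×ˢ Ω)) :
    ContDiffOn ℝ ∞ (fderivWithin ℝ f (J ×ˢ Ω)) (J ×ˢ Ω) :=
  hf.fderivWithin (hJ.prod hΩ.uniqueDiffOn) (by norm_cast)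

theorem hasFDerivWithinAt_prod (hf : ContDiffOn ℝ ∞ f (J ×ˢ Ω))
    (ht : t ∈ J) (hy : y ∈ Ω) :
    HasFDerivWithinAt f (fderivWithin ℝ f (J ×ˢ Ω) (t, y)) (J ×ˢ Ω)
      (t, y) :=
  ((hf.differentiableOn (by simp)) (t, y) ⟨ht, hy⟩).hasFDerivWithinAt

theorem hasFDerivAt_slice (hΩ : IsOpen Ω) (hf : ContDiffOn ℝ ∞ f (J ×ˢ Ω))
    (ht : t ∈ J) (hy : y ∈ Ω) :
    HasFDerivAt (fun z ↦ f (t, z)) ((fderivWithin ℝ f (J ×ˢ Ω) (t, y)).comp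
      (ContinuousLinearMap.inr ℝ ℝ F)) y :=
  ((hasFDerivWithinAt_prod hf ht hy).comp y (hasFDerivAt_prodMk_right t y).hasFDerivWithinAt
    fun _ hz ↦ mk_mem_prod ht hz).hasFDerivAt (hΩ.mem_nhds hy)

theorem hasDerivWithinAt_slice (hf : ContDiffOn ℝ ∞ f (J ×ˢ Ω))
    (ht : t ∈ J) (hy : y ∈ Ω) :
    HasDerivWithinAt (fun s ↦ f (s, y)) (fderivWithin ℝ f (J ×ˢ Ω) (t, y) (1, 0))
      J t := by
  have h := ((hasFDerivWithinAt_prod hf ht hy).comp t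
    (hasFDerivAt_prodMk_left t y).hasFDerivWithinAt fun _ hz ↦ mk_mem_prod hz hy).hasDerivWithinAt
  simpa using! h

end SliceDerivatives

/-! ### The exterior derivative of a 1-form on a vector space. -/

section Curl

open Topology Filter

variable {E : Type*} [NormedAddCommGroup E] [NormedSpace ℝ E]

/-- The exterior derivative of a `1`-form on a vector space, as a bilinear form. -/
def curl (u : E → E →L[ℝ] ℝ) (y : E) : E →L[ℝ] E →L[ℝ] ℝ :=
  fderiv ℝ u y - (fderiv ℝ u y).flip

theorem curl_apply (u : E → E →L[ℝ] ℝ) (y v w : E) :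
    curl u y v w = fderiv ℝ u y v w - fderiv ℝ u y w v := by
  simp [curl]

/-- The terms with the second derivative of `τ` cancel by its symmetry. -/
theorem curl_pullback {b : E → E →L[ℝ] ℝ} {τ : E → E} {y : E}
    (hb : DifferentiableAt ℝ b (τ y)) (hτ : ContDiffAt ℝ 2 τ y) (v w : E) :
    curl (fun z ↦ (b (τ z)).comp (fderiv ℝ τ z)) y v w =
      curl b (τ y) (fderiv ℝ τ y v) (fderiv ℝ τ y w) := by
  have h1 : HasFDerivAt (fun z ↦ b (τ z)) ((fderiv ℝ b (τ y)).comp (fderiv ℝ τ y)) y :=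
    hb.hasFDerivAt.comp y (hτ.differentiableAt (by norm_num)).hasFDerivAt
  have h2 : HasFDerivAt (fderiv ℝ τ) (fderiv ℝ (fderiv ℝ τ) y) y :=
    ((hτ.fderiv_right (m := 1) (by norm_num)).differentiableAt (by norm_num)).hasFDerivAt
  have hsymm : IsSymmSndFDerivAt ℝ τ y := hτ.isSymmSndFDerivAt (by simp)
  rw [curl_apply, curl_apply, (h1.clm_comp h2).fderiv]
  simp [hsymm.eq v w]

theorem ofSubsingleton_extDeriv_apply {u : E → E →L[ℝ] ℝ} {y : E} (hu : DifferentiableAt ℝ u y)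
    (v w : E) :
    extDeriv (fun z ↦ ContinuousAlternatingMap.ofSubsingleton ℝ E ℝ (0 : Fin 1) (u z)) y ![v, w] =
      curl u y v w := by
  have h : DifferentiableAt ℝ
      (fun z ↦ ContinuousAlternatingMap.ofSubsingleton ℝ E ℝ (0 : Fin 1) (u z)) y :=
    (ContinuousAlternatingMap.ofSubsingletonLIE (𝕜 := ℝ) (E := E) (F := ℝ)
      (0 : Fin 1)).differentiable.differentiableAt.comp y hu
  have key : ∀ c d : E, fderiv ℝ (fun z ↦ u z c) y d = fderiv ℝ u y d c := fun c d ↦ by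
    rw [(hu.hasFDerivAt.clm_apply (hasFDerivAt_const c y)).fderiv]
    simp
  rw [extDeriv_apply h, curl_apply]
  simp [Fin.sum_univ_two, Fin.removeNth, key]
  ring

end Curl

/-! ### 1-forms and their exterior derivatives in charts. -/

section FormsInCharts

open Topology Filter

variable {E : Type*} [NormedAddCommGroup E] [NormedSpace ℝ E]
variable {M : Type*} [TopologicalSpace M] [ChartedSpace E M] [IsManifold 𝓘(ℝ, E) ∞ M]

/-- The value of a `1`-form at `x`, with `T_x M` identified with `E`. -/
def OneForm.val (α : OneForm E M) (x : M) : E →L[ℝ] ℝ := (α.at x :)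

/-- The exterior derivative at `x` as a bilinear form, with `T_x M` identified with `E`. -/
def OneForm.dval (α : OneForm E M) (x : M) : E →L[ℝ] E →L[ℝ] ℝ :=
  curl (α.inChart x) (extChartAt 𝓘(ℝ, E) x x)

theorem OneForm.inChart_apply (α : OneForm E M) (p : M) (y v : E) :
    α.inChart p y v = α.val ((extChartAt 𝓘(ℝ, E) p).symm y) (chartSymmDeriv p y v) := rfl

theorem OneForm.inChart_self (α : OneForm E M) (x : M) :
    α.inChart x (extChartAt 𝓘(ℝ, E) x x) = α.val x := by
  ext v
  rw [α.inChart_apply, chartSymmDeriv_self, extChartAt_to_inv]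

/-- The coordinate expression is the reading of the section in the trivialization of the cotangent
bundle at p. -/
theorem contDiffOn_inChart {α : ℝ → OneForm E M} (hα : IsSmoothFamily α) (p : M) :
    ContDiffOn ℝ ∞ (fun q : ℝ × E ↦ (α q.1).inChart p q.2)
      (Icc (0 : ℝ) 1 ×ˢ (extChartAt 𝓘(ℝ, E) p).target) := by
  set e := trivializationAt (E →L[ℝ] ℝ)
    (fun x : M ↦ TangentSpace 𝓘(ℝ, E) x →L[ℝ] Bundle.Trivial M ℝ x) p
  have h1 := hα.mono (t := Icc (0 : ℝ) 1 ×ˢ (extChartAt 𝓘(ℝ, E) p).source)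
    (prod_mono Subset.rfl (subset_univ _))
  have h2 := ((e.contMDiffOn_iff (IB := 𝓘(ℝ, E)) (IM := 𝓘(ℝ, ℝ).prod 𝓘(ℝ, E)) (n := ∞) (by
    intro q hq
    simpa [e] using hq.2)).1 h1).2
  have h3 : ContMDiffOn 𝓘(ℝ, ℝ × E) (𝓘(ℝ, ℝ).prod 𝓘(ℝ, E)) ∞
      (fun q : ℝ × E ↦ (q.1, (extChartAt 𝓘(ℝ, E) p).symm q.2))
      (Icc (0 : ℝ) 1 ×ˢ (extChartAt 𝓘(ℝ, E) p).target) := by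
    rw [modelWithCornersSelf_prod, ← chartedSpaceSelf_prod]
    exact contMDiffOn_fst.prodMk ((contMDiffOn_extChartAt_symm p).comp contMDiffOn_snd
      fun q hq ↦ hq.2)
  have h4 := h2.comp h3 fun q hq ↦ ⟨hq.1, (extChartAt 𝓘(ℝ, E) p).map_target hq.2⟩
  rw [contMDiffOn_iff_contDiffOn] at h4
  refine h4.congr fun q hq ↦ ?_
  have hs : (extChartAt 𝓘(ℝ, E) p).symm q.2 ∈ (chartAt E p).source := by
    simpa using (extChartAt 𝓘(ℝ, E) p).map_target hq.2
  ext v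
  rw [OneForm.inChart_apply, Function.comp_apply, hom_trivializationAt_apply,
    ContinuousLinearMap.inCoordinates, TangentBundle.symmL_trivializationAt hs,
    modelWithCornersSelf_coe, range_id, mfderivWithin_univ,
    (extChartAt 𝓘(ℝ, E) p).right_inv hq.2]
  change _ = (Bundle.Trivial.trivialization M ℝ).continuousLinearMapAt ℝ
    ((extChartAt 𝓘(ℝ, E) p).symm q.2)
    ((α q.1).val ((extChartAt 𝓘(ℝ, E) p).symm q.2) (chartSymmDeriv p q.2 v))
  rw [Bundle.Trivial.continuousLinearMapAt_trivialization]
  rfl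

variable {α : OneForm E M}

theorem OneForm.bilin_d_apply {x : M}
    (h : DifferentiableAt ℝ (α.inChart x) (extChartAt 𝓘(ℝ, E) x x)) (v w : E) :
    bilin (α.d x) v w = α.dval x v w :=
  ofSubsingleton_extDeriv_apply h v w

theorem hasFDerivAt_chart_comp_symm {p x : M} {z : E} (hz : z ∈ (extChartAt 𝓘(ℝ, E) p).target)
    (hx : (extChartAt 𝓘(ℝ, E) p).symm z ∈ (extChartAt 𝓘(ℝ, E) x).source) :
    HasFDerivAt (fun z ↦ extChartAt 𝓘(ℝ, E) x ((extChartAt 𝓘(ℝ, E) p).symm z))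
      ((chartDeriv (E := E) x ((extChartAt 𝓘(ℝ, E) p).symm z)).comp (chartSymmDeriv p z)) z :=
  ((hasMFDerivAt_chart hx).comp z (hasMFDerivAt_chart_symm hz)).hasFDerivAt

theorem OneForm.inChart_eq_comp {p x : M} {z : E} (hz : z ∈ (extChartAt 𝓘(ℝ, E) p).target)
    (hx : (extChartAt 𝓘(ℝ, E) p).symm z ∈ (extChartAt 𝓘(ℝ, E) x).source) :
    α.inChart p z = (α.inChart x (extChartAt 𝓘(ℝ, E) x ((extChartAt 𝓘(ℝ, E) p).symm z))).comp
      (fderiv ℝ (fun z ↦ extChartAt 𝓘(ℝ, E) x ((extChartAt 𝓘(ℝ, E) p).symm z)) z) := by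
  ext v
  have h := chartSymmDeriv_chartDeriv ((extChartAt 𝓘(ℝ, E) x).map_source hx)
    (chartSymmDeriv p z v)
  rw [(extChartAt 𝓘(ℝ, E) x).left_inv hx] at h
  rw [(hasFDerivAt_chart_comp_symm hz hx).fderiv, ContinuousLinearMap.comp_apply, α.inChart_apply,
    α.inChart_apply, ContinuousLinearMap.comp_apply, h, (extChartAt 𝓘(ℝ, E) x).left_inv hx]

/-- `dval` at x is computed in the chart at x, which varies with x; this compares it with the fixed
chart at p. The transition map has derivative `chartSymmDeriv p y` at y, because the chart at x has
identity derivative at x. -/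
theorem OneForm.curl_inChart {p : M} {y : E} (hy : y ∈ (extChartAt 𝓘(ℝ, E) p).target)
    (h : DifferentiableAt ℝ (α.inChart ((extChartAt 𝓘(ℝ, E) p).symm y))
      (extChartAt 𝓘(ℝ, E) ((extChartAt 𝓘(ℝ, E) p).symm y) ((extChartAt 𝓘(ℝ, E) p).symm y)))
    (v w : E) :
    curl (α.inChart p) y v w = α.dval ((extChartAt 𝓘(ℝ, E) p).symm y)
      (chartSymmDeriv p y v) (chartSymmDeriv p y w) := by
  set x := (extChartAt 𝓘(ℝ, E) p).symm y with hx
  set τ : E → E := fun z ↦ extChartAt 𝓘(ℝ, E) x ((extChartAt 𝓘(ℝ, E) p).symm z) with hτ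
  have hxs : (extChartAt 𝓘(ℝ, E) p).symm y ∈ (extChartAt 𝓘(ℝ, E) x).source :=
    mem_extChartAt_source x
  have hev : ∀ᶠ z in 𝓝 y, z ∈ (extChartAt 𝓘(ℝ, E) p).target ∧
      (extChartAt 𝓘(ℝ, E) p).symm z ∈ (extChartAt 𝓘(ℝ, E) x).source :=
    Filter.Eventually.and ((isOpen_extChartAt_target p).mem_nhds hy) (
      (hasMFDerivAt_chart_symm hy).continuousAt.preimage_mem_nhds
        ((isOpen_extChartAt_source x).mem_nhds hxs))
  have hcd : ContDiffAt ℝ 2 τ y := by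
    have h1 : ContMDiffAt 𝓘(ℝ, E) 𝓘(ℝ, E) ∞ τ y :=
      (contMDiffAt_extChartAt' (by simpa using hxs)).comp y
        ((contMDiffOn_extChartAt_symm p).contMDiffAt
          ((isOpen_extChartAt_target p).mem_nhds hy))
    exact h1.contDiffAt.of_le (by norm_cast)
  have hD : fderiv ℝ τ y = chartSymmDeriv p y := by
    rw [(hasFDerivAt_chart_comp_symm hy hxs).fderiv]
    ext v
    exact chartDeriv_self x _
  have heq : α.inChart p =ᶠ[𝓝 y] fun z ↦ (α.inChart x (τ z)).comp (fderiv ℝ τ z) :=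
    hev.mono fun z hz ↦ OneForm.inChart_eq_comp hz.1 hz.2
  have : curl (α.inChart p) y = curl (fun z ↦ (α.inChart x (τ z)).comp (fderiv ℝ τ z)) y := by
    rw [curl, curl, heq.fderiv_eq]
  rw [this, curl_pullback h hcd, hD]
  rfl

end FormsInCharts

/-! ### Smooth families of 1-forms and their time derivatives. -/

section Families

open Topology Filter

variable {E : Type*} [NormedAddCommGroup E] [NormedSpace ℝ E]
variable {M : Type*} [TopologicalSpace M] [ChartedSpace E M] [IsManifold 𝓘(ℝ, E) ∞ M]
variable {α β : ℝ → OneForm E M} {t : ℝ}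

/-- The time derivative of a family of `1`-forms, with `T_x M` identified with `E`. -/
def timeDeriv (α : ℝ → OneForm E M) (t : ℝ) (x : M) : E →L[ℝ] ℝ :=
  derivWithin (fun s ↦ (α s).val x) (Icc 0 1) t

theorem hasDerivWithinAt_val (hα : IsSmoothFamily α) (ht : t ∈ Icc (0 : ℝ) 1) (x : M) :
    HasDerivWithinAt (fun s ↦ (α s).val x) (timeDeriv α t x) (Icc 0 1) t := by
  have h := hasDerivWithinAt_slice (contDiffOn_inChart hα x) ht
    (mem_extChartAt_target (I := 𝓘(ℝ, E)) x)
  simp only [OneForm.inChart_self] at h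
  exact h.differentiableWithinAt.hasDerivWithinAt

theorem hasDerivWithinAt_inChart (hα : IsSmoothFamily α) (ht : t ∈ Icc (0 : ℝ) 1) (p : M) (y : E) :
    HasDerivWithinAt (fun s ↦ (α s).inChart p y)
      ((timeDeriv α t ((extChartAt 𝓘(ℝ, E) p).symm y)).comp (chartSymmDeriv p y)) (Icc 0 1) t :=
  ((ContinuousLinearMap.compL ℝ E E ℝ).flip
    (chartSymmDeriv p y)).hasFDerivAt.comp_hasDerivWithinAt t (hasDerivWithinAt_val hα ht _)

theorem contDiffOn_timeDeriv (hα : IsSmoothFamily α) (p : M) :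
    ContDiffOn ℝ ∞ (fun q : ℝ × E ↦ (timeDeriv α q.1 ((extChartAt 𝓘(ℝ, E) p).symm q.2)).comp
      (chartSymmDeriv p q.2)) (Icc (0 : ℝ) 1 ×ˢ (extChartAt 𝓘(ℝ, E) p).target) := by
  have h := contDiffOn_inChart hα p
  refine ((contDiffOn_fderivWithin_prod (uniqueDiffOn_Icc one_pos)
    (isOpen_extChartAt_target p) h).clm_apply
    (contDiffOn_const (c := ((1 : ℝ), (0 : E))))).congr fun q hq ↦ ?_
  exact (uniqueDiffOn_Icc one_pos q.1 hq.1).eq_deriv _ (hasDerivWithinAt_inChart hα hq.1 p q.2)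
    (hasDerivWithinAt_slice h hq.1 hq.2)

theorem differentiableAt_inChart (hα : IsSmoothFamily α) (ht : t ∈ Icc (0 : ℝ) 1) {p : M} {y : E}
    (hy : y ∈ (extChartAt 𝓘(ℝ, E) p).target) : DifferentiableAt ℝ ((α t).inChart p) y :=
  (hasFDerivAt_slice (isOpen_extChartAt_target p) (contDiffOn_inChart hα p) ht
    hy).differentiableAt

theorem contDiffOn_curl_inChart [FiniteDimensional ℝ E] (hα : IsSmoothFamily α) (p : M) :
    ContDiffOn ℝ ∞ (fun q : ℝ × E ↦ curl ((α q.1).inChart p) q.2)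
      (Icc (0 : ℝ) 1 ×ˢ (extChartAt 𝓘(ℝ, E) p).target) := by
  have h := contDiffOn_inChart hα p
  have h1 : ContDiffOn ℝ ∞ (fun q : ℝ × E ↦ fderiv ℝ ((α q.1).inChart p) q.2)
      (Icc (0 : ℝ) 1 ×ˢ (extChartAt 𝓘(ℝ, E) p).target) :=
    ((contDiffOn_fderivWithin_prod (uniqueDiffOn_Icc one_pos)
    (isOpen_extChartAt_target p) h).clm_comp
      (contDiffOn_const (c := ContinuousLinearMap.inr ℝ ℝ E))).congr fun q hq ↦
        (hasFDerivAt_slice (isOpen_extChartAt_target p) h hq.1 hq.2).fderiv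
  have h2 : ∀ v w : E, ContDiffOn ℝ ∞ (fun q : ℝ × E ↦ fderiv ℝ ((α q.1).inChart p) q.2 v w)
      (Icc (0 : ℝ) 1 ×ˢ (extChartAt 𝓘(ℝ, E) p).target) := fun v w ↦
    (h1.clm_apply contDiffOn_const).clm_apply contDiffOn_const
  refine contDiffOn_clm_apply.2 fun v ↦ contDiffOn_clm_apply.2 fun w ↦ ?_
  simp only [curl_apply]
  exact (h2 v w).sub (h2 w v)

theorem curl_inChart_apply (hα : IsSmoothFamily α) (ht : t ∈ Icc (0 : ℝ) 1) {p : M} {y : E}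
    (hy : y ∈ (extChartAt 𝓘(ℝ, E) p).target) (v w : E) :
    curl ((α t).inChart p) y v w = (α t).dval ((extChartAt 𝓘(ℝ, E) p).symm y)
      (chartSymmDeriv p y v) (chartSymmDeriv p y w) :=
  OneForm.curl_inChart hy (differentiableAt_inChart hα ht (mem_extChartAt_target _)) v w

theorem bilin_d_eq (hα : IsSmoothFamily α) (ht : t ∈ Icc (0 : ℝ) 1) (x : M) (v w : E) :
    bilin ((α t).d x) v w = (α t).dval x v w :=
  OneForm.bilin_d_apply (differentiableAt_inChart hα ht (mem_extChartAt_target x)) v w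

/-- The time derivative vanishes on a kernel that does not depend on time. -/
theorem timeDeriv_eq_zero (hα : IsSmoothFamily α) (ht : t ∈ Icc (0 : ℝ) 1) {x : M} {v : E}
    (hv : ∀ s ∈ Icc (0 : ℝ) 1, (α s).val x v = 0) : timeDeriv α t x v = 0 := by
  have h1 := (hasDerivWithinAt_val hα ht x).clm_apply (hasDerivWithinAt_const t (Icc 0 1) v)
  have h2 := (hasDerivWithinAt_const t (Icc (0 : ℝ) 1) (0 : ℝ)).congr hv (hv t ht)
  simpa using (uniqueDiffOn_Icc one_pos t ht).eq_deriv _ h1 h2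

end Families

/-! ### The generating field and the Reeb fields on the manifold. -/

section GrayField

open Topology Filter

variable {E : Type*} [NormedAddCommGroup E] [NormedSpace ℝ E] [FiniteDimensional ℝ E]

section Smoothness

variable {G : Type*} [NormedAddCommGroup G] [NormedSpace ℝ G] {S : Set G}
  {a b c a' b' : G → E →L[ℝ] ℝ} {ζ η : G → E →L[ℝ] E →L[ℝ] ℝ}

/-- Inversion of operators is smooth at invertible ones, and `grayForm` is invertible at every point
of `S`. -/
theorem contDiffOn_reebVector (ha : ContDiffOn ℝ ∞ a S) (hb : ContDiffOn ℝ ∞ b S)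
    (hζ : ContDiffOn ℝ ∞ ζ S) (hη : ContDiffOn ℝ ∞ η S) (hc : ContDiffOn ℝ ∞ c S)
    (h : ∀ q ∈ S, IsLinearContactPair (a q) (b q) (fun v w ↦ ζ q v w) (fun v w ↦ η q v w)) :
    ContDiffOn ℝ ∞ (fun q ↦ reebVector (a q) (b q) (ζ q) (η q) (c q)) S := by
  have h1 : ContDiffOn ℝ ∞ (fun q ↦ grayForm (a q) (b q) (ζ q) (η q)) S :=
    ((hζ.add hη).add (ha.smulRight ha)).add (hb.smulRight hb)
  refine ContDiffOn.clm_apply (fun q hq ↦ ?_) hc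
  obtain ⟨e, he⟩ := (h q hq).exists_equiv_grayForm
  have := (contDiffAt_map_inverse (n := ∞) e)
  rw [he] at this
  exact this.comp_contDiffWithinAt q (h1 q hq)

theorem contDiffOn_grayVector (ha : ContDiffOn ℝ ∞ a S) (hb : ContDiffOn ℝ ∞ b S)
    (hζ : ContDiffOn ℝ ∞ ζ S) (hη : ContDiffOn ℝ ∞ η S)
    (ha' : ContDiffOn ℝ ∞ a' S) (hb' : ContDiffOn ℝ ∞ b' S)
    (h : ∀ q ∈ S, IsLinearContactPair (a q) (b q) (fun v w ↦ ζ q v w) (fun v w ↦ η q v w)) :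
    ContDiffOn ℝ ∞ (fun q ↦ grayVector (a q) (b q) (ζ q) (η q) (a' q) (b' q)) S := by
  have hR := contDiffOn_reebVector ha hb hζ hη ha h
  have hS := contDiffOn_reebVector ha hb hζ hη hb h
  exact contDiffOn_reebVector ha hb hζ hη (((ha'.neg.sub hb').add
    ((ha'.clm_apply hR).smul ha)).add ((hb'.clm_apply hS).smul hb)) h

end Smoothness

variable {M : Type*} [TopologicalSpace M] [ChartedSpace E M] [IsManifold 𝓘(ℝ, E) ∞ M]
variable {α β : ℝ → OneForm E M} {h k : ℕ} {t : ℝ}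

/-- The kernel foliation at `x`, with `T_x M` identified with `E`. -/
def OneForm.kerVal (α : OneForm E M) (h : ℕ) (x : M) : Submodule ℝ E := (α.kerFoliation h x :)

theorem isLinearContactPair_val (hα : IsSmoothFamily α) (hβ : IsSmoothFamily β)
    (ht : t ∈ Icc (0 : ℝ) 1) (hp : IsContactPair h k (α t) (β t)) (x : M) :
    IsLinearContactPair ((α t).val x) ((β t).val x) (fun v w ↦ (α t).dval x v w)
        (fun v w ↦ (β t).dval x v w) ∧
      (∀ v, v ∈ (α t).kerVal h x ↔ (α t).val x v = 0 ∧ ∀ w, (α t).dval x v w = 0) ∧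
      (∀ v, v ∈ (β t).kerVal k x ↔ (β t).val x v = 0 ∧ ∀ w, (β t).dval x v w = 0) := by
  -- The forms are renamed as forms on `E` rather than on the tangent space, so that the linear
  -- algebra applies with V = E.
  obtain ⟨ζ, hζ⟩ : ∃ ζ : E [⋀^Fin 2]→ₗ[ℝ] ℝ, ζ = ((α t).d x :) := ⟨_, rfl⟩
  obtain ⟨η, hη⟩ : ∃ η : E [⋀^Fin 2]→ₗ[ℝ] ℝ, η = ((β t).d x :) := ⟨_, rfl⟩
  obtain ⟨a, ha⟩ : ∃ a : E →ₗ[ℝ] ℝ, a = ((α t).val x).toLinearMap := ⟨_, rfl⟩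
  obtain ⟨b, hb⟩ : ∃ b : E →ₗ[ℝ] ℝ, b = ((β t).val x).toLinearMap := ⟨_, rfl⟩
  have kα : (α t).kerVal h x = formKer (wedge (asForm a) (wedgePow ζ h)) := by
    subst hζ ha; rfl
  have kβ : (β t).kerVal k x = formKer (wedge (asForm b) (wedgePow η k)) := by
    subst hη hb; rfl
  have eα : ∀ v w, bilin ζ v w = (α t).dval x v w := by
    subst hζ; exact bilin_d_eq hα ht x
  have eβ : ∀ v w, bilin η v w = (β t).dval x v w := by
    subst hη; exact bilin_d_eq hβ ht x
  obtain ⟨h1, h2, h3⟩ := isLinearContactPair_of_wedge (V := E) hp.isVolumeForm.1 a b ζ η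
    (by subst hζ hη ha hb; exact hp.isVolumeForm.2 x) (by subst hζ; exact hp.d_left_pow x)
    (by subst hη; exact hp.d_right_pow x)
  refine ⟨?_, fun v ↦ ?_, fun v ↦ ?_⟩
  · have hα' : (fun v w ↦ (α t).dval x v w) = fun v ↦ (bilin ζ v : E → ℝ) :=
      funext₂ fun v w ↦ (eα v w).symm
    have hβ' : (fun v w ↦ (β t).dval x v w) = fun v ↦ (bilin η v : E → ℝ) :=
      funext₂ fun v w ↦ (eβ v w).symm
    rw [hα', hβ']
    subst ha hb
    exact h1
  · rw [kα, h2, Submodule.mem_inf, LinearMap.mem_ker, LinearMap.mem_ker, LinearMap.ext_iff, ha]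
    simp only [eα]
    rfl
  · rw [kβ, h3, Submodule.mem_inf, LinearMap.mem_ker, LinearMap.mem_ker, LinearMap.ext_iff, hb]
    simp only [eβ]
    rfl

/-- The vector field generating the stabilizing isotopy. -/
def grayField (α β : ℝ → OneForm E M) (t : ℝ) (x : M) : E :=
  grayVector ((α t).val x) ((β t).val x) ((α t).dval x) ((β t).dval x) (timeDeriv α t x)
    (timeDeriv β t x)

/-- The Reeb vector fields of a pair of forms. -/
def reebField (α β γ : ℝ → OneForm E M) (t : ℝ) (x : M) : E :=
  reebVector ((α t).val x) ((β t).val x) ((α t).dval x) ((β t).dval x) ((γ t).val x)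

theorem isLinearContactPair_inChart (hα : IsSmoothFamily α) (hβ : IsSmoothFamily β)
    (ht : t ∈ Icc (0 : ℝ) 1) (hp : IsContactPair h k (α t) (β t)) {p : M} {y : E}
    (hy : y ∈ (extChartAt 𝓘(ℝ, E) p).target) :
    IsLinearContactPair ((α t).inChart p y) ((β t).inChart p y)
      (fun v w ↦ curl ((α t).inChart p) y v w) (fun v w ↦ curl ((β t).inChart p) y v w) :=
  (isLinearContactPair_val hα hβ ht hp _).1.pullback (chartSymmEquiv hy) (fun _ ↦ rfl)
    (fun _ ↦ rfl) (curl_inChart_apply hα ht hy) (curl_inChart_apply hβ ht hy)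

/-- By naturality, the coordinate expression of the field is the generating vector of the coordinate
expressions of the forms, which depends smoothly on them. -/
theorem isSmoothField_grayField (hα : IsSmoothFamily α) (hβ : IsSmoothFamily β)
    (hp : ∀ t ∈ Icc (0 : ℝ) 1, IsContactPair h k (α t) (β t)) :
    IsSmoothField (grayField α β) := by
  intro p
  refine (contDiffOn_grayVector (contDiffOn_inChart hα p) (contDiffOn_inChart hβ p)
    (contDiffOn_curl_inChart hα p) (contDiffOn_curl_inChart hβ p) (contDiffOn_timeDeriv hα p)
    (contDiffOn_timeDeriv hβ p)
    fun q hq ↦ isLinearContactPair_inChart hα hβ hq.1 (hp _ hq.1) hq.2).congr fun q hq ↦ ?_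
  have := (isLinearContactPair_val hα hβ hq.1 (hp _ hq.1) _).1.grayVector_pullback
    (chartSymmEquiv hq.2) (a₁ := (α q.1).inChart p q.2) (b₁ := (β q.1).inChart p q.2)
    (fun _ ↦ rfl) (fun _ ↦ rfl) (curl_inChart_apply hα hq.1 hq.2)
    (curl_inChart_apply hβ hq.1 hq.2) (a' := timeDeriv α q.1 ((extChartAt 𝓘(ℝ, E) p).symm q.2))
    (b' := timeDeriv β q.1 ((extChartAt 𝓘(ℝ, E) p).symm q.2))
    (a₁' := (timeDeriv α q.1 ((extChartAt 𝓘(ℝ, E) p).symm q.2)).comp (chartSymmDeriv p q.2))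
    (b₁' := (timeDeriv β q.1 ((extChartAt 𝓘(ℝ, E) p).symm q.2)).comp (chartSymmDeriv p q.2))
    (fun _ ↦ rfl) (fun _ ↦ rfl)
  rw [chartField, grayField, ← this, chartSymmEquiv_apply, chartDeriv_chartSymmDeriv hq.2]

theorem isSmoothField_reebField {γ : ℝ → OneForm E M} (hα : IsSmoothFamily α)
    (hβ : IsSmoothFamily β) (hγ : IsSmoothFamily γ)
    (hp : ∀ t ∈ Icc (0 : ℝ) 1, IsContactPair h k (α t) (β t)) :
    IsSmoothField (reebField α β γ) := by
  intro p
  refine (contDiffOn_reebVector (contDiffOn_inChart hα p) (contDiffOn_inChart hβ p)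
    (contDiffOn_curl_inChart hα p) (contDiffOn_curl_inChart hβ p) (contDiffOn_inChart hγ p)
    fun q hq ↦ isLinearContactPair_inChart hα hβ hq.1 (hp _ hq.1) hq.2).congr fun q hq ↦ ?_
  have := (isLinearContactPair_val hα hβ hq.1 (hp _ hq.1) _).1.reebVector_pullback
    (chartSymmEquiv hq.2) (a₁ := (α q.1).inChart p q.2) (b₁ := (β q.1).inChart p q.2)
    (fun _ ↦ rfl) (fun _ ↦ rfl) (curl_inChart_apply hα hq.1 hq.2)
    (curl_inChart_apply hβ hq.1 hq.2)
    (c := (γ q.1).val ((extChartAt 𝓘(ℝ, E) p).symm q.2)) (c₁ := (γ q.1).inChart p q.2)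
    (fun _ ↦ rfl)
  rw [chartField, reebField, ← this, chartSymmEquiv_apply, chartDeriv_chartSymmDeriv hq.2]

/-- The constancy of the foliations enters here: a vector of F at time t lies in Ker α_s for every
s, so α_t' vanishes on it; likewise for β and G. -/
theorem grayField_spec (hα : IsSmoothFamily α) (hβ : IsSmoothFamily β)
    (hp : ∀ t ∈ Icc (0 : ℝ) 1, IsContactPair h k (α t) (β t))
    (hF : ∀ t ∈ Icc (0 : ℝ) 1, (α t).kerFoliation h = (α 0).kerFoliation h)
    (hG : ∀ t ∈ Icc (0 : ℝ) 1, (β t).kerFoliation k = (β 0).kerFoliation k)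
    (ht : t ∈ Icc (0 : ℝ) 1) (x : M) :
    (α t).val x (grayField α β t x) = 0 ∧ (β t).val x (grayField α β t x) = 0 ∧
      (∀ w, (α t).dval x (grayField α β t x) w =
        -timeDeriv α t x w + timeDeriv α t x (reebField α β α t x) * (α t).val x w) ∧
      ∀ w, (β t).dval x (grayField α β t x) w =
        -timeDeriv β t x w + timeDeriv β t x (reebField α β β t x) * (β t).val x w := by
  have hpair := fun s hs ↦ isLinearContactPair_val hα hβ hs (hp s hs) x
  refine (hpair t ht).1.grayVector_spec (fun v h1 h2 ↦ ?_) (fun v h1 h2 ↦ ?_)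
  · refine timeDeriv_eq_zero hα ht fun s hs ↦ (((hpair s hs).2.1 v).1 ?_).1
    rw [OneForm.kerVal, hF s hs, ← hF t ht]
    exact ((hpair t ht).2.1 v).2 ⟨h1, h2⟩
  · refine timeDeriv_eq_zero hβ ht fun s hs ↦ (((hpair s hs).2.2 v).1 ?_).1
    rw [OneForm.kerVal, hG s hs, ← hG t ht]
    exact ((hpair t ht).2.2 v).2 ⟨h1, h2⟩

end GrayField

/-! ### Derivative of the pulled-back form along the flow, in coordinates. -/

section FirstVariation

variable {E : Type*} [NormedAddCommGroup E] [NormedSpace ℝ E]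
variable {J : Set ℝ} {U Ω : Set E} {u F : ℝ × E → E} {a : ℝ × E → E →L[ℝ] ℝ} {t : ℝ} {ξ : E}

/-- The spatial derivative of a flow solves the linearized equation. -/
theorem hasDerivWithinAt_fderivWithin_flow (hJ : UniqueDiffOn ℝ J) (hJc : J ⊆ closure (interior J))
    (hU : IsOpen U) (hu : ContDiffOn ℝ ∞ u (J ×ˢ U))
    (hflow : ∀ z ∈ U, HasDerivWithinAt (fun s ↦ u (s, z)) (F (t, u (t, z))) J t)
    (ht : t ∈ J) (hξ : ξ ∈ U) (hF : DifferentiableAt ℝ (fun y ↦ F (t, y)) (u (t, ξ))) (v : E) :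
    HasDerivWithinAt (fun s ↦ fderivWithin ℝ u (J ×ˢ U) (s, ξ) (0, v))
      (fderiv ℝ (fun y ↦ F (t, y)) (u (t, ξ)) (fderivWithin ℝ u (J ×ˢ U) (t, ξ) (0, v))) J t := by
  have hu' := contDiffOn_fderivWithin_prod hJ hU hu
  have h1 := (hasDerivWithinAt_slice hu' ht hξ).clm_apply
    (hasDerivWithinAt_const t J ((0 : ℝ), v))
  -- Symmetry of second derivatives within J × U also holds at end times belonging to J, since J
  -- lies in the closure of its interior.
  have hsymm : IsSymmSndFDerivWithinAt ℝ u (J ×ˢ U) (t, ξ) := by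
    refine (hu (t, ξ) ⟨ht, hξ⟩).isSymmSndFDerivWithinAt
      (by rw [minSmoothness_of_isRCLikeNormedField]; norm_cast) (hJ.prod hU.uniqueDiffOn) ?_
      ⟨ht, hξ⟩
    rw [interior_prod_eq, closure_prod_eq, hU.interior_eq]
    exact ⟨hJc ht, subset_closure hξ⟩
  have h2 : HasFDerivAt (fun z ↦ fderivWithin ℝ u (J ×ˢ U) (t, z) (1, 0))
      (((fderivWithin ℝ (fderivWithin ℝ u (J ×ˢ U)) (J ×ˢ U) (t, ξ)).comp
        (ContinuousLinearMap.inr ℝ ℝ E)).flip (1, 0)) ξ := by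
    have := (hasFDerivAt_slice hU hu' ht hξ).clm_apply
      (hasFDerivAt_const (((1 : ℝ), (0 : E))) ξ)
    simpa using! this
  have h3 : HasFDerivAt (fun z ↦ F (t, u (t, z))) ((fderiv ℝ (fun y ↦ F (t, y)) (u (t, ξ))).comp
      ((fderivWithin ℝ u (J ×ˢ U) (t, ξ)).comp (ContinuousLinearMap.inr ℝ ℝ E))) ξ :=
    HasFDerivAt.comp (g := fun y ↦ F (t, y)) ξ hF.hasFDerivAt (hasFDerivAt_slice hU hu ht hξ)
  -- Both sides of ∂_t u = F(t, u) are differentiated in space.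
  have h4 := h2.unique (h3.congr_of_eventuallyEq (by
    filter_upwards [hU.mem_nhds hξ] with z hz
    exact (hJ t ht).eq_deriv _ (hasDerivWithinAt_slice hu ht hz) (hflow z hz)))
  have h5 := DFunLike.congr_fun h4 v
  simp only [ContinuousLinearMap.flip_apply, ContinuousLinearMap.comp_apply,
    ContinuousLinearMap.inr_apply] at h5
  rw [← h5, hsymm.eq]
  simpa using! h1

/-- The derivative of the pullback of a family of `1`-forms under the flow of a field `F` that
lies in their kernel. -/
theorem hasDerivWithinAt_pullback_flow (hJ : UniqueDiffOn ℝ J) (hJI : J ⊆ Icc 0 1)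
    (hJc : J ⊆ closure (interior J)) (hU : IsOpen U) (hΩ : IsOpen Ω)
    (hu : ContDiffOn ℝ ∞ u (J ×ˢ U)) (huΩ : ∀ s ∈ J, ∀ z ∈ U, u (s, z) ∈ Ω)
    (hflow : ∀ z ∈ U, HasDerivWithinAt (fun s ↦ u (s, z)) (F (t, u (t, z))) J t)
    (hF : ContDiffOn ℝ ∞ F (Icc 0 1 ×ˢ Ω)) (ha : ContDiffOn ℝ ∞ a (Icc 0 1 ×ˢ Ω))
    (haF : ∀ y ∈ Ω, a (t, y) (F (t, y)) = 0) (ht : t ∈ J) (hξ : ξ ∈ U)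
    {a' : E →L[ℝ] ℝ} (ha' : HasDerivWithinAt (fun s ↦ a (s, u (t, ξ))) a' (Icc 0 1) t) {m : ℝ}
    (hcurl : ∀ w, curl (fun y ↦ a (t, y)) (u (t, ξ)) (F (t, u (t, ξ))) w =
      -a' w + m * a (t, u (t, ξ)) w) (v : E) :
    HasDerivWithinAt (fun s ↦ a (s, u (s, ξ)) (fderivWithin ℝ u (J ×ˢ U) (s, ξ) (0, v)))
      (m * a (t, u (t, ξ)) (fderivWithin ℝ u (J ×ˢ U) (t, ξ) (0, v))) J t := by
  have htI := hJI ht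
  have hy := huΩ t ht ξ hξ
  set y := u (t, ξ) with hydef
  set w := fderivWithin ℝ u (J ×ˢ U) (t, ξ) (0, v)
  have hFy := hasFDerivAt_slice hΩ hF htI hy
  have hay := hasFDerivAt_slice hΩ ha htI hy
  have hW := hasDerivWithinAt_fderivWithin_flow hJ hJc hU hu hflow ht hξ hFy.differentiableAt v
  set A := fderivWithin ℝ a (Icc 0 1 ×ˢ Ω) (t, y) with hA
  have ea : fderiv ℝ (fun z ↦ a (t, z)) y = A.comp (ContinuousLinearMap.inr ℝ ℝ E) := hay.fderiv
  have ea' : A (1, 0) = a' :=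
    (uniqueDiffOn_Icc one_pos t htI).eq_deriv _ (hasDerivWithinAt_slice ha htI hy) ha'
  have hcurve : HasDerivWithinAt (fun s ↦ (s, u (s, ξ))) ((1 : ℝ), F (t, y)) J t :=
    (hasDerivWithinAt_id t J).prodMk (hflow ξ hξ)
  have hg : HasDerivWithinAt (fun s ↦ a (s, u (s, ξ))) (A (1, F (t, y))) J t := by
    have h1 : HasFDerivWithinAt a A (Icc 0 1 ×ˢ Ω) (t, u (t, ξ)) :=
      hasFDerivWithinAt_prod ha htI hy
    exact h1.comp_hasDerivWithinAt t hcurve fun s hs ↦ mk_mem_prod (hJI hs) (huΩ s hs ξ hξ)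
  -- The identity a(F) = 0 on Ω, differentiated in the direction w.
  have hzero : A (0, w) (F (t, y)) + a (t, y) (fderiv ℝ (fun z ↦ F (t, z)) y w) = 0 := by
    have h1 := hay.clm_apply hFy
    have h2 := h1.unique ((hasFDerivAt_const (0 : ℝ) y).congr_of_eventuallyEq (by
      filter_upwards [hΩ.mem_nhds hy] with z hz using haF z hz))
    have h3 := DFunLike.congr_fun h2 w
    rw [hFy.fderiv]
    simpa [add_comm] using! h3
  have hc := hcurl w
  rw [curl_apply, ea] at hc
  simp only [ContinuousLinearMap.comp_apply, ContinuousLinearMap.inr_apply] at hc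
  have hsplit : A (1, F (t, y)) w = a' w + A (0, F (t, y)) w := by
    rw [← ea', ← _root_.add_apply, ← map_add]
    simp
  have h := hg.clm_apply hW
  refine h.congr_deriv ?_
  -- By `hzero` the second term is -A(0, w)(F). With `hsplit` the sum is a'(w) plus the curl applied
  -- to (F, w), that is, Cartan's formula with a(F) = 0; `hc` evaluates it to m·a(w).
  change A (1, F (t, y)) w + a (t, y) (fderiv ℝ (fun z ↦ F (t, z)) y w) = _
  linarith

end FirstVariation

/-! ### Scalar linear equations and the time intervals used. -/

section LinearEquation

/-- A solution of a scalar linear equation that vanishes once vanishes identically. -/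
theorem eqOn_zero_of_hasDerivWithinAt_mul {c m : ℝ → ℝ} {a b t : ℝ} (hm : ContinuousOn m (Icc a b))
    (hc : ∀ s ∈ Icc a b, HasDerivWithinAt c (m s * c s) (Icc a b) s) (ht : t ∈ Icc a b)
    (h0 : c t = 0) : EqOn c 0 (Icc a b) := by
  obtain ⟨K, hK⟩ := isCompact_Icc.exists_bound_of_continuousOn hm
  refine eqOn_of_hasDerivWithinAt (v := fun s y ↦ m s * y) (S := univ) (K := K.toNNReal) (t := t)
    (fun s hs ↦ ?_) hc (fun _ _ ↦ trivial) (fun s _ ↦ ?_) (fun _ _ ↦ trivial) ht h0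
  · refine (LipschitzWith.of_dist_le_mul fun y z ↦ ?_).lipschitzOnWith
    rw [Real.dist_eq, ← mul_sub, abs_mul, Real.dist_eq]
    exact mul_le_mul_of_nonneg_right ((hK s hs).trans (Real.le_coe_toNNReal K)) (abs_nonneg _)
  · simpa using! hasDerivWithinAt_const s (Icc a b) (0 : ℝ)

end LinearEquation

section Subintervals

variable {c d : ℝ}

theorem uniqueDiffOn_Icc_inter_Ioo : UniqueDiffOn ℝ (Icc (0 : ℝ) 1 ∩ Ioo c d) :=
  (uniqueDiffOn_Icc one_pos).inter isOpen_Ioo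

theorem Icc_inter_Ioo_subset_closure_interior :
    Icc (0 : ℝ) 1 ∩ Ioo c d ⊆ closure (interior (Icc (0 : ℝ) 1 ∩ Ioo c d)) := by
  rw [interior_inter, interior_Icc, isOpen_Ioo.interior_eq, ← closure_Ioo (zero_ne_one (α := ℝ))]
  exact isOpen_Ioo.closure_inter

end Subintervals

/-! ### Pullback of the forms by the isotopy and conclusion. -/

section Pullback

open Topology Filter

variable {E : Type*} [NormedAddCommGroup E] [NormedSpace ℝ E]
variable {M : Type*} [TopologicalSpace M] [ChartedSpace E M]

/-- The coordinate expression of a family of diffeomorphisms in the charts at `p` and `q`. -/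
def flowChart (φ : ℝ → Diffeomorph 𝓘(ℝ, E) 𝓘(ℝ, E) M M ∞) (p q : M) (r : ℝ × E) : E :=
  extChartAt 𝓘(ℝ, E) q (φ r.1 ((extChartAt 𝓘(ℝ, E) p).symm r.2))

/-- The derivative of a diffeomorphism, with tangent spaces identified with `E`. -/
def diffeoDeriv (φ : Diffeomorph 𝓘(ℝ, E) 𝓘(ℝ, E) M M ∞) (x : M) : E →L[ℝ] E :=
  (mfderiv 𝓘(ℝ, E) 𝓘(ℝ, E) φ x :)

theorem exists_flowChart_nhds {φ : ℝ → Diffeomorph 𝓘(ℝ, E) 𝓘(ℝ, E) M M ∞} (hφ : IsIsotopy φ)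
    {t₀ : ℝ} (ht₀ : t₀ ∈ Icc (0 : ℝ) 1) (x₀ : M) :
    ∃ c d U, t₀ ∈ Ioo c d ∧ IsOpen U ∧ extChartAt 𝓘(ℝ, E) x₀ x₀ ∈ U ∧
      U ⊆ (extChartAt 𝓘(ℝ, E) x₀).target ∧ ∀ t ∈ Icc (0 : ℝ) 1 ∩ Ioo c d, ∀ ξ ∈ U,
        φ t ((extChartAt 𝓘(ℝ, E) x₀).symm ξ) ∈ (extChartAt 𝓘(ℝ, E) (φ t₀ x₀)).source := by
  set χ := extChartAt 𝓘(ℝ, E) x₀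
  have h1 : ContinuousOn (fun r : ℝ × E ↦ φ r.1 (χ.symm r.2)) (Icc (0 : ℝ) 1 ×ˢ χ.target) :=
    hφ.smooth.continuousOn.comp (continuousOn_fst.prodMk
      ((continuousOn_extChartAt_symm x₀).comp continuousOn_snd fun r hr ↦ hr.2))
      fun r hr ↦ ⟨hr.1, trivial⟩
  have h2 := (h1 (t₀, χ x₀) ⟨ht₀, mem_extChartAt_target x₀⟩).preimage_mem_nhdsWithin
    ((isOpen_extChartAt_source (I := 𝓘(ℝ, E)) (φ t₀ x₀)).mem_nhds (by
      simp [χ]))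
  rw [nhdsWithin_prod_eq, mem_prod_iff] at h2
  obtain ⟨A, hA, B, hB, hAB⟩ := h2
  rw [nhdsWithin_eq_nhds.2
    ((isOpen_extChartAt_target x₀).mem_nhds (mem_extChartAt_target x₀))] at hB
  rw [mem_nhdsWithin_iff_exists_mem_nhds_inter] at hA
  obtain ⟨A', hA', hAA⟩ := hA
  obtain ⟨c, d, hcd, hcdA⟩ := mem_nhds_iff_exists_Ioo_subset.1 hA'
  refine ⟨c, d, interior B ∩ χ.target, hcd, isOpen_interior.inter (isOpen_extChartAt_target x₀),
    ⟨mem_interior_iff_mem_nhds.2 hB, mem_extChartAt_target x₀⟩, inter_subset_right, ?_⟩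
  intro t ht ξ hξ
  exact hAB (mk_mem_prod (hAA ⟨hcdA ht.2, ht.1⟩) (interior_subset hξ.1))

variable [IsManifold 𝓘(ℝ, E) ∞ M]

/-- The pullback of a `1`-form at `x`, with `T_x M` identified with `E`. -/
def OneForm.pullbackVal (φ : Diffeomorph 𝓘(ℝ, E) 𝓘(ℝ, E) M M ∞) (α : OneForm E M) (x : M) :
    E →L[ℝ] ℝ :=
  (α.val (φ x)).comp (diffeoDeriv φ x)

variable {φ : ℝ → Diffeomorph 𝓘(ℝ, E) 𝓘(ℝ, E) M M ∞} {α : ℝ → OneForm E M} {X R : ℝ → M → E}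
  {t t₀ c d : ℝ} {p q x : M} {U : Set E} {ξ : E}

theorem hasFDerivAt_flowChart (hξ : ξ ∈ (extChartAt 𝓘(ℝ, E) p).target)
    (hq : φ t ((extChartAt 𝓘(ℝ, E) p).symm ξ) ∈ (extChartAt 𝓘(ℝ, E) q).source) :
    HasFDerivAt (fun z ↦ flowChart φ p q (t, z))
      ((chartDeriv (E := E) q (φ t ((extChartAt 𝓘(ℝ, E) p).symm ξ))).comp
        ((diffeoDeriv (φ t) ((extChartAt 𝓘(ℝ, E) p).symm ξ)).comp (chartSymmDeriv p ξ))) ξ := by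
  have h1 : HasMFDerivAt 𝓘(ℝ, E) 𝓘(ℝ, E) (φ t) ((extChartAt 𝓘(ℝ, E) p).symm ξ)
      (diffeoDeriv (E := E) (φ t) ((extChartAt 𝓘(ℝ, E) p).symm ξ)) :=
    (((φ t).contMDiff.mdifferentiable (by simp)) _).hasMFDerivAt
  exact ((hasMFDerivAt_chart hq).comp ξ (h1.comp ξ (hasMFDerivAt_chart_symm hξ))).hasFDerivAt

/-- The flow maps the chart domain `U` at `p` into the chart domain at `q` for times in `(c, d)`. -/
structure IsFlowBox (φ : ℝ → Diffeomorph 𝓘(ℝ, E) 𝓘(ℝ, E) M M ∞) (p q : M) (c d : ℝ) (U : Set E) :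
    Prop where
  isOpen : IsOpen U
  subset_target : U ⊆ (extChartAt 𝓘(ℝ, E) p).target
  mem_source : ∀ t ∈ Icc (0 : ℝ) 1 ∩ Ioo c d, ∀ ξ ∈ U,
    φ t ((extChartAt 𝓘(ℝ, E) p).symm ξ) ∈ (extChartAt 𝓘(ℝ, E) q).source

theorem IsFlowBox.contDiffOn (hB : IsFlowBox φ p q c d U) (hφ : IsIsotopy φ) :
    ContDiffOn ℝ ∞ (flowChart φ p q) ((Icc (0 : ℝ) 1 ∩ Ioo c d) ×ˢ U) := by
  have h1 : ContMDiffOn 𝓘(ℝ, ℝ × E) (𝓘(ℝ, ℝ).prod 𝓘(ℝ, E)) ∞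
      (fun r : ℝ × E ↦ (r.1, (extChartAt 𝓘(ℝ, E) p).symm r.2))
      ((Icc (0 : ℝ) 1 ∩ Ioo c d) ×ˢ U) := by
    rw [modelWithCornersSelf_prod, ← chartedSpaceSelf_prod]
    exact contMDiffOn_fst.prodMk ((contMDiffOn_extChartAt_symm p).comp contMDiffOn_snd
      fun r hr ↦ hB.subset_target hr.2)
  have h2 := hφ.smooth.comp h1 fun r hr ↦ ⟨hr.1.1, trivial⟩
  have h3 : ContMDiffOn 𝓘(ℝ, E) 𝓘(ℝ, E) ∞ (extChartAt 𝓘(ℝ, E) q)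
      (extChartAt 𝓘(ℝ, E) q).source := by
    simpa using contMDiffOn_extChartAt (I := 𝓘(ℝ, E)) (n := ∞) (x := q)
  exact (h3.comp h2 fun r hr ↦ hB.mem_source r.1 hr.1 r.2 hr.2).contDiffOn

/-- Links the coordinate computation to the intrinsic pullback: the chart at q introduced by the
form and by the flow cancels. -/
theorem IsFlowBox.pullbackVal_apply (hB : IsFlowBox φ p q c d U) (hφ : IsIsotopy φ)
    (ht : t ∈ Icc (0 : ℝ) 1 ∩ Ioo c d) (hξ : ξ ∈ U) (β : OneForm E M) (v : E) :
    β.inChart q (flowChart φ p q (t, ξ))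
      (fderivWithin ℝ (flowChart φ p q) ((Icc (0 : ℝ) 1 ∩ Ioo c d) ×ˢ U) (t, ξ) (0, v)) =
    β.pullbackVal (φ t) ((extChartAt 𝓘(ℝ, E) p).symm ξ) (chartSymmDeriv p ξ v) := by
  have hs := hB.mem_source t ht ξ hξ
  have h1 := DFunLike.congr_fun ((hasFDerivAt_slice hB.isOpen (hB.contDiffOn hφ) ht hξ).unique
    (hasFDerivAt_flowChart (hB.subset_target hξ) hs)) v
  simp only [ContinuousLinearMap.comp_apply, ContinuousLinearMap.inr_apply] at h1
  have h2 := chartSymmDeriv_chartDeriv ((extChartAt 𝓘(ℝ, E) q).map_source hs)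
    (diffeoDeriv (φ t) ((extChartAt 𝓘(ℝ, E) p).symm ξ) (chartSymmDeriv p ξ v))
  rw [(extChartAt 𝓘(ℝ, E) q).left_inv hs] at h2
  rw [h1, OneForm.inChart_apply, flowChart, h2, (extChartAt 𝓘(ℝ, E) q).left_inv hs,
    OneForm.pullbackVal, ContinuousLinearMap.comp_apply]

/-- The function `φ_t^* α_t (R_0)` is smooth. -/
theorem isSmoothFunctionFamily_pullbackVal (hφ : IsIsotopy φ) (hα : IsSmoothFamily α)
    (hR : IsSmoothField R) :
    IsSmoothFunctionFamily (E := E) fun t x ↦ (α t).pullbackVal (φ t) x (R 0 x) := by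
  rintro ⟨t₀, x₀⟩ ⟨ht₀, -⟩
  obtain ⟨c, d, U, hcd, hU, hxU, hUt, hs⟩ := exists_flowChart_nhds hφ ht₀ x₀
  set q := φ t₀ x₀
  have hB : IsFlowBox φ x₀ q c d U := ⟨hU, hUt, hs⟩
  set χ := extChartAt 𝓘(ℝ, E) x₀ with hχ
  set J := Icc (0 : ℝ) 1 ∩ Ioo c d
  have hu := hB.contDiffOn hφ
  have hu' := contDiffOn_fderivWithin_prod uniqueDiffOn_Icc_inter_Ioo hU hu
  have hR0 : ContDiffOn ℝ ∞ (fun r : ℝ × E ↦ ((0 : ℝ), chartField R x₀ (0, r.2))) (J ×ˢ U) :=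
    contDiffOn_const.prodMk ((hR x₀).comp (contDiffOn_const.prodMk contDiffOn_snd)
      fun r hr ↦ mk_mem_prod ⟨le_rfl, zero_le_one⟩ (hUt hr.2))
  have ha : ContDiffOn ℝ ∞ (fun r : ℝ × E ↦ (α r.1).inChart q (flowChart φ x₀ q r)) (J ×ˢ U) :=
    (contDiffOn_inChart hα q).comp (contDiffOn_fst.prodMk hu) fun r hr ↦
      mk_mem_prod hr.1.1 ((extChartAt 𝓘(ℝ, E) q).map_source (hs r.1 hr.1 r.2 hr.2))
  have hf := ha.clm_apply (hu'.clm_apply hR0)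
  have hχs : ContMDiffOn 𝓘(ℝ, E) 𝓘(ℝ, E) ∞ χ χ.source := by
    simpa [hχ] using contMDiffOn_extChartAt (I := 𝓘(ℝ, E)) (n := ∞) (x := x₀)
  have h1 : ContMDiffOn (𝓘(ℝ, ℝ).prod 𝓘(ℝ, E)) 𝓘(ℝ, ℝ × E) ∞
      (fun r : ℝ × M ↦ (r.1, χ r.2)) (J ×ˢ (χ.source ∩ χ ⁻¹' U)) := by
    rw [modelWithCornersSelf_prod, ← chartedSpaceSelf_prod]
    exact contMDiffOn_fst.prodMk (hχs.comp contMDiffOn_snd fun r hr ↦ hr.2.1)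
  have h2 := hf.contMDiffOn.comp h1 fun r hr ↦ mk_mem_prod hr.1 hr.2.2
  have hmem : x₀ ∈ χ.source ∩ χ ⁻¹' U := ⟨mem_extChartAt_source x₀, hxU⟩
  have hnhds : J ×ˢ (χ.source ∩ χ ⁻¹' U) ∈ 𝓝[Icc (0 : ℝ) 1 ×ˢ univ] (t₀, x₀) := by
    rw [nhdsWithin_prod_eq, nhdsWithin_univ]
    exact prod_mem_prod (inter_Ioo_mem_nhdsWithin hcd) (inter_mem (extChartAt_source_mem_nhds x₀)
      ((continuousAt_extChartAt x₀).preimage_mem_nhds (hU.mem_nhds hxU)))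
  have heq : ∀ r ∈ J ×ˢ (χ.source ∩ χ ⁻¹' U),
      (α r.1).pullbackVal (φ r.1) r.2 (R 0 r.2) = (α r.1).inChart q (flowChart φ x₀ q (r.1, χ r.2))
        (fderivWithin ℝ (flowChart φ x₀ q) (J ×ˢ U) (r.1, χ r.2)
          (0, chartField R x₀ (0, χ r.2))) := by
    intro r hr
    rw [hB.pullbackVal_apply hφ hr.1 hr.2.2, chartField, chartSymmDeriv_chartDeriv (hUt hr.2.2)]
    rw [← hχ, χ.left_inv hr.2.1]
  refine ((h2 (t₀, x₀) ⟨⟨ht₀, hcd⟩, hmem⟩).mono_of_mem_nhdsWithin hnhds).congr_of_eventuallyEq ?_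
    (heq _ ⟨⟨ht₀, hcd⟩, hmem⟩)
  filter_upwards [hnhds] with r hr using heq r hr

/-- The evolution of the pullback of a family of forms under a field in their kernel. -/
theorem hasDerivWithinAt_pullbackVal (hφ : IsIsotopy φ) (hα : IsSmoothFamily α)
    (hX : IsSmoothField X) (hsol : ∀ x, ∀ t ∈ Icc (0 : ℝ) 1, IsSolAt X (fun s ↦ φ s x) t)
    (hαX : ∀ t ∈ Icc (0 : ℝ) 1, ∀ x, (α t).val x (X t x) = 0) {μ : ℝ → M → ℝ}
    (hd : ∀ t ∈ Icc (0 : ℝ) 1, ∀ x w, (α t).dval x (X t x) w =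
      -timeDeriv α t x w + μ t x * (α t).val x w) (ht : t ∈ Icc (0 : ℝ) 1) (x : M) (v : E) :
    HasDerivWithinAt (fun s ↦ (α s).pullbackVal (φ s) x v)
      (μ t (φ t x) * (α t).pullbackVal (φ t) x v) (Icc 0 1) t := by
  obtain ⟨c, d, U, hcd, hU, hxU, hUt, hs⟩ := exists_flowChart_nhds hφ ht x
  set q := φ t x
  have hB : IsFlowBox φ x q c d U := ⟨hU, hUt, hs⟩
  set χ := extChartAt 𝓘(ℝ, E) x with hχ
  set κ := extChartAt 𝓘(ℝ, E) q with hκ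
  have htJ : t ∈ Icc (0 : ℝ) 1 ∩ Ioo c d := ⟨ht, hcd⟩
  have hval : ∀ s ∈ Icc (0 : ℝ) 1 ∩ Ioo c d, (α s).inChart q (flowChart φ x q (s, χ x))
      (fderivWithin ℝ (flowChart φ x q) ((Icc (0 : ℝ) 1 ∩ Ioo c d) ×ˢ U) (s, χ x) (0, v)) =
      (α s).pullbackVal (φ s) x v := by
    intro s hs
    rw [hB.pullbackVal_apply hφ hs hxU, hχ, chartSymmDeriv_self, extChartAt_to_inv]
  have hut : flowChart φ x q (t, χ x) = κ q := by
    rw [flowChart, hχ, extChartAt_to_inv]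
  have hsymm : ∀ y ∈ κ.target, ∀ w, (α t).inChart q y (chartField X q (t, y)) = 0 ∧
      curl ((α t).inChart q) y (chartField X q (t, y)) w =
        -(timeDeriv α t (κ.symm y)).comp (chartSymmDeriv q y) w +
          μ t (κ.symm y) * (α t).inChart q y w := by
    intro y hy w
    have h1 : chartSymmDeriv q y (chartField X q (t, y)) = X t (κ.symm y) :=
      chartSymmDeriv_chartDeriv hy _
    rw [curl_inChart_apply hα ht hy, (α t).inChart_apply, (α t).inChart_apply, h1, ← hκ]
    exact ⟨hαX t ht _, hd t ht _ _⟩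
  have hκq : κ q ∈ κ.target := mem_extChartAt_target q
  have key := hasDerivWithinAt_pullback_flow (u := flowChart φ x q) (F := chartField X q)
    (a := fun r ↦ (α r.1).inChart q r.2) (Ω := κ.target) (m := μ t q) (ξ := χ x)
    uniqueDiffOn_Icc_inter_Ioo inter_subset_left Icc_inter_Ioo_subset_closure_interior hU
    (isOpen_extChartAt_target q) (hB.contDiffOn hφ)
    (fun s hs' z hz ↦ κ.map_source (hs s hs' z hz))
    (fun z hz ↦ ((hsol (χ.symm z) t ht).hasDerivWithinAt_chart (hs t htJ z hz)).mono
      inter_subset_left) (hX q) (contDiffOn_inChart hα q)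
    (fun y hy ↦ (hsymm y hy 0).1) htJ hxU
    (a' := (timeDeriv α t q).comp (chartSymmDeriv q (κ q)))
    (by
      have := hasDerivWithinAt_inChart hα ht q (κ q)
      rw [← hκ, κ.left_inv (mem_extChartAt_source q)] at this
      rw [hut]
      exact this)
    (fun w ↦ by
      have := (hsymm (κ q) hκq w).2
      rw [κ.left_inv (mem_extChartAt_source q)] at this
      rw [hut]
      exact this) v
  have hJ := inter_Ioo_mem_nhdsWithin (I := Icc (0 : ℝ) 1) hcd
  have key' := key.mono_of_mem_nhdsWithin hJ
  simp only [hval t htJ] at key'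
  refine key'.congr_of_eventuallyEq ?_ (hval t htJ).symm
  filter_upwards [hJ] with s hs using (hval s hs).symm

/-- Continuity of the coefficient of the linear equation for φ_t^*α_t, which supplies the Lipschitz
constant in its uniqueness. -/
theorem continuousOn_timeDeriv_apply (hφ : IsIsotopy φ) (hα : IsSmoothFamily α)
    (hR : IsSmoothField R) (x : M) :
    ContinuousOn (fun t ↦ timeDeriv α t (φ t x) (R t (φ t x))) (Icc 0 1) := by
  intro t ht
  set q := φ t x with hq
  set κ := extChartAt 𝓘(ℝ, E) q
  have hc : ContinuousWithinAt (fun s ↦ φ s x) (Icc 0 1) t :=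
    (hφ.smooth.continuousOn.comp (f := fun s : ℝ ↦ (s, x)) (by fun_prop)
      fun s hs ↦ ⟨hs, trivial⟩) t ht
  have h1 : ContinuousWithinAt (fun s ↦ (s, κ (φ s x))) (Icc 0 1) t :=
    continuousWithinAt_id.prodMk (ContinuousAt.comp_continuousWithinAt (f := fun s ↦ φ s x)
      (continuousAt_extChartAt q) hc)
  have hsrc : ∀ᶠ s in 𝓝[Icc 0 1] t, φ s x ∈ κ.source :=
    hc.preimage_mem_nhdsWithin (extChartAt_source_mem_nhds q)
  have h2 := ((contDiffOn_timeDeriv hα q).clm_apply (hR q)).continuousOn (t, κ q)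
    ⟨ht, mem_extChartAt_target q⟩
  have h3 := h2.tendsto.comp (tendsto_nhdsWithin_iff.2 ⟨h1, by
    filter_upwards [hsrc, self_mem_nhdsWithin] with s hs hsI
    exact mk_mem_prod hsI (κ.map_source hs)⟩)
  have heq : ∀ s ∈ Icc (0 : ℝ) 1, φ s x ∈ κ.source → timeDeriv α s (φ s x) (R s (φ s x)) =
      ((timeDeriv α s (κ.symm (κ (φ s x)))).comp (chartSymmDeriv q (κ (φ s x))))
        (chartField R q (s, κ (φ s x))) := by
    intro s _ hs
    rw [ContinuousLinearMap.comp_apply, chartField, chartSymmDeriv_chartDeriv (κ.map_source hs),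
      κ.left_inv hs]
  rw [ContinuousWithinAt, heq t ht (mem_extChartAt_source q)]
  refine h3.congr' ?_
  filter_upwards [hsrc, self_mem_nhdsWithin] with s hs hsI using (heq s hsI hs).symm

theorem pullbackVal_zero (hφ : IsIsotopy φ) (β : OneForm E M) (x : M) :
    β.pullbackVal (φ 0) x = β.val x := by
  have h : (φ 0 : M → M) = id := funext hφ.map_zero
  have h1 : diffeoDeriv (φ 0) x = ContinuousLinearMap.id ℝ E := by
    rw [diffeoDeriv, h]
    exact mfderiv_id
  rw [OneForm.pullbackVal, h1, hφ.map_zero]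
  rfl

/-- For fixed v, (φ_t^*α_t)(v) solves a scalar linear equation, so it vanishes at one time only if
it vanishes at all. Taking v = R_0, where the value at time 0 is 1, gives a nonvanishing factor;
taking v - α_0(v)R_0, in the kernel of α_0, gives proportionality. -/
theorem pullbackVal_eq_smul (hφ : IsIsotopy φ) (hα : IsSmoothFamily α)
    (hX : IsSmoothField X) (hR : IsSmoothField R)
    (hsol : ∀ x, ∀ t ∈ Icc (0 : ℝ) 1, IsSolAt X (fun s ↦ φ s x) t)
    (hαX : ∀ t ∈ Icc (0 : ℝ) 1, ∀ x, (α t).val x (X t x) = 0)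
    (hd : ∀ t ∈ Icc (0 : ℝ) 1, ∀ x w, (α t).dval x (X t x) w =
      -timeDeriv α t x w + timeDeriv α t x (R t x) * (α t).val x w)
    (hαR : ∀ x, (α 0).val x (R 0 x) = 1) (ht : t ∈ Icc (0 : ℝ) 1) (x : M) :
    (α t).pullbackVal (φ t) x (R 0 x) ≠ 0 ∧
      (α t).pullbackVal (φ t) x = (α t).pullbackVal (φ t) x (R 0 x) • (α 0).val x := by
  have h0 : (0 : ℝ) ∈ Icc (0 : ℝ) 1 := ⟨le_rfl, zero_le_one⟩
  have hlin : ∀ v, ∀ s ∈ Icc (0 : ℝ) 1, (α s).pullbackVal (φ s) x v = 0 →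
      EqOn (fun s ↦ (α s).pullbackVal (φ s) x v) 0 (Icc 0 1) := fun v s hs hv ↦
    eqOn_zero_of_hasDerivWithinAt_mul (continuousOn_timeDeriv_apply hφ hα hR x)
      (fun r hr ↦ hasDerivWithinAt_pullbackVal hφ hα hX hsol hαX hd hr x v) hs hv
  refine ⟨fun h ↦ ?_, ?_⟩
  · have := hlin _ t ht h h0
    simp only [pullbackVal_zero hφ, hαR, Pi.zero_apply, one_ne_zero] at this
  · ext v
    have h1 : (α 0).pullbackVal (φ 0) x (v - (α 0).val x v • R 0 x) = 0 := by
      rw [pullbackVal_zero hφ, map_sub, map_smul, hαR, smul_eq_mul, mul_one, sub_self]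
    have h2 : (α t).pullbackVal (φ t) x (v - (α 0).val x v • R 0 x) = 0 := hlin _ 0 h0 h1 ht
    rw [map_sub, map_smul, sub_eq_zero] at h2
    rw [h2, smul_apply, smul_eq_mul, smul_eq_mul, mul_comm]

end Pullback

end ContactPairs

end

theorem theorem4 {E : Type*} [NormedAddCommGroup E] [NormedSpace ℝ E] [FiniteDimensional ℝ E]
    {M : Type*} [TopologicalSpace M] [ChartedSpace E M] [IsManifold 𝓘(ℝ, E) ∞ M]
    [T2Space M] [CompactSpace M] (h k : ℕ) (α β : ℝ → ContactPairs.OneForm E M)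
    (hα : ContactPairs.IsSmoothFamily α) (hβ : ContactPairs.IsSmoothFamily β)
    (hpair : ∀ t ∈ Icc (0 : ℝ) 1, ContactPairs.IsContactPair h k (α t) (β t))
    (hF : ∀ t ∈ Icc (0 : ℝ) 1, (α t).kerFoliation h = (α 0).kerFoliation h)
    (hG : ∀ t ∈ Icc (0 : ℝ) 1, (β t).kerFoliation k = (β 0).kerFoliation k) :
    ∃ (φ : ℝ → Diffeomorph 𝓘(ℝ, E) 𝓘(ℝ, E) M M ∞) (f g : ℝ → M → ℝ),
      ContactPairs.IsIsotopy φ ∧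
      ContactPairs.IsSmoothFunctionFamily (E := E) f ∧
      ContactPairs.IsSmoothFunctionFamily (E := E) g ∧
      ∀ t ∈ Icc (0 : ℝ) 1, ∀ x : M,
        f t x ≠ 0 ∧ g t x ≠ 0 ∧
        (α t).pullback (φ t) x = f t x • (α 0).at x ∧
        (β t).pullback (φ t) x = g t x • (β 0).at x := by
  open ContactPairs in
  have h0 : (0 : ℝ) ∈ Icc (0 : ℝ) 1 := ⟨le_rfl, zero_le_one⟩
  have hX := isSmoothField_grayField hα hβ hpair
  have hR := isSmoothField_reebField hα hβ hα hpair
  have hS := isSmoothField_reebField hα hβ hβ hpair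
  have hspec := fun t (ht : t ∈ Icc (0 : ℝ) 1) x ↦ grayField_spec hα hβ hpair hF hG ht x
  have hpair0 := fun x ↦ (isLinearContactPair_val hα hβ h0 (hpair 0 h0) x).1
  obtain ⟨φ, hφ, hsol⟩ := exists_isIsotopy hX
  -- The factors f and g are the pullbacks evaluated on the two Reeb fields at time 0.
  refine ⟨φ, _, _, hφ, isSmoothFunctionFamily_pullbackVal hφ hα hR,
    isSmoothFunctionFamily_pullbackVal hφ hβ hS, fun t ht x ↦ ?_⟩
  obtain ⟨hf, hfα⟩ := pullbackVal_eq_smul hφ hα hX hR hsol (fun t ht x ↦ (hspec t ht x).1)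
    (fun t ht x w ↦ (hspec t ht x).2.2.1 w) (fun x ↦ (hpair0 x).reebVector_left.1) ht x
  obtain ⟨hg, hgβ⟩ := pullbackVal_eq_smul hφ hβ hX hS hsol (fun t ht x ↦ (hspec t ht x).2.1)
    (fun t ht x w ↦ (hspec t ht x).2.2.2 w) (fun x ↦ (hpair0 x).reebVector_right.1) ht x
  exact ⟨hf, hg, hfα, hgβ⟩
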